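/- **Setting.** Let $(\Omega,\mathcal F,(\mathcal F_t),\mathbb P)$ be a filtered probability space, in discrete or continuous time with first time $0$ and last time $T$, satisfying the usual conditions, with $\mathcal F_0$ trivial and $\mathcal F_T=\mathcal F$. Let $p,q\in[1,\infty]$ with $\frac1p+\frac1q=1$, let $1\le m\le d$ and $M=\mathbb R^m\times\{0\}^{d-m}$, $M_+=M\cap\mathbb R^d_+$. For a random set $D\subseteq\mathbb R^d$, $L^r_t(D)$ is the set of (classes of) $\mathcal F_t$-measurable $r$-integrable random vectors with values in $D$ a.s., and $L^p:=L^p_T(\mathbb R^d)$, $L^q(D):=L^q_T(D)$. $L^p$ carries the norm topology if $p<\infty$ and the weak* topology if $p=\infty$. Put $M_t=L^p_t(M)$, $M_{t,+}=L^p_t(M_+)$, $M_{t,-}=-M_{t,+}$, $M_t^\perp=L^q_t(M^\perp)$. $C^+$ denotes the positive dual cone, taken in $\mathbb R^d$ if $C\subseteq\mathbb R^d$, and in $L^q_s(\mathbb R^d)$ with the pairing $\mathbb E[v^{\mathsf T}u]$ if $C\subseteq M_s$. Let $(R_t)$ be a dynamic set-valued risk measure: for every $t$, $R_t(X)\subseteq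 M_t$ and $R_t(X)=R_t(X)+M_{t,+}$ for every $X\in L^p$; $R_t(X)\subseteq R_t(Y)$ whenever $Y-X\in L^p_T(\mathbb R^d_+)$; $R_t(X+u)=R_t(X)-u$ for $u\in M_t$; $R_t(0)$ is nonempty, closed and $\mathcal F_t$-decomposable, with $R_t(0)=L^p_t(\tilde R_t(0))$ for an $\mathcal F_t$-measurable random closed set $\tilde R_t(0)$ with $\mathbb P(\tilde R_t(0)=M)=0$. Assume that for every $t$: * $R_t$ is normalized: $R_t(X)=R_t(X)+R_t(0)$ for all $X$; * $R_t$ is conditionally convex: $R_t(\lambda X+(1-\lambda)Y)\supseteq\lambda R_t(X)+(1-\lambda)R_t(Y)$ for all $X,Y\in L^p$ and all $\mathcal F_t$-measurable $\lambda$ with values in $[0,1]$; * $R_t$ is convex upper continuous: $\{X: R_t(X)\cap D\ne\emptyset\}$ is closed for every $D\subseteq M_t$ with $D=\operatorname{cl}\operatorname{co}(D+M_{t,-})$; * the scalarizations $\rho_t^w(X):=\operatorname{ess\,inf}\{w^{\mathsf T}u: u\in R_t(X)\}$ are in $L^1$ for all $X\in L^p$ and $w\in L^q_t(\tilde R_t(0)^+\setminus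 M^\perp)$. The same formula defines $\rho_t^w(X)$ for every $w\in L^q_t(\mathbb R^d)$. Put $A_t=\{X\in L^p: 0\in R_t(X)\}$ and $A_{t,s}=A_t\cap M_s$. **Dual variables.** $\mathcal M^d$ is the set of vectors $\mathbb Q=(\mathbb Q_1,\dots,\mathbb Q_d)$ of probability measures $\mathbb Q_i\ll\mathbb P$. For $s\le r$ let $\bar\xi_{s,r}(\mathbb Q_i)=\mathbb E[\frac{d\mathbb Q_i}{d\mathbb P}|\mathcal F_r]/\mathbb E[\frac{d\mathbb Q_i}{d\mathbb P}|\mathcal F_s]$ where the denominator is positive, and $1$ elsewhere; $w_s^r(\mathbb Q,w)=(w_i\,\bar\xi_{s,r}(\mathbb Q_i))_{i}$, and $\mathbb E^{\mathbb Q}[X|\mathcal F_t]=(\mathbb E[\bar\xi_{t,T}(\mathbb Q_i)X_i|\mathcal F_t])_i$. In products, $0\cdot(\pm\infty)=0$. For $t<s$ define $$\mathcal W_{t,s}(w)=\{(\mathbb Q,m_\perp)\in\mathcal M^d\times M_t^\perp: w+m_\perp\in L^q_t(M_+^+\setminus M^\perp),\ w_t^s(\mathbb Q,w+m_\perp)\in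 M_{s,+}^+\},$$ $$\mathcal W_s(v)=\{(\mathbb S,n_\perp)\in\mathcal M^d\times M_s^\perp: v+n_\perp\in L^q_s(M_+^+),\ w_s^T(\mathbb S,v+n_\perp)\in L^q(\mathbb R^d_+)\},$$ $$\alpha_s(\mathbb S,v)=\operatorname*{ess\,sup}_{Z\in A_s}v^{\mathsf T}\mathbb E^{\mathbb S}[-Z|\mathcal F_s],\qquad \alpha_{t,s}(\mathbb Q,w)=\operatorname*{ess\,sup}_{Z\in A_{t,s}}w^{\mathsf T}\mathbb E^{\mathbb Q}[-Z|\mathcal F_t],$$ $$\beta_{t,s}^w(\mathbb Q,m_\perp,\mathbb S,n_\perp)=\operatorname*{ess\,sup}_{Z\in A_t}\mathbb E\big[w_s^T(\mathbb S,w_t^s(\mathbb Q,w+m_\perp)+n_\perp)^{\mathsf T}(-Z)\,\big|\,\mathcal F_t\big].$$ **Lemma.** Fix times $0\le t<s\le T$. The following are equivalent: 1. $A_t\subseteq A_{t,s}+A_s$; 2. for every $X\in L^p$ and every $w\in L^q_t(\tilde R_t(0)^+\setminus M^\perp)$, almost surely $$\rho_t^w(X)\ \ge\ \operatorname*{ess\,sup}_{\substack{(\mathbb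 Q,m_\perp)\in\mathcal W_{t,s}(w)\\ w_t^s(\mathbb Q,w+m_\perp)\in R_s(0)^+}}\Big(-\alpha_{t,s}(\mathbb Q,w+m_\perp)+\mathbb E\big[\rho_s^{w_t^s(\mathbb Q,w+m_\perp)}(X)\,\big|\,\mathcal F_t\big]\Big);$$ 3. for every $w\in L^q_t(\tilde R_t(0)^+\setminus M^\perp)$, $(\mathbb Q,m_\perp)\in\mathcal W_{t,s}(w)$ and $(\mathbb S,n_\perp)\in\mathcal W_s(w_t^s(\mathbb Q,w+m_\perp))$, almost surely $$\beta_{t,s}^w(\mathbb Q,m_\perp,\mathbb S,n_\perp)\ \le\ \alpha_{t,s}(\mathbb Q,w+m_\perp)+\mathbb E\big[\alpha_s(\mathbb S,w_t^s(\mathbb Q,w+m_\perp)+n_\perp)\,\big|\,\mathcal F_t\big].$$ Likewise, the three conditions obtained by replacing "$\subseteq$" by "$\supseteq$" in 1, "$\ge$" by "$\le$" in 2, and "$\le$" by "$\ge$" in 3 are equivalent. -/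

import Mathlib

open MeasureTheory Set
open scoped ENNReal Pointwise Topology

noncomputable section

namespace MSR

/-! ### Euclidean preliminaries -/

/-- `ℝ^d`. -/
abbrev Vec (d : ℕ) := EuclideanSpace ℝ (Fin d)

/-- The pairing `vᵀu` on `ℝ^d`. -/
def dot {d : ℕ} (v u : Vec d) : ℝ := ∑ i, v i * u i

/-- The nonnegative orthant `ℝ^d_+`. -/
def orthant (d : ℕ) : Set (Vec d) := {x | ∀ i, 0 ≤ x i}

/-- The eligible portfolios `M = ℝ^m × {0}^{d-m}`. -/
def eligible (d m : ℕ) : Set (Vec d) := {x | ∀ i : Fin d, m ≤ i.val → x i = 0}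

/-- The nonnegative eligible portfolios `M_+ = M ∩ ℝ^d_+`. -/
def eligiblePos (d m : ℕ) : Set (Vec d) := eligible d m ∩ orthant d

/-- The orthogonal space `C^⊥`. -/
def perp {d : ℕ} (C : Set (Vec d)) : Set (Vec d) := {v | ∀ u ∈ C, dot v u = 0}

/-- The positive dual cone `C^+` of a subset of `ℝ^d`. -/
def posDual {d : ℕ} (C : Set (Vec d)) : Set (Vec d) := {v | ∀ u ∈ C, 0 ≤ dot v u}

/-! ### Essential supremum and infimum of a family of random variables -/

section EssSup

variable {Ω : Type*} {mΩ : MeasurableSpace Ω}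

/-- `g` is an essential supremum of the family `S` of extended real random variables: the
least measurable function dominating every member of `S` almost surely. -/
def IsEssSup (P : Measure Ω) (S : Set (Ω → EReal)) (g : Ω → EReal) : Prop :=
  Measurable g ∧ (∀ f ∈ S, f ≤ᵐ[P] g) ∧
    ∀ h : Ω → EReal, Measurable h → (∀ f ∈ S, f ≤ᵐ[P] h) → g ≤ᵐ[P] h

theorem exists_isEssSup (P : Measure Ω) [IsFiniteMeasure P] (S : Set (Ω → EReal)) :
    ∃ g, IsEssSup P S g := by
  set H : Set (Ω → EReal) := {h | Measurable h ∧ ∀ f ∈ S, f ≤ᵐ[P] h} with hH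
  have hne : H.Nonempty := ⟨fun _ => ⊤, measurable_const, fun f _ => .of_forall fun _ => le_top⟩
  set φ : EReal → ℝ≥0∞ := fun x => (1 + EReal.exp x)⁻¹ with hφ
  have hφm : Measurable φ := by
    have : Measurable EReal.exp := EReal.measurable_exp
    fun_prop
  have hφanti : StrictAnti φ := fun a b hab =>
    ENNReal.inv_strictAnti ((ENNReal.add_lt_add_iff_left ENNReal.one_ne_top).2 (EReal.exp_strictMono hab))
  have hφle : ∀ x, φ x ≤ 1 := fun x => by
    simp only [hφ]; exact ENNReal.inv_le_one.2 le_self_add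
  set F : (Ω → EReal) → ℝ≥0∞ := fun h => ∫⁻ ω, φ (h ω) ∂P with hF
  obtain ⟨u, -, hu, huH⟩ := exists_seq_tendsto_sSup (hne.image F) (OrderTop.bddAbove _)
  choose h hhH hhu using huH
  have hgH : (fun ω => ⨅ n, h n ω) ∈ H := by
    refine ⟨Measurable.iInf fun n => (hhH n).1, fun f hf => ?_⟩
    filter_upwards [ae_all_iff.2 fun n => (hhH n).2 f hf] with ω hω
    exact le_iInf hω
  have hgmax : sSup (F '' H) ≤ F (fun ω => ⨅ n, h n ω) := by
    refine le_of_tendsto' hu fun n => ?_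
    rw [← hhu n]
    exact lintegral_mono fun ω => hφanti.antitone (iInf_le _ n)
  refine ⟨_, hgH.1, hgH.2, fun k hk hkS => ?_⟩
  set g : Ω → EReal := fun ω => ⨅ n, h n ω with hg
  have hmin : (fun ω => g ω ⊓ k ω) ∈ H := by
    refine ⟨hgH.1.min hk, fun f hf => ?_⟩
    filter_upwards [hgH.2 f hf, hkS f hf] with ω h1 h2 using le_inf h1 h2
  have hle : F (fun ω => g ω ⊓ k ω) ≤ F g := (le_sSup (mem_image_of_mem F hmin)).trans hgmax
  have hfin : F g ≠ ∞ := by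
    refine ne_top_of_le_ne_top (measure_ne_top P univ) ?_
    calc F g ≤ ∫⁻ _, 1 ∂P := lintegral_mono fun ω => hφle _
      _ = P univ := by simp
  have hae := ae_eq_of_ae_le_of_lintegral_le (μ := P) (f := fun ω => φ (g ω))
    (g := fun ω => φ (g ω ⊓ k ω)) (.of_forall fun ω => hφanti.antitone inf_le_left) hfin
    (hφm.comp hmin.1).aemeasurable hle
  filter_upwards [hae] with ω hω
  have := hφanti.injective hω
  exact inf_eq_left.1 this.symm

/-- The essential supremum of a family of random variables (unique up to null sets). -/
def essSupFam (P : Measure Ω) [IsFiniteMeasure P] (S : Set (Ω → EReal)) : Ω → EReal :=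
  (exists_isEssSup P S).choose

/-- The essential infimum of a family of random variables. -/
def essInfFam (P : Measure Ω) [IsFiniteMeasure P] (S : Set (Ω → EReal)) : Ω → EReal :=
  fun ω => -essSupFam P ((fun f ω => -f ω) '' S) ω

/-- The (generalized) conditional expectation `E[f | 𝓖] = E[f⁺ | 𝓖] - E[f⁻ | 𝓖]` of an extended
real random variable. -/
def genCondExp (P : Measure Ω) (𝓖 : MeasurableSpace Ω) (f : Ω → EReal) : Ω → EReal :=
  fun ω => (condLExp 𝓖 P (fun x => (f x).toENNReal) ω : EReal)
    - (condLExp 𝓖 P (fun x => (-f x).toENNReal) ω : EReal)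

/-- An extended real random variable which belongs to `L^1`. -/
def MemL1 (P : Measure Ω) (f : Ω → EReal) : Prop :=
  ∃ g : Ω → ℝ, Integrable g P ∧ f =ᵐ[P] fun ω => (g ω : EReal)

end EssSup

section Spaces

variable {Ω ι : Type*} {mΩ : MeasurableSpace Ω} [LinearOrder ι] [OrderBot ι] [OrderTop ι]

/-- The standing assumptions on the filtration: usual conditions (right-continuous, `𝓕_0` contains
all null sets), `𝓕_0` is trivial (up to null sets), `𝓕_T = 𝓕`. The time set has least element
`0 = ⊥` and greatest element `T = ⊤`. -/
structure StandardFiltration (ℱ : Filtration ι mΩ) (P : Measure Ω) : Prop where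
  rightCont : ℱ.IsRightContinuous
  complete : ∀ B : Set Ω, P B = 0 → MeasurableSet[ℱ ⊥] B
  trivial : ∀ B : Set Ω, MeasurableSet[ℱ ⊥] B → P B = 0 ∨ P B = 1
  terminal : ℱ ⊤ = mΩ

/-- `L^r_t(D)`: the `𝓕_t`-measurable random vectors in `L^r` with values in the random set `D`. -/
def LSel {d : ℕ} (ℱ : Filtration ι mΩ) (P : Measure Ω) (r : ℝ≥0∞) (t : ι) (D : Ω → Set (Vec d)) :
    Set (Ω → Vec d) :=
  {X | MemLp X r P ∧ AEStronglyMeasurable[ℱ t] X P ∧ ∀ᵐ ω ∂P, X ω ∈ D ω}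

/-- `L^p_t(D)` as a set of equivalence classes in `L^p`. -/
def LpSel {d : ℕ} {p : ℝ≥0∞} (ℱ : Filtration ι mΩ) (P : Measure Ω) (t : ι)
    (D : Ω → Set (Vec d)) : Set (Lp (Vec d) p P) :=
  {X | ⇑X ∈ LSel ℱ P p t D}

/-- The topology on `L^p`: norm topology if `p < ∞`, and the weak* topology `σ(L^∞, L^1)` if
`p = ∞`. -/
def lpTop (d : ℕ) (p : ℝ≥0∞) [Fact (1 ≤ p)] (P : Measure Ω) :
    TopologicalSpace (Lp (Vec d) p P) :=
  open Classical in
  if p = ∞ then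
    TopologicalSpace.induced
      (fun (X : Lp (Vec d) p P) (Y : {Y : Ω → Vec d // MemLp Y 1 P}) =>
        ∫ ω, dot (Y.1 ω) (X ω) ∂P) Pi.topologicalSpace
  else inferInstance

/-- A family of random vectors is `𝓖`-decomposable: it is stable under pasting along finite
`𝓖`-measurable partitions. -/
def Decomposable {d : ℕ} {p : ℝ≥0∞} {P : Measure Ω} (𝓖 : MeasurableSpace Ω)
    (S : Set (Lp (Vec d) p P)) : Prop :=
  ∀ (N : ℕ) (B : Fin N → Set Ω) (X : Fin N → Lp (Vec d) p P) (Z : Lp (Vec d) p P),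
    (∀ n, MeasurableSet[𝓖] (B n)) → Pairwise (fun i j => Disjoint (B i) (B j)) →
    (⋃ n, B n) = univ → (∀ n, X n ∈ S) →
    (∀ᵐ ω ∂P, ∀ n, ω ∈ B n → Z ω = X n ω) → Z ∈ S

end Spaces

/-! ### Set-valued risk measures -/

section RiskMeasures

variable {Ω ι : Type*} {mΩ : MeasurableSpace Ω} [LinearOrder ι] [OrderBot ι] [OrderTop ι]
  {d : ℕ} {p : ℝ≥0∞}

/-- `M_t = L^p_t(M)`. -/
def Mt (ℱ : Filtration ι mΩ) (P : Measure Ω) (m : ℕ) (t : ι) : Set (Lp (Vec d) p P) :=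
  LpSel ℱ P t fun _ => eligible d m

/-- `M_{t,+} = L^p_t(M_+)`. -/
def MtPos (ℱ : Filtration ι mΩ) (P : Measure Ω) (m : ℕ) (t : ι) : Set (Lp (Vec d) p P) :=
  LpSel ℱ P t fun _ => eligiblePos d m

/-- `R` is a conditional risk measure at time `t`, and `R0` is the random set `R̃_t(0)`, that is,
the `𝓕_t`-measurable random closed set (unique up to null sets) with `R(0) = L^p_t(R0)`. -/
structure IsConditionalRiskMeasure [Fact (1 ≤ p)] (ℱ : Filtration ι mΩ) (P : Measure Ω) (m : ℕ)
    (t : ι) (R : Lp (Vec d) p P → Set (Lp (Vec d) p P)) (R0 : Ω → Set (Vec d)) : Prop where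
  subset_Mt : ∀ X, R X ⊆ Mt ℱ P m t
  upper : ∀ X, R X = R X + MtPos ℱ P m t
  monotone : ∀ X Y, Y - X ∈ LpSel ℱ P ⊤ (fun _ => orthant d) → R X ⊆ R Y
  translative : ∀ X, ∀ u ∈ Mt ℱ P m t, R (X + u) = (fun v => v - u) '' R X
  zero_nonempty : (R 0).Nonempty
  zero_closed : IsClosed[lpTop d p P] (R 0)
  zero_decomposable : Decomposable (ℱ t) (R 0)
  zeroSet_closed : ∀ ω, IsClosed (R0 ω)
  zeroSet_measurable : ∀ U : Set (Vec d), IsOpen U → MeasurableSet[ℱ t] {ω | (R0 ω ∩ U).Nonempty}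
  zero_eq : R 0 = LpSel ℱ P t R0
  zeroSet_ne : ∀ᵐ ω ∂P, R0 ω ≠ eligible d m

/-- `R` is normalized. -/
def IsNormalized {P : Measure Ω} (R : Lp (Vec d) p P → Set (Lp (Vec d) p P)) : Prop :=
  ∀ X, R X = R X + R 0

/-- `R` is conditionally convex at time `t`: `R(λX + (1-λ)Y) ⊇ λ R(X) + (1-λ) R(Y)` for all
`𝓕_t`-measurable `λ` with values in `[0,1]`. -/
def IsConditionallyConvex (ℱ : Filtration ι mΩ) (P : Measure Ω) (t : ι)
    (R : Lp (Vec d) p P → Set (Lp (Vec d) p P)) : Prop :=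
  ∀ (l : Ω → ℝ), StronglyMeasurable[ℱ t] l → (∀ ω, l ω ∈ Icc (0 : ℝ) 1) →
    ∀ X Y u v Z z : Lp (Vec d) p P, u ∈ R X → v ∈ R Y →
      (∀ᵐ ω ∂P, Z ω = l ω • X ω + (1 - l ω) • Y ω) →
      (∀ᵐ ω ∂P, z ω = l ω • u ω + (1 - l ω) • v ω) → z ∈ R Z

/-- `D ∈ 𝒢(M_t; M_{t,-})`: `D ⊆ M_t` and `D = cl co (D + M_{t,-})`. -/
def IsLowerClosedConvex [Fact (1 ≤ p)] (ℱ : Filtration ι mΩ) (P : Measure Ω) (m : ℕ) (t : ι)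
    (D : Set (Lp (Vec d) p P)) : Prop :=
  D ⊆ Mt ℱ P m t ∧ D = @closure _ (lpTop d p P) (convexHull ℝ (D + -MtPos ℱ P m t))

/-- `R` is convex upper continuous: `R^-[D] = {X | R(X) ∩ D ≠ ∅}` is closed for every
`D ∈ 𝒢(M_t; M_{t,-})`. -/
def IsCUC [Fact (1 ≤ p)] (ℱ : Filtration ι mΩ) (P : Measure Ω) (m : ℕ) (t : ι)
    (R : Lp (Vec d) p P → Set (Lp (Vec d) p P)) : Prop :=
  ∀ D, IsLowerClosedConvex ℱ P m t D → IsClosed[lpTop d p P] {X | (R X ∩ D).Nonempty}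

/-- The acceptance set `A_t = {X | 0 ∈ R_t(X)}`. -/
def acceptance {P : Measure Ω} (R : Lp (Vec d) p P → Set (Lp (Vec d) p P)) :
    Set (Lp (Vec d) p P) :=
  {X | 0 ∈ R X}

/-- The stepped acceptance set `A_{t,s} = A_t ∩ M_s`, where `R = R_t`. -/
def steppedAcceptance (ℱ : Filtration ι mΩ) (P : Measure Ω) (m : ℕ) (s : ι)
    (R : Lp (Vec d) p P → Set (Lp (Vec d) p P)) : Set (Lp (Vec d) p P) :=
  acceptance R ∩ Mt ℱ P m s

/-- The scalarization `ρ^w(X) = ess inf {wᵀu | u ∈ R(X)}`. -/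
def scalarization (P : Measure Ω) [IsFiniteMeasure P]
    (R : Lp (Vec d) p P → Set (Lp (Vec d) p P)) (w : Ω → Vec d) (X : Lp (Vec d) p P) :
    Ω → EReal :=
  essInfFam P {g | ∃ u ∈ R X, g = fun ω => (dot (w ω) (u ω) : EReal)}

/-! ### Dual variables and penalty functions -/

/-- `Q` is a vector of probability measures absolutely continuous with respect to `P`. -/
def IsVecProb (P : Measure Ω) (Q : Fin d → Measure Ω) : Prop :=
  ∀ i, IsProbabilityMeasure (Q i) ∧ Q i ≪ P

/-- The conditional density `E[dQ/dP | 𝓖]`. -/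
def condDensity (P : Measure Ω) (𝓖 : MeasurableSpace Ω) (Q : @Measure Ω mΩ) : Ω → ℝ :=
  condExp 𝓖 P fun ω => (Q.rnDeriv P ω).toReal

/-- `ξ̄_{s,r}(Q) = E[dQ/dP | 𝓕_r] / E[dQ/dP | 𝓕_s]` where the denominator is positive, `1`
elsewhere. -/
def xi (ℱ : Filtration ι mΩ) (P : Measure Ω) (s r : ι) (Q : Measure Ω) (ω : Ω) : ℝ :=
  open Classical in
  if 0 < condDensity P (ℱ s) Q ω then condDensity P (ℱ r) Q ω / condDensity P (ℱ s) Q ω else 1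

/-- `w_t^s(Q,w) = diag(w) ξ_{t,s}(Q)`. -/
def wStep (ℱ : Filtration ι mΩ) (P : Measure Ω) (t s : ι) (Q : Fin d → Measure Ω)
    (w : Ω → Vec d) (ω : Ω) : Vec d :=
  WithLp.toLp 2 fun i => w ω i * xi ℱ P t s (Q i) ω

/-- The `P`-almost sure version of the `i`-th component of `E_Q[X | 𝓕_t]`, namely
`E[ξ̄_{t,T}(Q_i) X_i | 𝓕_t]`. -/
def QCondExp (ℱ : Filtration ι mΩ) (P : Measure Ω) (t : ι) (Q : Fin d → Measure Ω)
    (X : Ω → Vec d) (i : Fin d) : Ω → EReal :=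
  genCondExp P (ℱ t) fun ω => ((xi ℱ P t ⊤ (Q i) ω * X ω i : ℝ) : EReal)

/-- `wᵀ E_Q[X | 𝓕_t]`, with `0 · (±∞) = 0`. -/
def dotQCondExp (ℱ : Filtration ι mΩ) (P : Measure Ω) (t : ι) (Q : Fin d → Measure Ω)
    (w X : Ω → Vec d) (ω : Ω) : EReal :=
  ∑ i, (w ω i : EReal) * QCondExp ℱ P t Q X i ω

/-- The positive dual cone `C^+ ⊆ L^q_s` of a set `C` in `L^p_s`. -/
def dualCone (ℱ : Filtration ι mΩ) (P : Measure Ω) (q : ℝ≥0∞) (s : ι)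
    (C : Set (Lp (Vec d) p P)) : Set (Ω → Vec d) :=
  {v | v ∈ LSel ℱ P q s (fun _ => univ) ∧ ∀ u ∈ C, 0 ≤ ∫ ω, dot (v ω) (u ω) ∂P}

/-- The stepped dual variables `𝒲_{t,s}`; here `p` is the exponent of the primal space and `q` the
conjugate exponent. -/
def dualStepped (ℱ : Filtration ι mΩ) (P : Measure Ω) (p q : ℝ≥0∞) (m : ℕ) (t s : ι) :
    Set ((Fin d → Measure Ω) × (Ω → Vec d)) :=
  {x | IsVecProb P x.1 ∧
    x.2 ∈ LSel ℱ P q t (fun _ => posDual (eligiblePos d m) \ perp (eligible d m)) ∧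
    wStep ℱ P t s x.1 x.2 ∈ dualCone ℱ P q s (MtPos ℱ P m s : Set (Lp (Vec d) p P))}

/-- The terminal dual variables `𝒲_s`, where the second component may take values in `M^⊥`. -/
def dualTerminal (ℱ : Filtration ι mΩ) (P : Measure Ω) (q : ℝ≥0∞) (m : ℕ) (s : ι) :
    Set ((Fin d → Measure Ω) × (Ω → Vec d)) :=
  {x | IsVecProb P x.1 ∧
    x.2 ∈ LSel ℱ P q s (fun _ => posDual (eligiblePos d m)) ∧
    wStep ℱ P s ⊤ x.1 x.2 ∈ LSel ℱ P q ⊤ (fun _ => orthant d)}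

/-- `𝒲_{t,s}(w) = {(Q, m_⊥) ∈ 𝓜^d × M_t^⊥ | (Q, w + m_⊥) ∈ 𝒲_{t,s}}`. -/
def dualSteppedAt (ℱ : Filtration ι mΩ) (P : Measure Ω) (p q : ℝ≥0∞) (m : ℕ) (t s : ι)
    (w : Ω → Vec d) : Set ((Fin d → Measure Ω) × (Ω → Vec d)) :=
  {x | x.2 ∈ LSel ℱ P q t (fun _ => perp (eligible d m)) ∧
    (x.1, w + x.2) ∈ dualStepped ℱ P p q m t s}

/-- `𝒲_s(v) = {(R, n_⊥) ∈ 𝓜^d × M_s^⊥ | (R, v + n_⊥) ∈ 𝒲_s}`. -/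
def dualTerminalAt (ℱ : Filtration ι mΩ) (P : Measure Ω) (q : ℝ≥0∞) (m : ℕ) (s : ι)
    (v : Ω → Vec d) : Set ((Fin d → Measure Ω) × (Ω → Vec d)) :=
  {x | x.2 ∈ LSel ℱ P q s (fun _ => perp (eligible d m)) ∧
    (x.1, v + x.2) ∈ dualTerminal ℱ P q m s}

/-- The penalty function `ess sup {wᵀ E_Q[-Z | 𝓕_t] | Z ∈ A}`; it is `α_t(Q,w)` for `A = A_t` and
`α_{t,s}(Q,w)` for `A = A_{t,s}`. -/
def penalty (ℱ : Filtration ι mΩ) (P : Measure Ω) [IsFiniteMeasure P] (t : ι)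
    (A : Set (Lp (Vec d) p P)) (Q : Fin d → Measure Ω) (w : Ω → Vec d) : Ω → EReal :=
  essSupFam P {g | ∃ Z ∈ A, g = dotQCondExp ℱ P t Q w fun ω => -Z ω}

/-- The penalty function `β_{t,s}^w(Q, m_⊥, R, n_⊥)
= ess sup {E[w_s^T(R, w_t^s(Q, w + m_⊥) + n_⊥)ᵀ (-Z) | 𝓕_t] | Z ∈ A}` for `A = A_t`. -/
def extendedPenalty (ℱ : Filtration ι mΩ) (P : Measure Ω) [IsFiniteMeasure P] (t s : ι)
    (A : Set (Lp (Vec d) p P)) (w : Ω → Vec d) (Q : Fin d → Measure Ω) (mperp : Ω → Vec d)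
    (R : Fin d → Measure Ω) (nperp : Ω → Vec d) : Ω → EReal :=
  essSupFam P {g | ∃ Z ∈ A, g = genCondExp P (ℱ t) fun ω =>
    (dot (wStep ℱ P s ⊤ R (wStep ℱ P t s Q (w + mperp) + nperp) ω) (-Z ω) : EReal)}

/-- The right-hand side of the recursive formulation: the essential supremum of
`-α_{t,s}(Q, w + m_⊥) + E[ρ_s^{w_t^s(Q, w + m_⊥)}(X) | 𝓕_t]` over `(Q, m_⊥) ∈ 𝒲_{t,s}(w)` with
`w_t^s(Q, w + m_⊥) ∈ R_s(0)^+`. -/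
def recursiveBound (ℱ : Filtration ι mΩ) (P : Measure Ω) [IsFiniteMeasure P] (q : ℝ≥0∞) (m : ℕ)
    (t s : ι) (Rt Rs : Lp (Vec d) p P → Set (Lp (Vec d) p P)) (w : Ω → Vec d)
    (X : Lp (Vec d) p P) : Ω → EReal :=
  essSupFam P {g | ∃ (Q : Fin d → Measure Ω) (mperp : Ω → Vec d),
    (Q, mperp) ∈ dualSteppedAt ℱ P p q m t s w ∧
    wStep ℱ P t s Q (w + mperp) ∈ dualCone ℱ P q s (Rs 0) ∧
    g = fun ω => -penalty ℱ P t (steppedAcceptance ℱ P m s Rt) Q (w + mperp) ω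
      + genCondExp P (ℱ t) (scalarization P Rs (wStep ℱ P t s Q (w + mperp)) X) ω}

end RiskMeasures

end MSR

end

open MSR

/-! Everything reduces to one nonnegative density `v` in `L^q`. A choice of `(Q, m_⊥, S, n_⊥)`
enters the penalties only through `v = w_s^T(S, w_t^s(Q, w + m_⊥) + n_⊥)`: the three penalties are
essential suprema of the conditional losses `E[vᵀ(-Z) | 𝓕]` over `A_t`, `A_{t,s}` and `A_s`
(`penalties_eq`). Conversely, every nonnegative `v` whose conditional expectation at `t` is a weight
arises in this way (`exists_dual_variables`).

The reduction relies on a rigidity fact. Normalization and conditional convexity make `R(0)` a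
closed convex cone, and convex upper continuity then forces `R(0) = M_+` at each time
(`zero_eq_MtPos`). A larger cone would allow a curve in `M` that comes arbitrarily close to the cone
without meeting it; lowered by `M_+`, the curve is a set that violates upper continuity. Hence the
weights are those of `M_+^+ \ M^⊥`, and the side condition `w_t^s(Q, w + m_⊥) ∈ R_s(0)^+` is already
contained in `𝒲_{t,s}(w)`.

From an inclusion of acceptance sets to inequalities one decomposes positions or takes suprema:
acceptance sets are stable under pasting, so penalties are increasing limits of conditional losses
(`exists_seq_pen`), and `α_{t,s} + E[α_s | 𝓕_t]` is the supremum of the losses over `A_{t,s} + A_s`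
(`exists_seq_pen_add`).

In the other direction one separates. The sum `A_{t,s} + A_s` is closed because it is the set of `X`
for which `R_s(X)` meets `-A_{t,s}` (`isClosed_acceptance_add`). A point outside it is separated by
some `v`, which can be altered off an `𝓕_t`-measurable set so that its conditional expectation
becomes a weight (`RegularRiskMeasure.exists_separating_density`). The scalarizations are tied to
the penalties by weak duality (`RegularRiskMeasure.weak_duality`) and, up to `ε` in expectation, by
a dual density (`RegularRiskMeasure.exists_dual`). -/

namespace MSR

/-! ### The pairing between `L^p` and `L^q`. -/

section Pairing

variable {Ω : Type*} {mΩ : MeasurableSpace Ω} {P : Measure Ω} {d : ℕ} {p q : ℝ≥0∞}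

theorem dot_eq_inner (v u : Vec d) : dot v u = inner ℝ v u := by
  simp only [dot, PiLp.inner_apply, RCLike.inner_apply, conj_trivial]
  exact Finset.sum_congr rfl fun i _ => mul_comm _ _

@[simp] theorem dot_add_right (v a b : Vec d) : dot v (a + b) = dot v a + dot v b := by
  simp [dot_eq_inner, inner_add_right]

@[simp] theorem dot_neg_right (v a : Vec d) : dot v (-a) = -dot v a := by
  simp [dot_eq_inner]

@[simp] theorem dot_smul_right (v a : Vec d) (c : ℝ) : dot v (c • a) = c * dot v a := by
  simp [dot_eq_inner, inner_smul_right]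

@[simp] theorem dot_smul_left (v a : Vec d) (c : ℝ) : dot (c • v) a = c * dot v a := by
  simp [dot_eq_inner, inner_smul_left]

@[simp] theorem dot_zero_right (v : Vec d) : dot v 0 = 0 := by simp [dot_eq_inner]

@[simp] theorem dot_zero_left (v : Vec d) : dot 0 v = 0 := by simp [dot_eq_inner]

theorem dot_single (v : Vec d) (i : Fin d) (a : ℝ) :
    dot v (EuclideanSpace.single i a) = v i * a := by
  simp [dot_eq_inner, EuclideanSpace.inner_single_right, mul_comm]

theorem aestronglyMeasurable_coord {m : MeasurableSpace Ω} {v : Ω → Vec d}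
    (hv : AEStronglyMeasurable[m] v P) (i : Fin d) :
    AEStronglyMeasurable[m] (fun ω => v ω i) P :=
  (show Continuous fun x : Vec d => x i by fun_prop).comp_aestronglyMeasurable hv

theorem aestronglyMeasurable_of_coord {m : MeasurableSpace Ω} {v : Ω → Vec d}
    (hv : ∀ i, AEStronglyMeasurable[m] (fun ω => v ω i) P) :
    AEStronglyMeasurable[m] v P := by
  refine ⟨fun ω => WithLp.toLp 2 fun i => (hv i).mk _ ω, ?_, ?_⟩
  · have h : @Measurable _ _ m _ fun ω i => (hv i).mk _ ω :=
      measurable_pi_iff.2 fun i => (hv i).stronglyMeasurable_mk.measurable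
    exact (PiLp.continuous_toLp 2 (fun _ : Fin d => ℝ)).comp_stronglyMeasurable
      h.stronglyMeasurable
  · filter_upwards [ae_all_iff.2 fun i => (hv i).ae_eq_mk] with ω h
    ext i
    exact h i

theorem memLp_coord {v : Ω → Vec d} {r : ℝ≥0∞} (hv : MemLp v r P) (i : Fin d) :
    MemLp (fun ω => v ω i) r P :=
  hv.of_le (aestronglyMeasurable_coord hv.1 i) (.of_forall fun ω => PiLp.norm_apply_le (v ω) i)

theorem memLp_of_coord {v : Ω → Vec d} {r : ℝ≥0∞} (hv : ∀ i, MemLp (fun ω => v ω i) r P) :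
    MemLp v r P := by
  have h : MemLp (fun ω => ∑ i, ‖v ω i‖) r P := memLp_finsetSum _ fun i _ => (hv i).norm
  refine h.of_le (aestronglyMeasurable_of_coord fun i => (hv i).1) (.of_forall fun ω => ?_)
  have h0 : ‖v ω‖ ≤ ∑ i, ‖v ω i‖ := by
    have : v ω = ∑ i, EuclideanSpace.single i (v ω i) := by
      ext j; simp [Finset.sum_apply, Pi.single_apply]
    rw [this]
    refine (norm_sum_le _ _).trans (Finset.sum_le_sum fun i _ => ?_)
    simp [Finset.sum_apply, Pi.single_apply]
  exact h0.trans (le_abs_self _)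

theorem integrable_dot [p.HolderConjugate q] {v Z : Ω → Vec d} (hv : MemLp v q P)
    (hZ : MemLp Z p P) : Integrable (fun ω => dot (v ω) (Z ω)) P := by
  simp only [dot]
  have : q.HolderConjugate p := ENNReal.HolderConjugate.symm
  exact integrable_finsetSum _ fun i _ => (memLp_coord hv i).integrable_mul (memLp_coord hZ i)

/-- The pairing of a random vector with an element of `L^p`. -/
noncomputable def pair (P : Measure Ω) (v : Ω → Vec d) (Z : Lp (Vec d) p P) : ℝ :=
  ∫ ω, dot (v ω) (Z ω) ∂P

section

variable [p.HolderConjugate q] {v : Ω → Vec d}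

theorem integrable_dot_Lp (hv : MemLp v q P) (Z : Lp (Vec d) p P) :
    Integrable (fun ω => dot (v ω) (Z ω)) P := integrable_dot hv (Lp.memLp Z)

theorem pair_add (hv : MemLp v q P) (Y Z : Lp (Vec d) p P) :
    pair P v (Y + Z) = pair P v Y + pair P v Z := by
  rw [pair, pair, pair, ← integral_add (integrable_dot_Lp hv Y) (integrable_dot_Lp hv Z)]
  refine integral_congr_ae ?_
  filter_upwards [Lp.coeFn_add Y Z] with ω h
  rw [h, Pi.add_apply, dot_add_right]

theorem pair_neg (Z : Lp (Vec d) p P) : pair P v (-Z) = -pair P v Z := by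
  rw [pair, pair, ← integral_neg]
  refine integral_congr_ae ?_
  filter_upwards [Lp.coeFn_neg Z] with ω h
  rw [h, Pi.neg_apply, dot_neg_right]

theorem pair_sub (hv : MemLp v q P) (Y Z : Lp (Vec d) p P) :
    pair P v (Y - Z) = pair P v Y - pair P v Z := by
  rw [sub_eq_add_neg, pair_add hv, pair_neg, sub_eq_add_neg]

theorem pair_smul (c : ℝ) (Z : Lp (Vec d) p P) : pair P v (c • Z) = c * pair P v Z := by
  rw [pair, pair, ← integral_const_mul]
  refine integral_congr_ae ?_
  filter_upwards [Lp.coeFn_smul c Z] with ω h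
  rw [h, Pi.smul_apply, dot_smul_right]

theorem pair_zero : pair P v (0 : Lp (Vec d) p P) = 0 := by
  simpa using pair_smul (P := P) (v := v) (0 : ℝ) (0 : Lp (Vec d) p P)

/-- The pairing as a linear functional. -/
noncomputable def pairLin (hv : MemLp v q P) : Lp (Vec d) p P →ₗ[ℝ] ℝ where
  toFun := pair P v
  map_add' := pair_add hv
  map_smul' := fun c Z => pair_smul c Z

theorem continuous_pair_norm [Fact (1 ≤ p)] (hv : MemLp v q P) :
    Continuous (fun Z : Lp (Vec d) p P => pair P v Z) := by
  have : q.HolderConjugate p := ENNReal.HolderConjugate.symm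
  have : Fact (1 ≤ q) := ⟨ENNReal.HolderConjugate.one_le q p⟩
  have h := ((innerSL ℝ (E := Vec d)).lpPairing P q p (hv.toLp v)).continuous
  refine h.congr fun Z => ?_
  rw [ContinuousLinearMap.lpPairing_eq_integral, pair]
  refine integral_congr_ae ?_
  filter_upwards [hv.coeFn_toLp] with ω hω
  rw [hω, dot_eq_inner, innerSL_apply_apply]

end

/-! ### The topology on `L^p`, and weak* separation in `L^∞`. -/

section Topology

variable [Fact (1 ≤ p)]

theorem lpTop_of_ne_top (hp : p ≠ ∞) :
    lpTop d p P = (inferInstance : TopologicalSpace (Lp (Vec d) p P)) := by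
  simp [lpTop, hp]

/-- The linear map defining the weak* topology on `L^∞`. -/
noncomputable def weakStarMap (d : ℕ) (P : Measure Ω) :
    Lp (Vec d) ∞ P →ₗ[ℝ] ({Y : Ω → Vec d // MemLp Y 1 P} → ℝ) :=
  LinearMap.pi fun Y => pairLin (p := ∞) (q := 1) Y.2

theorem lpTop_top : lpTop d ∞ P =
    TopologicalSpace.induced (weakStarMap d P) Pi.topologicalSpace := by
  simp only [lpTop, if_true]
  rfl

theorem lpTop_isTopologicalAddGroup :
    @IsTopologicalAddGroup (Lp (Vec d) p P) (lpTop d p P) _ := by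
  by_cases hp : p = ∞
  · subst hp
    rw [lpTop_top]
    exact topologicalAddGroup_induced (weakStarMap d P)
  · rw [lpTop_of_ne_top hp]; infer_instance

theorem lpTop_continuousSMul :
    @ContinuousSMul ℝ (Lp (Vec d) p P) _ _ (lpTop d p P) := by
  by_cases hp : p = ∞
  · subst hp
    rw [lpTop_top]
    exact continuousSMul_induced (weakStarMap d P)
  · rw [lpTop_of_ne_top hp]; infer_instance

theorem continuous_pair [p.HolderConjugate q] {v : Ω → Vec d} (hv : MemLp v q P) :
    @Continuous _ _ (lpTop d p P) _ (fun Z : Lp (Vec d) p P => pair P v Z) := by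
  by_cases hp : p = ∞
  · subst hp
    obtain rfl : q = 1 := ENNReal.HolderConjugate.unique ∞ q 1
    rw [lpTop_top]
    have h : Continuous fun f : {Y : Ω → Vec d // MemLp Y 1 P} → ℝ => f ⟨v, hv⟩ :=
      continuous_apply _
    change @Continuous _ _ (TopologicalSpace.induced (weakStarMap d P) Pi.topologicalSpace) _
      ((fun f : {Y : Ω → Vec d // MemLp Y 1 P} → ℝ => f ⟨v, hv⟩) ∘ weakStarMap d P)
    exact @Continuous.comp _ _ _ (TopologicalSpace.induced (weakStarMap d P) Pi.topologicalSpace)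
      _ _ _ _ h continuous_induced_dom
  · rw [lpTop_of_ne_top hp]; exact continuous_pair_norm hv

theorem isClosed_le_pair [p.HolderConjugate q] {v : Ω → Vec d} (hv : MemLp v q P) (c : ℝ) :
    IsClosed[lpTop d p P] {Z : Lp (Vec d) p P | c ≤ pair P v Z} := by
  let _ := lpTop d p P
  exact isClosed_le continuous_const (continuous_pair hv)

theorem isClosed_pair_le [p.HolderConjugate q] {v : Ω → Vec d} (hv : MemLp v q P) (c : ℝ) :
    IsClosed[lpTop d p P] {Z : Lp (Vec d) p P | pair P v Z ≤ c} := by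
  let _ := lpTop d p P
  exact isClosed_le (continuous_pair hv) continuous_const

theorem isClosed_pair_eq [p.HolderConjugate q] {v : Ω → Vec d} (hv : MemLp v q P) (c : ℝ) :
    IsClosed[lpTop d p P] {Z : Lp (Vec d) p P | pair P v Z = c} := by
  let _ := lpTop d p P
  exact isClosed_eq (continuous_pair hv) continuous_const

/-- Separation of a point from a weak* closed convex subset of `L^∞`. -/
theorem exists_separation_top {S : Set (Lp (Vec d) ∞ P)} (hS : Convex ℝ S)
    (hc : IsClosed[lpTop d ∞ P] S) {X : Lp (Vec d) ∞ P} (hX : X ∉ S) :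
    ∃ v : Ω → Vec d, MemLp v 1 P ∧ ∃ K, pair P v X < K ∧ ∀ Z ∈ S, K ≤ pair P v Z := by
  let _ := lpTop d ∞ P
  have hnhds : Sᶜ ∈ 𝓝 X := hc.isOpen_compl.mem_nhds hX
  have hle : @nhds _ (lpTop d ∞ P) X = Filter.comap (weakStarMap d P) (𝓝 (weakStarMap d P X)) := by
    rw [lpTop_top, nhds_induced]
  change Sᶜ ∈ @nhds _ (lpTop d ∞ P) X at hnhds
  rw [hle, Filter.mem_comap] at hnhds
  obtain ⟨U, hU, hUS⟩ := hnhds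
  rw [nhds_pi, Filter.mem_pi] at hU
  obtain ⟨I, hI, t, ht, hIt⟩ := hU
  have := hI.fintype
  classical
  -- A basic weak* neighbourhood involves only the finitely many functionals in `I`, so the
  -- separation can be done in the finite-dimensional space `ℝ^I`, for the closure of the image of
  -- `S`.
  set F : Lp (Vec d) ∞ P →ₗ[ℝ] (I → ℝ) := LinearMap.pi fun Y => pairLin (p := ∞) (q := 1) Y.1.2
  have hFX : F X ∉ closure (F '' S) := by
    intro hcl
    have hmem : Set.pi univ (fun i : I => t i.1) ∈ 𝓝 (F X) :=
      set_pi_mem_nhds finite_univ fun i _ => ht i.1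
    obtain ⟨_, hx, Z, hZ, rfl⟩ := mem_closure_iff_nhds.1 hcl _ hmem
    exact hUS (show weakStarMap d P Z ∈ U from hIt fun i hi => hx ⟨i, hi⟩ trivial) hZ
  obtain ⟨f, K, h1, h2⟩ := geometric_hahn_banach_point_closed
    (hS.linear_image F).closure isClosed_closure hFX
  -- A functional on `ℝ^I` is a combination of coordinates, hence `f ∘ F` is the pairing with the
  -- same combination of the `L^1` densities.
  have hv : MemLp (fun ω => ∑ i : I, f (Pi.single i 1) • i.1.1 ω) 1 P :=
    memLp_finsetSum _ fun i _ => i.1.2.const_smul (f (Pi.single i 1))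
  have hf : ∀ Z, pair P (fun ω => ∑ i : I, f (Pi.single i 1) • i.1.1 ω) Z = f (F Z) := by
    intro Z
    have e1 : f (F Z) = ∑ i : I, f (Pi.single i 1) * F Z i := by
      conv_lhs => rw [← Finset.univ_sum_single (F Z), map_sum]
      refine Finset.sum_congr rfl fun i _ => ?_
      rw [show Pi.single i (F Z i) = F Z i • (Pi.single i 1 : I → ℝ) by
        rw [← Pi.single_smul, smul_eq_mul, mul_one], map_smul, smul_eq_mul, mul_comm]
    rw [e1, pair]
    have e2 : ∀ ω, dot (∑ i : I, f (Pi.single i 1) • i.1.1 ω) (Z ω)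
        = ∑ i : I, f (Pi.single i 1) * dot (i.1.1 ω) (Z ω) := fun ω => by
      simp [dot_eq_inner, sum_inner, inner_smul_left]
    simp only [e2]
    rw [integral_finsetSum _ fun i _ => (integrable_dot_Lp i.1.2 Z).const_mul _]
    exact Finset.sum_congr rfl fun i _ => integral_const_mul _ _
  exact ⟨_, hv, K, by rw [hf]; exact h1, fun Z hZ => by
    rw [hf]; exact (h2 _ (subset_closure ⟨Z, hZ, rfl⟩)).le⟩

end Topology

end Pairing

/-! ### Riesz representation on `L^p` for `p < ∞`, and separation for all `p`. -/

section Riesz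

variable {Ω : Type*} {mΩ : MeasurableSpace Ω} {P : Measure Ω} {d : ℕ}
  {p q : ℝ≥0∞} [Fact (1 ≤ p)]

/-- Multiplication by an indicator as a continuous linear map of `L^p`. -/
theorem exists_indicatorCLM {A : Set Ω} (hA : MeasurableSet A) :
    ∃ T : Lp (Vec d) p P →L[ℝ] Lp (Vec d) p P, (∀ f, T f =ᵐ[P] A.indicator f) ∧ ∀ f, ‖T f‖ ≤ ‖f‖ := by
  let T : Lp (Vec d) p P →ₗ[ℝ] Lp (Vec d) p P :=
    { toFun := fun f => ((Lp.memLp f).indicator hA).toLp _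
      map_add' := fun f g => by
        rw [← MemLp.toLp_add]
        refine MemLp.toLp_congr _ _ ?_
        filter_upwards [Lp.coeFn_add f g] with ω h
        by_cases hω : ω ∈ A
        · simp only [Pi.add_apply, indicator_of_mem hω, h]
        · simp only [Pi.add_apply, indicator_of_notMem hω, add_zero]
      map_smul' := fun c f => by
        rw [RingHom.id_apply, ← MemLp.toLp_const_smul]
        refine MemLp.toLp_congr _ _ ?_
        filter_upwards [Lp.coeFn_smul c f] with ω h
        by_cases hω : ω ∈ A <;> simp [hω, h] }
  have hT' : ∀ f : Lp (Vec d) p P, T f = ((Lp.memLp f).indicator hA).toLp (A.indicator ⇑f) :=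
    fun _ => rfl
  have hT : ∀ f, T f =ᵐ[P] A.indicator f := fun f => by
    rw [hT']
    exact MemLp.coeFn_toLp _
  clear_value T
  have hn : ∀ f, ‖T f‖ ≤ ‖f‖ := fun f => by
    refine Lp.norm_le_norm_of_ae_le ?_
    filter_upwards [hT f] with ω h
    rw [h]
    exact norm_indicator_le_norm_self _ _
  exact ⟨T.mkContinuous 1 (fun f => by simpa using hn f), hT, hn⟩

variable [IsFiniteMeasure P]

/-- The signed measure `A ↦ φ (1_A c)` of a continuous functional `φ` on `L^p`, `p < ∞`. -/
noncomputable def functionalMeasure (hp : p ≠ ∞) (φ : Lp (Vec d) p P →L[ℝ] ℝ) (c : Vec d) :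
    SignedMeasure Ω where
  measureOf' A := open Classical in
    if hA : MeasurableSet A then φ (indicatorConstLp p hA (measure_ne_top P A) c) else 0
  empty' := by simp
  not_measurable' A hA := by simp [hA]
  m_iUnion' f hf hd := by
    classical
    have hfin : ∀ s : Finset ℕ, MeasurableSet (⋃ i ∈ s, f i) :=
      fun s => s.measurableSet_biUnion fun i _ => hf i
    have hsum : ∀ s : Finset ℕ, ∑ i ∈ s, φ (indicatorConstLp p (hf i) (measure_ne_top P _) c)
        = φ (indicatorConstLp p (hfin s) (measure_ne_top P _) c) := by
      intro s
      rw [← map_sum]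
      congr 1
      induction s using Finset.induction_on with
      | empty => simp
      | insert a s ha ih =>
        rw [Finset.sum_insert ha, ih]
        rw [← indicatorConstLp_disjoint_union (hf a) (hfin s)]
        · congr 1; simp
        · exact disjoint_iUnion₂_right.2 fun i hi => hd (by rintro rfl; exact ha hi)
    -- Countable additivity: the finite unions converge in measure to the full union, and for `p <
    -- ∞` this gives convergence of the indicators in `L^p`, to which `φ` can be applied.
    have key : Filter.Tendsto (fun s : Finset ℕ => P (symmDiff (⋃ i ∈ s, f i) (⋃ i, f i)))
        Filter.atTop (𝓝 0) := by
      refine tendsto_of_tendsto_of_tendsto_of_le_of_le tendsto_const_nhds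
        (ENNReal.tendsto_tsum_compl_atTop_zero (f := fun i => P (f i)) ?_) (fun _ => zero_le)
        fun s => ?_
      · rw [← measure_iUnion hd hf]; exact measure_ne_top _ _
      · refine (measure_mono ?_).trans (measure_iUnion_le fun b : {x // x ∉ s} => f b)
        intro x hx
        rcases hx with ⟨h1, h2⟩ | ⟨h1, h2⟩
        · exact absurd (iUnion₂_subset_iUnion _ _ h1) h2
        · obtain ⟨i, hi⟩ := mem_iUnion.1 h1
          refine mem_iUnion.2 ⟨⟨i, fun his => h2 (mem_iUnion₂.2 ⟨i, his, hi⟩)⟩, hi⟩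
    have hlim := (φ.continuous.tendsto _).comp (tendsto_indicatorConstLp_set (p := p) (c := c)
      (hs := MeasurableSet.iUnion hf) (hμs := measure_ne_top P _)
      (ht := hfin) (hμt := fun _ => measure_ne_top P _) hp key)
    simp only [hf, MeasurableSet.iUnion hf, dif_pos]
    refine Filter.Tendsto.congr (fun s => (hsum s).symm) ?_
    simp only [SummationFilter.unconditional_filter]
    exact hlim

theorem functionalMeasure_apply (hp : p ≠ ∞) (φ : Lp (Vec d) p P →L[ℝ] ℝ) (c : Vec d)
    {A : Set Ω} (hA : MeasurableSet A) :
    functionalMeasure hp φ c A = φ (indicatorConstLp p hA (measure_ne_top P A) c) := by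
  classical
  change (if hA : MeasurableSet A then φ (indicatorConstLp p hA (measure_ne_top P A) c) else 0) = _
  rw [dif_pos hA]

theorem functionalMeasure_absolutelyContinuous (hp : p ≠ ∞) (φ : Lp (Vec d) p P →L[ℝ] ℝ)
    (c : Vec d) : functionalMeasure hp φ c ≪ᵥ P.toENNRealVectorMeasure := by
  refine VectorMeasure.AbsolutelyContinuous.mk fun A hA h0 => ?_
  rw [Measure.toENNRealVectorMeasure_apply_measurable hA] at h0
  rw [functionalMeasure_apply hp φ c hA]
  have : indicatorConstLp p hA (measure_ne_top P A) c = 0 := by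
    rw [Lp.eq_zero_iff_ae_eq_zero]
    refine indicatorConstLp_coeFn.trans ?_
    filter_upwards [measure_eq_zero_iff_ae_notMem.1 h0] with ω hω
    simp [hω]
  rw [this, map_zero]

/-- Radon–Nikodym for each basis vector; linearity in `c` covers the other constant vectors. -/
theorem exists_density (hp : p ≠ ∞) (φ : Lp (Vec d) p P →L[ℝ] ℝ) :
    ∃ g : Ω → Vec d, Measurable g ∧ Integrable g P ∧ ∀ (A : Set Ω) (hA : MeasurableSet A) (c : Vec d),
      φ (indicatorConstLp p hA (measure_ne_top P A) c) = ∫ ω in A, dot (g ω) c ∂P := by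
  set e : Fin d → Vec d := fun i => EuclideanSpace.single i 1
  set g : Ω → Vec d := fun ω => WithLp.toLp 2 fun i =>
    (functionalMeasure hp φ (e i)).rnDeriv P ω
  have hgi : ∀ i, Integrable (fun ω => g ω i) P :=
    fun i => SignedMeasure.integrable_rnDeriv _ _
  have hgm : Measurable g := by
    have : Measurable fun ω i => (functionalMeasure hp φ (e i)).rnDeriv P ω :=
      measurable_pi_iff.2 fun i => SignedMeasure.measurable_rnDeriv _ _
    exact (PiLp.continuous_toLp 2 (fun _ : Fin d => ℝ)).measurable.comp this
  refine ⟨g, hgm, memLp_one_iff_integrable.1 (memLp_of_coord fun i =>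
    memLp_one_iff_integrable.2 (hgi i)), fun A hA c => ?_⟩
  have h1 : ∀ i, φ (indicatorConstLp p hA (measure_ne_top P A) (e i)) = ∫ ω in A, g ω i ∂P := by
    intro i
    rw [← functionalMeasure_apply hp φ (e i) hA, ← withDensityᵥ_apply (hgi i) hA]
    exact (congrArg (fun ν : SignedMeasure Ω => ν A) (SignedMeasure.withDensityᵥ_rnDeriv_eq _ _
      (functionalMeasure_absolutelyContinuous hp φ (e i)))).symm
  have h2 : indicatorConstLp p hA (measure_ne_top P A) c
      = ∑ i, c i • indicatorConstLp p hA (measure_ne_top P A) (e i) := by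
    let T : Vec d →ₗ[ℝ] Lp (Vec d) p P :=
      { toFun := fun x => indicatorConstLp p hA (measure_ne_top P A) x
        map_add' := fun x y => (indicatorConstLp_add (c := x) (c' := y)).symm
        map_smul' := fun a x => by
          refine Lp.ext ?_
          filter_upwards [indicatorConstLp_coeFn (p := p) (hs := hA) (hμs := measure_ne_top P A)
            (c := a • x), indicatorConstLp_coeFn (p := p) (hs := hA) (hμs := measure_ne_top P A)
            (c := x), Lp.coeFn_smul a (indicatorConstLp p hA (measure_ne_top P A) x)] with ω h1 h2 h3
          rw [h1, RingHom.id_apply, h3, Pi.smul_apply, h2]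
          by_cases h : ω ∈ A <;> simp [h] }
    change T c = ∑ i, c i • T (e i)
    conv_lhs => rw [show c = ∑ i, c i • e i by
      ext j; simp [e, Finset.sum_apply, Pi.single_apply]]
    simp only [map_sum, map_smul]
  rw [h2, map_sum]
  simp only [map_smul, h1, smul_eq_mul, dot]
  rw [integral_finsetSum _ fun i _ => ((hgi i).integrableOn.mul_const _)]
  exact Finset.sum_congr rfl fun i _ => by rw [integral_mul_const, mul_comm]

/-- Truncation of a random vector. -/
noncomputable def truncate (g : Ω → Vec d) (n : ℕ) : Ω → Vec d :=
  {ω | ‖g ω‖ ≤ n}.indicator g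

theorem measurable_truncate {g : Ω → Vec d} (hg : Measurable g) (n : ℕ) :
    Measurable (truncate g n) :=
  hg.indicator (measurableSet_le hg.norm measurable_const)

theorem norm_truncate_le (g : Ω → Vec d) (n : ℕ) (ω : Ω) : ‖truncate g n ω‖ ≤ n := by
  by_cases h : ‖g ω‖ ≤ n
  · rw [truncate, indicator_of_mem (show ω ∈ {ω | ‖g ω‖ ≤ n} from h)]; exact h
  · rw [truncate, indicator_of_notMem (show ω ∉ {ω | ‖g ω‖ ≤ n} from h)]; simp

theorem memLp_truncate {g : Ω → Vec d} (hg : Measurable g) (n : ℕ) (r : ℝ≥0∞) :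
    MemLp (truncate g n) r P :=
  (memLp_top_of_bound (measurable_truncate hg n).aestronglyMeasurable n
    (.of_forall (norm_truncate_le g n))).mono_exponent le_top

/-- Pairing with a truncation of `g` is `φ` composed with multiplication by the indicator of `‖g‖ ≤
n`. This is checked on indicators and extended by density, and the multiplication is a contraction.
-/
theorem pair_truncate_eq [p.HolderConjugate q] (hp : p ≠ ∞) (φ : Lp (Vec d) p P →L[ℝ] ℝ)
    {g : Ω → Vec d} (hg : Measurable g)
    (hφ : ∀ (A : Set Ω) (hA : MeasurableSet A) (c : Vec d),
      φ (indicatorConstLp p hA (measure_ne_top P A) c) = ∫ ω in A, dot (g ω) c ∂P)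
    (n : ℕ) (f : Lp (Vec d) p P) : |pair P (truncate g n) f| ≤ ‖φ‖ * ‖f‖ := by
  have hB : MeasurableSet {ω | ‖g ω‖ ≤ n} := measurableSet_le hg.norm measurable_const
  obtain ⟨T, hT, hTn⟩ := exists_indicatorCLM (P := P) (p := p) (d := d) hB
  have key : ∀ f, pair P (truncate g n) f = φ (T f) := by
    refine Lp.induction hp _ ?_ ?_ ?_
    · intro c A hA hPA
      have e1 : (Lp.simpleFunc.indicatorConst p hA hPA.ne c : Lp (Vec d) p P)
        = indicatorConstLp p hA (measure_ne_top P A) c := rfl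
      rw [e1]
      have e2 : T (indicatorConstLp p hA (measure_ne_top P A) c)
          = indicatorConstLp p (hA.inter hB) (measure_ne_top P _) c := by
        refine Lp.ext ?_
        filter_upwards [hT (indicatorConstLp p hA (measure_ne_top P A) c),
          indicatorConstLp_coeFn (p := p) (hs := hA) (hμs := measure_ne_top P A) (c := c),
          indicatorConstLp_coeFn (p := p) (hs := hA.inter hB) (hμs := measure_ne_top P _) (c := c)]
          with ω h1 h2 h3
        rw [h1, h3]
        by_cases hb : ω ∈ {ω | ‖g ω‖ ≤ n} <;> by_cases ha : ω ∈ A <;> simp_all [indicator]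
      rw [e2, hφ, pair, ← integral_indicator (hA.inter hB)]
      refine integral_congr_ae ?_
      filter_upwards [indicatorConstLp_coeFn (p := p) (hs := hA) (hμs := measure_ne_top P A)
        (c := c)] with ω h2
      rw [h2]
      by_cases hb : ‖g ω‖ ≤ n <;> by_cases ha : ω ∈ A <;> simp [truncate, indicator, ha, hb]
    · intro f g' hf hg' _ h1 h2
      rw [pair_add (q := q) (memLp_truncate hg n q), h1, h2, map_add, map_add]
    · exact isClosed_eq (continuous_pair_norm (q := q) (memLp_truncate hg n q))
        (φ.continuous.comp T.continuous)
  rw [key, ← Real.norm_eq_abs]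
  exact (φ.le_opNorm _).trans (mul_le_mul_of_nonneg_left (hTn f) (norm_nonneg _))

theorem dot_self (v : Vec d) : dot v v = ‖v‖ ^ 2 := by
  rw [dot_eq_inner, real_inner_self_eq_norm_sq]

/-- Converse Hölder, by testing against extremal functions: `G / ‖G‖` on `{‖G‖ > C}` when `q = ∞`,
and `‖G‖^(r-2) G` with `r = q` when `q < ∞`. In the second case the test gives `N^r ≤ C N^(r-1)` for
the norm `N`; the truncation keeps `N` finite, so one may divide. -/
theorem eLpNorm_truncate_le [p.HolderConjugate q] (hp : p ≠ ∞) {g : Ω → Vec d}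
    (hg : Measurable g) (n : ℕ) {C : ℝ} (hC : 0 ≤ C)
    (h : ∀ f : Lp (Vec d) p P, |pair P (truncate g n) f| ≤ C * ‖f‖) :
    eLpNorm (truncate g n) q P ≤ ENNReal.ofReal C := by
  set G := truncate g n
  have hGm : Measurable G := measurable_truncate hg n
  by_cases hq : q = ∞
  · subst hq
    obtain rfl : p = 1 := ENNReal.HolderConjugate.unique ∞ p 1
    set A : Set Ω := {ω | C < ‖G ω‖}
    have hA : MeasurableSet A := measurableSet_lt measurable_const hGm.norm
    set f : Ω → Vec d := A.indicator fun ω => ‖G ω‖⁻¹ • G ω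
    have hfm : Measurable f := (hGm.norm.inv.smul hGm).indicator hA
    have hfn : ∀ ω, ‖f ω‖ = A.indicator (fun _ => (1 : ℝ)) ω := by
      intro ω
      by_cases hω : ω ∈ A
      · have : 0 < ‖G ω‖ := hC.trans_lt hω
        simp [f, hω, norm_smul, this.ne']
      · simp [f, hω]
    have hf : MemLp f 1 P := (memLp_top_of_bound hfm.aestronglyMeasurable 1 (.of_forall fun ω => by
      rw [hfn]; exact indicator_le' (fun _ _ => le_rfl) (fun _ _ => zero_le_one) ω)).mono_exponent le_top
    have h1 := h (hf.toLp f)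
    have h2 : pair P G (hf.toLp f) = ∫ ω in A, ‖G ω‖ ∂P := by
      rw [pair, ← integral_indicator hA]
      refine integral_congr_ae ?_
      filter_upwards [hf.coeFn_toLp] with ω hω
      rw [hω]
      by_cases ha : ω ∈ A
      · have : 0 < ‖G ω‖ := hC.trans_lt ha
        simp only [f, indicator_of_mem ha, dot_smul_right, dot_self]
        field_simp
      · simp [f, ha]
    have h3 : ‖hf.toLp f‖ = ∫ ω in A, (1 : ℝ) ∂P := by
      rw [Lp.norm_toLp, eLpNorm_one_eq_lintegral_enorm, ← integral_norm_eq_lintegral_enorm hf.1,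
        ← integral_indicator hA]
      exact integral_congr_ae (.of_forall hfn)
    rw [h2, h3, ← integral_const_mul] at h1
    simp only [mul_one] at h1
    have hGi : IntegrableOn (fun ω => ‖G ω‖) A P :=
      ((memLp_truncate hg n 1).integrable le_rfl).norm.integrableOn
    have h4 : ∫ ω in A, (‖G ω‖ - C) ∂P ≤ 0 := by
      rw [integral_sub hGi (integrable_const _)]
      linarith [le_abs_self (∫ ω in A, ‖G ω‖ ∂P)]
    have h5 : P A = 0 := by
      by_contra h0
      have := (setIntegral_pos_iff_support_of_nonneg_ae (μ := P) (s := A) (f := fun ω => ‖G ω‖ - C)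
        (by
          filter_upwards [ae_restrict_mem hA] with ω hω
          exact sub_nonneg.2 (le_of_lt hω)) (hGi.sub (integrable_const _))).2 (by
          refine (pos_iff_ne_zero.2 h0).trans_le (measure_mono fun ω hω => ⟨?_, hω⟩)
          exact (sub_pos.2 (show C < ‖G ω‖ from hω)).ne')
      linarith
    rw [eLpNorm_exponent_top]
    refine essSup_le_of_ae_le _ ?_
    filter_upwards [measure_eq_zero_iff_ae_notMem.1 h5] with ω hω
    rw [← ofReal_norm]
    exact ENNReal.ofReal_le_ofReal (not_lt.1 hω)
  · have hp1 : 1 ≤ p := Fact.out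
    have hp0 : p ≠ 0 := (zero_lt_one.trans_le hp1).ne'
    have hq1 : q ≠ 1 := fun h1 => hp ((ENNReal.HolderConjugate.eq_top_iff_eq_one p q).2 h1)
    have hq1' : 1 < q := lt_of_le_of_ne (ENNReal.HolderConjugate.one_le q p) hq1.symm
    set r := q.toReal
    have hr : 1 < r := by
      rw [← ENNReal.toReal_one]; exact (ENNReal.toReal_lt_toReal ENNReal.one_ne_top hq).2 hq1'
    have hr0 : 0 < r := by linarith
    have hpr : p.toReal * (r - 1) = r := by
      have h0 := ENNReal.HolderConjugate.inv_add_inv_eq_one p q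
      have h1 : p.toReal⁻¹ + r⁻¹ = 1 := by
        have := congrArg ENNReal.toReal h0
        rwa [ENNReal.toReal_add (by simpa using hp0) (by simpa using (zero_lt_one.trans hq1').ne'),
          ENNReal.toReal_inv, ENNReal.toReal_inv, ENNReal.toReal_one] at this
      have hpp : 0 < p.toReal := ENNReal.toReal_pos hp0 hp
      field_simp at h1
      linarith
    have hexp : p * ENNReal.ofReal (r - 1) = q := by
      rw [← ENNReal.ofReal_toReal hp, ← ENNReal.ofReal_mul ENNReal.toReal_nonneg, hpr,
        ENNReal.ofReal_toReal hq]
    have hGq : MemLp G q P := memLp_truncate hg n q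
    set f : Ω → Vec d := fun ω => ‖G ω‖ ^ (r - 2) • G ω
    have hfm : Measurable f := (hGm.norm.pow_const _).smul hGm
    have hfn : ∀ ω, ‖f ω‖ = ‖G ω‖ ^ (r - 1) := by
      intro ω
      simp only [f, norm_smul, Real.norm_eq_abs, abs_of_nonneg (Real.rpow_nonneg (norm_nonneg _) _)]
      rcases eq_or_lt_of_le (norm_nonneg (G ω)) with h0 | h0
      · rw [← h0, mul_zero, Real.zero_rpow (by linarith)]
      · conv_lhs => rw [← Real.rpow_one ‖G ω‖, ← Real.rpow_mul h0.le, ← Real.rpow_add h0]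
        congr 1; ring
    have hfe : eLpNorm f p P = eLpNorm G q P ^ (r - 1) := by
      rw [← hexp, ← eLpNorm_norm_rpow G (by linarith : 0 < r - 1), ← eLpNorm_norm f]
      simp only [hfn]
    have hGfin : eLpNorm G q P ≠ ∞ := hGq.2.ne
    have hf : MemLp f p P := ⟨hfm.aestronglyMeasurable, by
      rw [hfe]; exact ENNReal.rpow_lt_top_of_nonneg (by linarith) hGfin⟩
    set N := (eLpNorm G q P).toReal
    have hN : 0 ≤ N := ENNReal.toReal_nonneg
    have h1 := h (hf.toLp f)
    have h2 : pair P G (hf.toLp f) = N ^ r := by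
      have e1 : pair P G (hf.toLp f) = ∫ ω, ‖G ω‖ ^ r ∂P := by
        refine integral_congr_ae ?_
        filter_upwards [hf.coeFn_toLp] with ω hω
        rw [hω]
        simp only [f, dot_smul_right, dot_self]
        rcases eq_or_lt_of_le (norm_nonneg (G ω)) with h0 | h0
        · rw [← h0, Real.zero_rpow hr0.ne']; simp
        · rw [← Real.rpow_natCast, ← Real.rpow_add h0]
          congr 1; push_cast; ring
      have e2 := hGq.eLpNorm_eq_integral_rpow_norm (zero_lt_one.trans hq1').ne' hq
      have e3 : 0 ≤ ∫ ω, ‖G ω‖ ^ r ∂P := integral_nonneg fun ω => Real.rpow_nonneg (norm_nonneg _) _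
      rw [e1]
      simp only [N]
      rw [e2, ENNReal.toReal_ofReal (Real.rpow_nonneg e3 _), ← Real.rpow_mul e3,
        inv_mul_cancel₀ hr0.ne', Real.rpow_one]
    have h3 : ‖hf.toLp f‖ = N ^ (r - 1) := by
      rw [Lp.norm_toLp, hfe, ← ENNReal.toReal_rpow]
    rw [h2, h3] at h1
    rw [← ENNReal.ofReal_toReal hGfin]
    refine ENNReal.ofReal_le_ofReal ?_
    rcases eq_or_lt_of_le hN with h0 | h0
    · rw [show (eLpNorm G q P).toReal = 0 from h0.symm]; exact hC
    · have h4 : N ^ r = N * N ^ (r - 1) := by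
        conv_rhs => rw [← Real.rpow_one N, ← Real.rpow_mul h0.le, ← Real.rpow_add h0]
        congr 1; ring
      rw [h4] at h1
      exact le_of_mul_le_mul_right ((le_abs_self _).trans h1) (Real.rpow_pos_of_pos h0 _)

/-- Riesz representation of continuous functionals on `L^p`, `p < ∞`. -/
theorem exists_pair_eq [p.HolderConjugate q] (hp : p ≠ ∞) (φ : Lp (Vec d) p P →L[ℝ] ℝ) :
    ∃ v : Ω → Vec d, MemLp v q P ∧ ∀ Z, φ Z = pair P v Z := by
  obtain ⟨g, hgm, hgi, hφ⟩ := exists_density hp φ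
  have hb : ∀ n, eLpNorm (truncate g n) q P ≤ ENNReal.ofReal ‖φ‖ := fun n =>
    eLpNorm_truncate_le hp hgm n (norm_nonneg φ) (pair_truncate_eq (q := q) hp φ hgm hφ n)
  have hlim : ∀ᵐ ω ∂P, Filter.Tendsto (fun n => truncate g n ω) Filter.atTop (𝓝 (g ω)) := by
    refine .of_forall fun ω => ?_
    obtain ⟨N, hN⟩ := exists_nat_ge ‖g ω‖
    refine tendsto_const_nhds.congr' ?_
    filter_upwards [Filter.eventually_ge_atTop N] with n hn
    rw [truncate, indicator_of_mem]
    exact hN.trans (by exact_mod_cast hn)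
  -- Fatou's lemma: the bound `‖φ‖` does not depend on the truncation level.
  have hgq : MemLp g q P := by
    refine ⟨hgm.aestronglyMeasurable, lt_of_le_of_lt (Lp.eLpNorm_lim_le_liminf_eLpNorm
      (fun n => (measurable_truncate hgm n).aestronglyMeasurable) g hlim) ?_⟩
    exact (Filter.liminf_le_of_frequently_le' (Filter.Frequently.of_forall hb)).trans_lt
      ENNReal.ofReal_lt_top
  refine ⟨g, hgq, ?_⟩
  refine Lp.induction hp _ ?_ ?_ ?_
  · intro c A hA hPA
    have e1 : (Lp.simpleFunc.indicatorConst p hA hPA.ne c : Lp (Vec d) p P)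
      = indicatorConstLp p hA (measure_ne_top P A) c := rfl
    rw [e1, hφ, pair, ← integral_indicator hA]
    refine integral_congr_ae ?_
    filter_upwards [indicatorConstLp_coeFn (p := p) (hs := hA) (hμs := measure_ne_top P A)
        (c := c)] with ω h2
    rw [h2]
    by_cases ha : ω ∈ A <;> simp [indicator, ha]
  · intro f g' hf hg' _ h1 h2
    rw [pair_add (q := q) hgq, map_add, h1, h2]
  · exact isClosed_eq φ.continuous (continuous_pair_norm (q := q) hgq)

/-- Separation of a point from a closed convex set in `L^p`, by an element of `L^q`. -/
theorem exists_separation [p.HolderConjugate q] {S : Set (Lp (Vec d) p P)} (hS : Convex ℝ S)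
    (hc : IsClosed[lpTop d p P] S) {X : Lp (Vec d) p P} (hX : X ∉ S) :
    ∃ v : Ω → Vec d, MemLp v q P ∧ ∃ K, pair P v X < K ∧ ∀ Z ∈ S, K ≤ pair P v Z := by
  by_cases hp : p = ∞
  · subst hp
    obtain rfl : q = 1 := ENNReal.HolderConjugate.unique ∞ q 1
    exact exists_separation_top hS hc hX
  · rw [lpTop_of_ne_top hp] at hc
    obtain ⟨φ, K, h1, h2⟩ := geometric_hahn_banach_point_closed hS hc hX
    obtain ⟨v, hv, hφ⟩ := exists_pair_eq (q := q) hp φ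
    exact ⟨v, hv, K, by rw [← hφ]; exact h1, fun Z hZ => by rw [← hφ]; exact (h2 Z hZ).le⟩

end Riesz

/-! ### Measurable selections of random closed sets. -/

section Selection

variable {Ω E : Type*} {mΩ : MeasurableSpace Ω} [MetricSpace E] [SecondCountableTopology E]
  [MeasurableSpace E] [BorelSpace E]

/-- One step of the Kuratowski–Ryll-Nardzewski construction: `g ω` is the first point of a dense
sequence that is both `r'`-close to `G ω` and `r`-close to `f ω`. Choosing the first index keeps `g`
measurable. -/
theorem exists_measurable_refinement [Nonempty E] {G : Ω → Set E}
    (hG : ∀ U : Set E, IsOpen U → MeasurableSet {ω | (G ω ∩ U).Nonempty})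
    {F : Set Ω} (hF : MeasurableSet F) {f : Ω → E} (hf : Measurable f) {r r' : ℝ} (hr' : 0 < r')
    (h : ∀ ω ∈ F, (G ω ∩ Metric.ball (f ω) r).Nonempty) :
    ∃ g : Ω → E, Measurable g ∧ ∀ ω ∈ F, (G ω ∩ Metric.ball (g ω) r').Nonempty ∧
      dist (g ω) (f ω) < r := by
  classical
  set D := TopologicalSpace.denseSeq E
  set p : Ω → ℕ → Prop := fun ω k =>
    ω ∉ F ∨ ((G ω ∩ Metric.ball (D k) r').Nonempty ∧ dist (D k) (f ω) < r)
  have hp : ∀ ω, ∃ k, p ω k := by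
    intro ω
    by_cases hω : ω ∈ F
    · obtain ⟨z, hz, hzr⟩ := h ω hω
      have hpos : 0 < min r' (r - dist z (f ω)) := lt_min hr' (sub_pos.2 hzr)
      obtain ⟨k, hk⟩ := (TopologicalSpace.denseRange_denseSeq E).exists_dist_lt z hpos
      refine ⟨k, Or.inr ⟨⟨z, hz, hk.trans_le (min_le_left _ _)⟩, ?_⟩⟩
      have h1 := hk.trans_le (min_le_right r' (r - dist z (f ω)))
      have h2 := dist_triangle (D k) z (f ω)
      rw [dist_comm (D k) z] at h2
      linarith
    · exact ⟨0, Or.inl hω⟩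
  have hm : ∀ k, MeasurableSet {ω | p ω k} := fun k =>
    hF.compl.union ((hG _ Metric.isOpen_ball).inter
      (measurableSet_lt (measurable_const.dist hf) measurable_const))
  refine ⟨fun ω => D (Nat.find (hp ω)), (measurable_from_nat).comp (measurable_find hp hm),
    fun ω hω => ?_⟩
  exact (Nat.find_spec (hp ω)).resolve_left (fun h => h hω)

variable [CompleteSpace E]

/-- Refinements with radii `ε / 2^n` form a pointwise Cauchy sequence. Its limit lies in the closed
set `G ω`, and the displacements sum to at most `2ε`. -/
theorem exists_measurable_selection [Nonempty E] {G : Ω → Set E} (hc : ∀ ω, IsClosed (G ω))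
    (hG : ∀ U : Set E, IsOpen U → MeasurableSet {ω | (G ω ∩ U).Nonempty}) (x : E) {ε : ℝ}
    (hε : 0 < ε) :
    ∃ f : Ω → E, Measurable f ∧ ∀ ω, (G ω ∩ Metric.ball x ε).Nonempty →
      f ω ∈ G ω ∧ dist (f ω) x ≤ 2 * ε := by
  set F : Set Ω := {ω | (G ω ∩ Metric.ball x ε).Nonempty}
  have hF : MeasurableSet F := hG _ Metric.isOpen_ball
  set r : ℕ → ℝ := fun n => ε / 2 ^ n
  have hr : ∀ n, 0 < r n := fun n => by positivity
  let T : ℕ → Type _ := fun n =>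
    {f : Ω → E // Measurable f ∧ ∀ ω ∈ F, (G ω ∩ Metric.ball (f ω) (r n)).Nonempty}
  have step : ∀ n (f : T n), ∃ g : T (n + 1), ∀ ω ∈ F, dist (g.1 ω) (f.1 ω) < r n := by
    intro n f
    obtain ⟨g, hg, h⟩ := exists_measurable_refinement hG hF f.2.1 (hr (n + 1)) f.2.2
    exact ⟨⟨g, hg, fun ω hω => (h ω hω).1⟩, fun ω hω => (h ω hω).2⟩
  choose next hnext using step
  let s : ∀ n, T n := fun n => Nat.rec (motive := T)
    ⟨fun _ => x, measurable_const, fun ω hω => by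
      have h : (G ω ∩ Metric.ball x ε).Nonempty := hω
      simpa [r] using h⟩ (fun n f => next n f) n
  have hs0 : (s 0).1 = fun _ => x := rfl
  have hs : ∀ n, ∀ ω ∈ F, dist ((s n).1 ω) ((s (n + 1)).1 ω) ≤ r n := fun n ω hω => by
    rw [dist_comm]; exact (hnext n (s n) ω hω).le
  have hr2 : ∀ n, r n = 2 * ε / 2 / 2 ^ n := fun n => by simp only [r]; ring
  have hlim : ∀ ω ∈ F, ∃ z, Filter.Tendsto (fun n => (s n).1 ω) Filter.atTop (𝓝 z) := fun ω hω =>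
    cauchySeq_tendsto_of_complete (cauchySeq_of_le_geometric_two fun n => by
      rw [← hr2]; exact hs n ω hω)
  classical
  refine ⟨fun ω => if hω : ω ∈ F then (hlim ω hω).choose else x, ?_, fun ω hω => ?_⟩
  · refine measurable_of_tendsto_metrizable (f := fun n ω => if ω ∈ F then (s n).1 ω else x)
      (fun n => Measurable.ite hF (s n).2.1 measurable_const) (tendsto_pi_nhds.2 fun ω => ?_)
    by_cases hω : ω ∈ F
    · simp only [hω, if_true, dif_pos]
      exact (hlim ω hω).choose_spec
    · simp only [hω, if_false, dif_neg, not_false_eq_true]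
      exact tendsto_const_nhds
  · have hω' : ω ∈ F := hω
    simp only [hω', dif_pos]
    have hz := (hlim ω hω').choose_spec
    set z := (hlim ω hω').choose
    constructor
    · rw [← (hc ω).closure_eq, Metric.mem_closure_iff]
      intro δ hδ
      have hr0 : Filter.Tendsto r Filter.atTop (𝓝 0) := by
        have := (tendsto_pow_atTop_nhds_zero_of_lt_one (r := (1 / 2 : ℝ)) (by norm_num)
          (by norm_num)).const_mul ε
        simpa [r, div_eq_mul_inv] using this
      obtain ⟨n, h1, h2⟩ := ((Metric.tendsto_nhds.1 hz (δ / 2) (by positivity)).and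
        (hr0.eventually (gt_mem_nhds (by positivity : 0 < δ / 2)))).exists
      obtain ⟨y, hy, hyb⟩ := (s n).2.2 ω hω'
      refine ⟨y, hy, ?_⟩
      rw [dist_comm] at h1
      rw [Metric.mem_ball, dist_comm] at hyb
      linarith [dist_triangle z ((s n).1 ω) y]
    · have := dist_le_of_le_geometric_two_of_tendsto₀
        (fun n => by rw [← hr2]; exact hs n ω hω') hz
      rw [hs0, dist_comm] at this
      exact this

/-- A random closed set is almost surely contained in a closed set which contains all of its
locally defined bounded measurable selections. -/
theorem ae_subset_of_forall_selection [Nonempty E] {m : MeasurableSpace Ω} {P : Measure[mΩ] Ω}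
    {G : Ω → Set E} (hc : ∀ ω, IsClosed (G ω))
    (hG : ∀ U : Set E, IsOpen U → MeasurableSet[m] {ω | (G ω ∩ U).Nonempty})
    {K : Set E} (hK : IsClosed K)
    (h : ∀ (F : Set Ω) (f : Ω → E), MeasurableSet[m] F → Measurable[m] f →
      (∃ x C, ∀ ω ∈ F, dist (f ω) x ≤ C) → (∀ ω ∈ F, f ω ∈ G ω) → ∀ᵐ ω ∂P, ω ∈ F → f ω ∈ K) :
    ∀ᵐ ω ∂P, G ω ⊆ K := by
  set D := TopologicalSpace.denseSeq E
  set ε : ℕ → ℝ := fun j => 1 / ((j : ℝ) + 1)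
  have hε : ∀ j, 0 < ε j := fun j => Nat.one_div_pos_of_nat
  -- A selection through the `ε`-ball stays in the `2ε`-ball, hence outside `K`; so such an `ε`-ball
  -- is almost surely not met by `G`. Countably many balls suffice.
  have key : ∀ k j, Metric.closedBall (D k) (2 * ε j) ⊆ Kᶜ →
      ∀ᵐ ω ∂P, ¬ (G ω ∩ Metric.ball (D k) (ε j)).Nonempty := by
    intro k j hkj
    obtain ⟨f, hf, hfG⟩ := @exists_measurable_selection Ω E m _ _ _ _ _ _ G hc hG (D k) _ (hε j)
    filter_upwards [h _ f (hG _ (Metric.isOpen_ball (x := D k) (ε := ε j))) hf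
      ⟨D k, 2 * ε j, fun ω hω => (hfG ω hω).2⟩ (fun ω hω => (hfG ω hω).1)] with ω hω hne
    exact hkj (Metric.mem_closedBall.2 (hfG ω hne).2) (hω hne)
  have key2 : ∀ᵐ ω ∂P, ∀ k j, Metric.closedBall (D k) (2 * ε j) ⊆ Kᶜ →
      ¬ (G ω ∩ Metric.ball (D k) (ε j)).Nonempty := by
    simp only [ae_all_iff]
    exact key
  filter_upwards [key2] with ω hω z hz
  by_contra hzK
  obtain ⟨ρ, hρ, hball⟩ := Metric.isOpen_iff.1 hK.isOpen_compl z hzK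
  -- With `ε j < ρ / 3`, every point within `2 ε j` of the centre `D k` is within `3 ε j < ρ` of
  -- `z`.
  obtain ⟨j, hj⟩ := exists_nat_one_div_lt (show 0 < ρ / 3 by positivity)
  obtain ⟨k, hk⟩ := (TopologicalSpace.denseRange_denseSeq E).exists_dist_lt z (hε j)
  refine hω k j (fun y hy => hball ?_) ⟨z, hz, hk⟩
  rw [Metric.mem_closedBall] at hy
  rw [Metric.mem_ball]
  have h1 := dist_triangle y (D k) z
  rw [dist_comm z] at hk
  change ε j < ρ / 3 at hj
  linarith

end Selection

/-! ### Conditional expectations of extended real variables, and conditional ratios. -/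

section CondExp

variable {Ω : Type*} {𝓖 : MeasurableSpace Ω} {mΩ : MeasurableSpace Ω} {P : Measure Ω}

theorem lintegral_mul_condLExp [IsFiniteMeasure P] (hm : 𝓖 ≤ mΩ) {h f : Ω → ℝ≥0∞} (hh : Measurable[𝓖] h)
    (hf : AEMeasurable f P) :
    ∫⁻ ω, h ω * condLExp 𝓖 P f ω ∂P = ∫⁻ ω, h ω * f ω ∂P := by
  have hl : ∀ a : Ω → ℝ≥0∞, Measurable[𝓖] a → Measurable fun ω => a ω * condLExp 𝓖 P f ω :=
    fun a ha => (ha.mono hm le_rfl).mul (measurable_condLExp' _ _ _)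
  have hr : ∀ a : Ω → ℝ≥0∞, Measurable[𝓖] a → AEMeasurable (fun ω => a ω * f ω) P :=
    fun a ha => (ha.mono hm le_rfl).aemeasurable.mul hf
  refine @Measurable.ennreal_induction Ω 𝓖
    (fun h => ∫⁻ ω, h ω * condLExp 𝓖 P f ω ∂P = ∫⁻ ω, h ω * f ω ∂P) ?_ ?_ ?_ h hh
  · intro c s hs
    have e : ∀ g : Ω → ℝ≥0∞, (fun ω => s.indicator (fun _ => c) ω * g ω)
        = s.indicator (fun ω => c * g ω) := fun g => by
      ext ω; by_cases hω : ω ∈ s <;> simp [hω]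
    simp only [e]
    rw [lintegral_indicator (hm s hs), lintegral_indicator (hm s hs),
      lintegral_const_mul _ (measurable_condLExp' _ _ _), lintegral_const_mul'' _ hf.restrict,
      setLIntegral_condLExp hm P f hs]
  · intro a b _ ha hb h1 h2
    simp only [Pi.add_apply, add_mul]
    rw [lintegral_add_left (hl a ha),
      lintegral_add_left' (hr a ha), h1, h2]
  · intro a ha hmono ih
    simp only [ENNReal.iSup_mul]
    rw [lintegral_iSup (fun n => hl _ (ha n)),
      lintegral_iSup' (fun n => hr _ (ha n))]
    · simp only [ih]
    · exact .of_forall fun ω i j hij => mul_le_mul_left (hmono hij ω) _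
    · exact fun i j hij ω => mul_le_mul_left (hmono hij ω) _

theorem condLExp_mul [IsFiniteMeasure P] (hm : 𝓖 ≤ mΩ) {h f : Ω → ℝ≥0∞} (hh : Measurable[𝓖] h)
    (hf : AEMeasurable f P) :
    condLExp 𝓖 P (fun ω => h ω * f ω) =ᵐ[P] fun ω => h ω * condLExp 𝓖 P f ω := by
  refine (ae_eq_condLExp hm P _ (hh.mul (measurable_condLExp _ _ _)) fun s hs => ?_).symm
  have e : ∀ g : Ω → ℝ≥0∞, ∫⁻ ω in s, h ω * g ω ∂P = ∫⁻ ω, s.indicator h ω * g ω ∂P := fun g => by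
    rw [← lintegral_indicator (hm s hs)]
    congr 1 with ω
    by_cases hω : ω ∈ s <;> simp [hω]
  change ∫⁻ ω in s, h ω * condLExp 𝓖 P f ω ∂P = _
  rw [e, e]
  exact lintegral_mul_condLExp hm (hh.indicator hs) hf

theorem condLExp_iSup [IsFiniteMeasure P] (hm : 𝓖 ≤ mΩ) {f : ℕ → Ω → ℝ≥0∞} (hf : ∀ n, AEMeasurable (f n) P)
    (hmono : ∀ᵐ ω ∂P, Monotone fun n => f n ω) :
    condLExp 𝓖 P (fun ω => ⨆ n, f n ω) =ᵐ[P] fun ω => ⨆ n, condLExp 𝓖 P (f n) ω := by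
  have hm2 : ∀ᵐ ω ∂P, Monotone fun n => condLExp 𝓖 P (f n) ω := by
    have : ∀ n, condLExp 𝓖 P (f n) ≤ᵐ[P] condLExp 𝓖 P (f (n + 1)) := fun n => by
      refine condLExp_mono ?_
      filter_upwards [hmono] with ω h using h n.le_succ
    filter_upwards [ae_all_iff.2 this] with ω h using monotone_nat_of_le_succ h
  refine (ae_eq_condLExp hm P _ (Measurable.iSup fun n : ℕ => measurable_condLExp 𝓖 P (f n))
    fun s hs => ?_).symm
  rw [lintegral_iSup' (fun n => (measurable_condLExp' _ _ _).aemeasurable) (ae_restrict_of_ae hm2),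
    lintegral_iSup' (fun n => (hf n).restrict) (ae_restrict_of_ae hmono)]
  simp only [setLIntegral_condLExp hm P _ hs]

theorem genCondExp_congr {f g : Ω → EReal} (h : f =ᵐ[P] g) :
    genCondExp P 𝓖 f =ᵐ[P] genCondExp P 𝓖 g := by
  have h1 : condLExp 𝓖 P (fun x => (f x).toENNReal) =ᵐ[P] condLExp 𝓖 P fun x => (g x).toENNReal :=
    condLExp_congr_ae (by filter_upwards [h] with ω hω; rw [hω])
  have h2 : condLExp 𝓖 P (fun x => (-f x).toENNReal) =ᵐ[P] condLExp 𝓖 P fun x => (-g x).toENNReal :=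
    condLExp_congr_ae (by filter_upwards [h] with ω hω; rw [hω])
  filter_upwards [h1, h2] with ω e1 e2
  simp only [genCondExp, e1, e2]

theorem genCondExp_mono {f g : Ω → EReal} (h : f ≤ᵐ[P] g) :
    genCondExp P 𝓖 f ≤ᵐ[P] genCondExp P 𝓖 g := by
  have h1 : condLExp 𝓖 P (fun x => (f x).toENNReal) ≤ᵐ[P] condLExp 𝓖 P fun x => (g x).toENNReal :=
    condLExp_mono (by filter_upwards [h] with ω hω using EReal.toENNReal_le_toENNReal hω)
  have h2 : condLExp 𝓖 P (fun x => (-g x).toENNReal) ≤ᵐ[P] condLExp 𝓖 P fun x => (-f x).toENNReal :=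
    condLExp_mono (by
      filter_upwards [h] with ω hω using EReal.toENNReal_le_toENNReal (EReal.neg_le_neg_iff.2 hω))
  filter_upwards [h1, h2] with ω e1 e2
  exact EReal.sub_le_sub (EReal.coe_ennreal_le_coe_ennreal_iff.2 e1)
    (EReal.coe_ennreal_le_coe_ennreal_iff.2 e2)

theorem condLExp_ofReal_posPart {f : Ω → ℝ} (hf : Integrable f P) :
    condLExp 𝓖 P (fun ω => ENNReal.ofReal (f ω)) =ᵐ[P]
      fun ω => ENNReal.ofReal ((P[fun ω => max (f ω) 0 | 𝓖]) ω) := by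
  have := condLExp_ofReal 𝓖 (f := fun ω => max (f ω) 0) hf.pos_part
    (.of_forall fun ω => le_max_right _ _)
  refine Filter.EventuallyEq.trans (condLExp_congr_ae (.of_forall fun ω => ?_)) this
  simp only
  rcases le_total (f ω) 0 with h | h
  · simp [h, ENNReal.ofReal_of_nonpos h]
  · simp [h]

theorem genCondExp_coe {f : Ω → ℝ} (hf : Integrable f P) :
    genCondExp P 𝓖 (fun ω => (f ω : EReal)) =ᵐ[P] fun ω => ((P[f | 𝓖]) ω : EReal) := by
  have h1 := condLExp_ofReal_posPart (𝓖 := 𝓖) hf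
  have h2 := condLExp_ofReal_posPart (𝓖 := 𝓖) hf.neg
  have h3 : P[f | 𝓖] =ᵐ[P] P[fun ω => max (f ω) 0 | 𝓖] - P[fun ω => max (-f ω) 0 | 𝓖] := by
    refine Filter.EventuallyEq.trans (condExp_congr_ae (.of_forall fun ω => ?_))
      (condExp_sub hf.pos_part hf.neg.pos_part 𝓖)
    simp only [Pi.sub_apply, Pi.neg_apply]
    rcases le_total (f ω) 0 with h | h <;> simp [h]
  have h4 : 0 ≤ᵐ[P] P[fun ω => max (f ω) 0 | 𝓖] :=
    condExp_nonneg (.of_forall fun ω => le_max_right _ _)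
  have h5 : 0 ≤ᵐ[P] P[fun ω => max (-f ω) 0 | 𝓖] :=
    condExp_nonneg (.of_forall fun ω => le_max_right _ _)
  filter_upwards [h1, h2, h3, h4, h5] with ω e1 e2 e3 e4 e5
  have e6 : ∀ x : ℝ, ((x : EReal)).toENNReal = ENNReal.ofReal x := fun x =>
    EReal.toENNReal_of_ne_top (EReal.coe_ne_top x)
  simp only [genCondExp, ← EReal.coe_neg, e6]
  simp only [Pi.neg_apply] at e2
  rw [e1, e2, e3, Pi.sub_apply, EReal.coe_sub, EReal.coe_ennreal_ofReal, EReal.coe_ennreal_ofReal]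
  simp only [Pi.zero_apply] at e4 e5
  rw [max_eq_left e4, max_eq_left e5]

theorem genCondExp_le_coe {f : Ω → EReal} {g : Ω → ℝ} (hg : Integrable g P)
    (h : ∀ᵐ ω ∂P, f ω ≤ g ω) :
    ∀ᵐ ω ∂P, genCondExp P 𝓖 f ω ≤ ((P[g | 𝓖]) ω : EReal) := by
  filter_upwards [genCondExp_mono (𝓖 := 𝓖) h, genCondExp_coe (𝓖 := 𝓖) hg] with ω h1 h2
  exact h1.trans h2.le

theorem coe_le_genCondExp {f : Ω → EReal} {g : Ω → ℝ} (hg : Integrable g P)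
    (h : ∀ᵐ ω ∂P, (g ω : EReal) ≤ f ω) :
    ∀ᵐ ω ∂P, ((P[g | 𝓖]) ω : EReal) ≤ genCondExp P 𝓖 f ω := by
  filter_upwards [genCondExp_mono (𝓖 := 𝓖) h, genCondExp_coe (𝓖 := 𝓖) hg] with ω h1 h2
  exact h2.ge.trans h1

/-- Only `a f` is assumed integrable, not `f`. Where `a > 0`, both parts of `E[f | 𝓖]` are finite
because their products with `a` are; where `a = 0`, the convention `0 · (±∞) = 0` takes over. -/
theorem coe_mul_genCondExp [IsFiniteMeasure P] (hm : 𝓖 ≤ mΩ) {a f : Ω → ℝ} (ha : AEStronglyMeasurable[𝓖] a P)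
    (ha0 : 0 ≤ᵐ[P] a) (hf : AEStronglyMeasurable f P) (haf : Integrable (fun ω => a ω * f ω) P) :
    (fun ω => (a ω : EReal) * genCondExp P 𝓖 (fun ω => (f ω : EReal)) ω) =ᵐ[P]
      fun ω => ((P[fun ω => a ω * f ω | 𝓖]) ω : EReal) := by
  refine Filter.EventuallyEq.trans ?_ (genCondExp_coe haf)
  have key : ∀ g : Ω → ℝ, AEStronglyMeasurable g P → Integrable (fun ω => a ω * g ω) P →
      ∀ᵐ ω ∂P, condLExp 𝓖 P (fun ω => ENNReal.ofReal (a ω * g ω)) ω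
        = ENNReal.ofReal (a ω) * condLExp 𝓖 P (fun ω => ENNReal.ofReal (g ω)) ω ∧
        condLExp 𝓖 P (fun ω => ENNReal.ofReal (a ω * g ω)) ω ≠ ∞ := by
    intro g hg hag
    have h1 := condLExp_mul (P := P) hm (h := fun ω => ENNReal.ofReal (ha.mk a ω))
      (f := fun ω => ENNReal.ofReal (g ω))
      (ENNReal.measurable_ofReal.comp ha.stronglyMeasurable_mk.measurable)
      (ENNReal.measurable_ofReal.comp_aemeasurable hg.aemeasurable)
    have h2 : condLExp 𝓖 P (fun ω => ENNReal.ofReal (a ω * g ω)) =ᵐ[P]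
        condLExp 𝓖 P (fun ω => ENNReal.ofReal (ha.mk a ω) * ENNReal.ofReal (g ω)) := by
      refine condLExp_congr_ae ?_
      filter_upwards [ha.ae_eq_mk, ha0] with ω e1 e2
      rw [ENNReal.ofReal_mul e2, ← e1]
    have h3 := condLExp_ofReal_posPart (𝓖 := 𝓖) hag
    filter_upwards [h1, h2, h3, ha.ae_eq_mk] with ω e1 e2 e3 e4
    refine ⟨by rw [e2, e1, ← e4], by rw [e3]; exact ENNReal.ofReal_ne_top⟩
  have e6 : ∀ x : ℝ, ((x : EReal)).toENNReal = ENNReal.ofReal x := fun x =>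
    EReal.toENNReal_of_ne_top (EReal.coe_ne_top x)
  have k1 := key f hf haf
  have k2 := key (fun ω => -f ω) hf.neg (by simpa using haf.neg)
  filter_upwards [k1, k2, ha0] with ω h1 h2 h0
  simp only [genCondExp, ← EReal.coe_neg, e6, ← mul_neg]
  set x := condLExp 𝓖 P (fun ω => ENNReal.ofReal (f ω)) ω
  set y := condLExp 𝓖 P (fun ω => ENNReal.ofReal (-f ω)) ω
  rw [h1.1, h2.1]
  have h1' := h1.2
  have h2' := h2.2
  rw [h1.1] at h1'
  rw [h2.1] at h2'
  rcases eq_or_lt_of_le h0 with h | h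
  · rw [← show (0 : ℝ) = a ω from h]; simp
  · have hne : ENNReal.ofReal (a ω) ≠ 0 := (ENNReal.ofReal_pos.2 h).ne'
    have hx : x ≠ ∞ := fun hx => h1' (by rw [hx, ENNReal.mul_top hne])
    have hy : y ≠ ∞ := fun hy => h2' (by rw [hy, ENNReal.mul_top hne])
    rw [← ENNReal.ofReal_toReal hx, ← ENNReal.ofReal_toReal hy, EReal.coe_ennreal_mul,
      EReal.coe_ennreal_mul]
    simp only [EReal.coe_ennreal_ofReal, max_eq_left ENNReal.toReal_nonneg,
      max_eq_left (show 0 ≤ a ω from h0)]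
    norm_cast
    ring

/-- For `x ≥ 0`, `∫ |k| x = ∫ |k| E[x | 𝓖]` holds in `[0, ∞]` without any integrability of the
product. -/
theorem integrable_mul_of_integrable_mul_condExp [IsFiniteMeasure P] (hm : 𝓖 ≤ mΩ) {k x : Ω → ℝ}
    (hk : AEStronglyMeasurable[𝓖] k P) (hx : Integrable x P) (hx0 : 0 ≤ᵐ[P] x)
    (h : Integrable (fun ω => k ω * (P[x | 𝓖]) ω) P) : Integrable (fun ω => k ω * x ω) P := by
  refine ⟨(hk.mono hm).mul hx.1, ?_⟩
  have h1 := lintegral_mul_condLExp (P := P) hm (h := fun ω => ‖hk.mk k ω‖ₑ)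
    (f := fun ω => ENNReal.ofReal (x ω)) (measurable_enorm.comp hk.stronglyMeasurable_mk.measurable)
    (ENNReal.measurable_ofReal.comp_aemeasurable hx.1.aemeasurable)
  have h2 : ∫⁻ ω, ‖k ω * x ω‖ₑ ∂P = ∫⁻ ω, ‖hk.mk k ω‖ₑ * ENNReal.ofReal (x ω) ∂P := by
    refine lintegral_congr_ae ?_
    filter_upwards [hk.ae_eq_mk, hx0] with ω e1 e2
    rw [enorm_mul, e1, Real.enorm_eq_ofReal e2]
  have h3 : ∫⁻ ω, ‖k ω * (P[x | 𝓖]) ω‖ₑ ∂P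
      = ∫⁻ ω, ‖hk.mk k ω‖ₑ * condLExp 𝓖 P (fun ω => ENNReal.ofReal (x ω)) ω ∂P := by
    refine lintegral_congr_ae ?_
    filter_upwards [hk.ae_eq_mk, condLExp_ofReal 𝓖 hx hx0, condExp_nonneg (m := 𝓖) hx0]
      with ω e1 e2 e3
    rw [enorm_mul, e1, e2, Real.enorm_eq_ofReal e3]
  rw [HasFiniteIntegral, h2, ← h1, ← h3]
  exact h.2

/-- The quotient `f / E[x | 𝓖]` where the denominator is positive, `1` elsewhere. -/
noncomputable def condRatio (P : Measure Ω) (𝓖 : MeasurableSpace Ω) (x f : Ω → ℝ) (ω : Ω) : ℝ :=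
  open Classical in if 0 < (P[x | 𝓖]) ω then f ω / (P[x | 𝓖]) ω else 1

/-- The case distinction becomes an affine expression in `f` with `𝓖`-measurable coefficients, so
conditional expectations follow by pulling these out. -/
theorem condRatio_eq (x f : Ω → ℝ) (ω : Ω) : condRatio P 𝓖 x f ω =
    {ω | 0 < (P[x | 𝓖]) ω}.indicator (fun ω => ((P[x | 𝓖]) ω)⁻¹) ω * f ω
      + {ω | 0 < (P[x | 𝓖]) ω}ᶜ.indicator (fun _ => (1 : ℝ)) ω := by
  by_cases h : 0 < (P[x | 𝓖]) ω <;> simp [condRatio, h, div_eq_inv_mul]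

section

variable {𝓗 : MeasurableSpace Ω} {x : Ω → ℝ}

theorem measurableSet_condExp_pos : MeasurableSet[𝓖] {ω | 0 < (P[x | 𝓖]) ω} :=
  @measurableSet_lt _ _ _ _ _ 𝓖 _ _ _ _ _ measurable_const stronglyMeasurable_condExp.measurable

theorem stronglyMeasurable_invCondExp : StronglyMeasurable[𝓖]
    ({ω | 0 < (P[x | 𝓖]) ω}.indicator fun ω => ((P[x | 𝓖]) ω)⁻¹) :=
  (Measurable.indicator (stronglyMeasurable_condExp.measurable.inv)
    measurableSet_condExp_pos).stronglyMeasurable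

theorem integrable_invCondExp_mul [IsFiniteMeasure P] (hm : 𝓖 ≤ mΩ) (hx : Integrable x P) (hx0 : 0 ≤ᵐ[P] x) :
    Integrable (fun ω => {ω | 0 < (P[x | 𝓖]) ω}.indicator (fun ω => ((P[x | 𝓖]) ω)⁻¹) ω * x ω) P := by
  refine integrable_mul_of_integrable_mul_condExp hm
    stronglyMeasurable_invCondExp.aestronglyMeasurable hx hx0 ?_
  have : (fun ω => {ω | 0 < (P[x | 𝓖]) ω}.indicator (fun ω => ((P[x | 𝓖]) ω)⁻¹) ω * (P[x | 𝓖]) ω)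
      = {ω | 0 < (P[x | 𝓖]) ω}.indicator fun _ => (1 : ℝ) := by
    ext ω
    by_cases h : 0 < (P[x | 𝓖]) ω
    · simp [h, h.ne']
    · simp [h]
  rw [this]
  exact (integrable_const 1).indicator (hm _ measurableSet_condExp_pos)

theorem integrable_condRatio [IsFiniteMeasure P] (hm : 𝓖 ≤ mΩ) (hx : Integrable x P) (hx0 : 0 ≤ᵐ[P] x) :
    Integrable (condRatio P 𝓖 x x) P := by
  have : condRatio P 𝓖 x x = _ := funext (condRatio_eq x x)
  rw [this]
  exact (integrable_invCondExp_mul hm hx hx0).add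
    ((integrable_const 1).indicator (hm _ measurableSet_condExp_pos).compl)

theorem condExp_condRatio [IsFiniteMeasure P] (hm : 𝓖 ≤ 𝓗) (hm' : 𝓗 ≤ mΩ) (hx : Integrable x P) (hx0 : 0 ≤ᵐ[P] x) :
    P[condRatio P 𝓖 x x | 𝓗] =ᵐ[P] condRatio P 𝓖 x (P[x | 𝓗]) := by
  have hGm := hm.trans hm'
  have e : condRatio P 𝓖 x x = _ := funext (condRatio_eq x x)
  have e' : condRatio P 𝓖 x (P[x | 𝓗]) = _ := funext (condRatio_eq x (P[x | 𝓗]))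
  rw [e, e']
  have hB := measurableSet_condExp_pos (P := P) (𝓖 := 𝓖) (x := x)
  have h1 := condExp_add (m := 𝓗) (integrable_invCondExp_mul hGm hx hx0)
    ((integrable_const (1 : ℝ)).indicator (hGm _ hB).compl)
  have h2 := condExp_mul_of_stronglyMeasurable_left (m := 𝓗)
    ((stronglyMeasurable_invCondExp (P := P) (𝓖 := 𝓖) (x := x)).mono hm)
    (integrable_invCondExp_mul hGm hx hx0) hx
  have h3 := condExp_of_stronglyMeasurable (μ := P) hm'
    ((stronglyMeasurable_const (b := (1 : ℝ))).indicator (hm _ hB.compl))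
    ((integrable_const (1 : ℝ)).indicator (hGm _ hB).compl)
  refine h1.trans ?_
  filter_upwards [h2] with ω e2
  rw [Pi.add_apply, h3]
  exact congrArg (· + _) e2

theorem condRatio_nonneg {f : Ω → ℝ} (hf : 0 ≤ᵐ[P] f) : 0 ≤ᵐ[P] condRatio P 𝓖 x f := by
  filter_upwards [hf] with ω h
  by_cases h0 : 0 < (P[x | 𝓖]) ω
  · simp only [condRatio, h0, if_true, Pi.zero_apply]; exact div_nonneg h h0.le
  · simp [condRatio, h0]

theorem condRatio_self (ω : Ω) : condRatio P 𝓖 x (P[x | 𝓖]) ω = 1 := by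
  by_cases h : 0 < (P[x | 𝓖]) ω
  · simp [condRatio, h, h.ne']
  · simp [condRatio, h]

/-- A nonnegative random variable vanishes where its conditional expectation does. -/
theorem eq_zero_of_condExp_eq_zero [IsFiniteMeasure P] (hm : 𝓖 ≤ mΩ) (hx : Integrable x P) (hx0 : 0 ≤ᵐ[P] x) :
    ∀ᵐ ω ∂P, ¬ 0 < (P[x | 𝓖]) ω → x ω = 0 := by
  set B : Set Ω := {ω | 0 < (P[x | 𝓖]) ω}ᶜ
  have hB : MeasurableSet[𝓖] B := measurableSet_condExp_pos.compl
  have h1 : ∫ ω in B, x ω ∂P ≤ 0 := by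
    rw [← setIntegral_condExp hm hx hB]
    exact setIntegral_nonpos (hm _ hB) fun ω hω => not_lt.1 hω
  have h2 : ∫ ω in B, x ω ∂P = 0 := le_antisymm h1
    (setIntegral_nonneg_of_ae hx0)
  rw [setIntegral_eq_zero_iff_of_nonneg_ae (ae_restrict_of_ae hx0) hx.integrableOn] at h2
  filter_upwards [(ae_restrict_iff' (hm _ hB)).1 h2] with ω h h0
  exact h h0

theorem condExp_eq_zero_of_condExp_eq_zero [IsFiniteMeasure P] (hm : 𝓖 ≤ 𝓗) (hm' : 𝓗 ≤ mΩ)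
    (hx0 : 0 ≤ᵐ[P] x) : ∀ᵐ ω ∂P, ¬ 0 < (P[x | 𝓖]) ω → (P[x | 𝓗]) ω = 0 := by
  have h := eq_zero_of_condExp_eq_zero (hm.trans hm') (x := P[x | 𝓗]) integrable_condExp
    (condExp_nonneg hx0)
  filter_upwards [h, condExp_condExp_of_le (f := x) (μ := P) hm hm'] with ω h1 h2
  rwa [h2] at h1

end

end CondExp

/-! ### Density processes of absolutely continuous measures. -/

section Densities

variable {Ω ι : Type*} {mΩ : MeasurableSpace Ω} [LinearOrder ι]
  {P : Measure Ω} {ℱ : Filtration ι mΩ}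

theorem xi_eq_condRatio (r s : ι) (Q : Measure Ω) :
    xi ℱ P r s Q = condRatio P (ℱ r) (fun ω => (Q.rnDeriv P ω).toReal)
      (P[fun ω => (Q.rnDeriv P ω).toReal | ℱ s]) := rfl

theorem xi_nonneg (Q : Measure Ω) (r s : ι) : 0 ≤ᵐ[P] xi ℱ P r s Q := by
  rw [xi_eq_condRatio]
  exact condRatio_nonneg (condExp_nonneg (.of_forall fun _ => ENNReal.toReal_nonneg))

variable [IsProbabilityMeasure P]

/-- Every nonnegative integrable random variable determines a density process. -/
theorem exists_density_process {r : ι} {x : Ω → ℝ} (hx : Integrable x P)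
    (hx0 : 0 ≤ᵐ[P] x) :
    ∃ Q : Measure Ω, IsProbabilityMeasure Q ∧ Q ≪ P ∧ ∀ s, r ≤ s →
      (fun ω => (P[x | ℱ r]) ω * xi ℱ P r s Q ω) =ᵐ[P] P[x | ℱ s] := by
  -- The density of `Q` is `x / E[x | 𝓕_r]`, set to `1` where the denominator is not positive. Its
  -- conditional expectation at `r` is then `1`, so `Q` has mass one and the denominator in
  -- `ξ̄_{r,s}(Q)` is `1`.
  set D := condRatio P (ℱ r) x x
  have hD : Integrable D P := integrable_condRatio (ℱ.le r) hx hx0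
  have hD0 : 0 ≤ᵐ[P] D := condRatio_nonneg hx0
  set Q : Measure Ω := P.withDensity fun ω => ENNReal.ofReal (D ω)
  have hDr : P[D | ℱ r] =ᵐ[P] fun _ => 1 :=
    (condExp_condRatio le_rfl (ℱ.le r) hx hx0).trans (.of_forall fun ω => condRatio_self ω)
  have hQ : IsProbabilityMeasure Q := by
    refine ⟨?_⟩
    rw [withDensity_apply _ MeasurableSet.univ, Measure.restrict_univ,
      ← ofReal_integral_eq_lintegral_ofReal hD hD0, ← integral_condExp (ℱ.le r),
      integral_congr_ae hDr]
    simp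
  have hrn : (fun ω => (Q.rnDeriv P ω).toReal) =ᵐ[P] D := by
    filter_upwards [Measure.rnDeriv_withDensity₀ P (f := fun ω => ENNReal.ofReal (D ω))
      (ENNReal.measurable_ofReal.comp_aemeasurable hD.1.aemeasurable), hD0] with ω h1 h2
    rw [h1, ENNReal.toReal_ofReal h2]
  refine ⟨Q, hQ, withDensity_absolutelyContinuous _ _, fun s hs => ?_⟩
  have e1 : condDensity P (ℱ r) Q =ᵐ[P] fun _ => 1 := (condExp_congr_ae hrn).trans hDr
  have e2 : condDensity P (ℱ s) Q =ᵐ[P] condRatio P (ℱ r) x (P[x | ℱ s]) :=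
    (condExp_congr_ae hrn).trans (condExp_condRatio (ℱ.mono hs) (ℱ.le s) hx hx0)
  filter_upwards [e1, e2, condExp_eq_zero_of_condExp_eq_zero (ℱ.mono hs) (ℱ.le s) hx0,
    condExp_nonneg (m := ℱ r) hx0] with ω h1 h2 h3 h4
  rw [xi, h1, if_pos zero_lt_one, h2, div_one]
  by_cases h : 0 < (P[x | ℱ r]) ω
  · simp only [condRatio, h, if_true]
    field_simp
  -- Where `E[x | 𝓕_r]` vanishes, so does `E[x | 𝓕_s]`, and the value `1` of the ratio is
  -- irrelevant.
  · rw [h3 h, le_antisymm (not_lt.1 h) h4]; simp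

variable [OrderTop ι]

theorem condDensity_top (hT : ℱ ⊤ = mΩ) (Q : Measure Ω) [IsFiniteMeasure Q] :
    condDensity P (ℱ ⊤) Q = fun ω => (Q.rnDeriv P ω).toReal := by
  rw [condDensity, hT]
  exact condExp_of_stronglyMeasurable le_rfl
    (Measure.measurable_rnDeriv Q P).ennreal_toReal.stronglyMeasurable Measure.integrable_toReal_rnDeriv

theorem xi_top_eq_condRatio (hT : ℱ ⊤ = mΩ) (r : ι) (Q : Measure Ω) [IsFiniteMeasure Q] :
    xi ℱ P r ⊤ Q = condRatio P (ℱ r) (fun ω => (Q.rnDeriv P ω).toReal)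
      (fun ω => (Q.rnDeriv P ω).toReal) := by
  rw [xi_eq_condRatio]
  exact congrArg _ (condDensity_top hT Q)

variable (Q : Measure Ω) [IsFiniteMeasure Q]

theorem integrable_xi_top (hT : ℱ ⊤ = mΩ) (r : ι) : Integrable (xi ℱ P r ⊤ Q) P := by
  rw [xi_top_eq_condRatio hT]
  exact integrable_condRatio (ℱ.le r) Measure.integrable_toReal_rnDeriv
    (.of_forall fun _ => ENNReal.toReal_nonneg)

theorem condExp_xi_top (hT : ℱ ⊤ = mΩ) {r s : ι} (hrs : r ≤ s) :
    P[xi ℱ P r ⊤ Q | ℱ s] =ᵐ[P] xi ℱ P r s Q := by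
  rw [xi_top_eq_condRatio hT, xi_eq_condRatio]
  exact condExp_condRatio (ℱ.mono hrs) (ℱ.le s) Measure.integrable_toReal_rnDeriv
    (.of_forall fun _ => ENNReal.toReal_nonneg)

theorem integrable_xi (hT : ℱ ⊤ = mΩ) {r s : ι} (hrs : r ≤ s) : Integrable (xi ℱ P r s Q) P :=
  integrable_condExp.congr (condExp_xi_top Q hT hrs)

theorem condExp_xi (hT : ℱ ⊤ = mΩ) {r s : ι} (hrs : r ≤ s) :
    P[xi ℱ P r s Q | ℱ r] =ᵐ[P] fun _ => 1 := by
  refine (condExp_congr_ae (condExp_xi_top Q hT hrs).symm).trans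
    ((condExp_condExp_of_le (ℱ.mono hrs) (ℱ.le s)).trans ((condExp_xi_top Q hT le_rfl).trans ?_))
  rw [xi_eq_condRatio]
  exact .of_forall fun ω => condRatio_self ω

theorem condExp_mul_xi (hT : ℱ ⊤ = mΩ) {r s : ι} (hrs : r ≤ s) {a : Ω → ℝ}
    (ha : AEStronglyMeasurable[ℱ r] a P) (hi : Integrable (fun ω => a ω * xi ℱ P r s Q ω) P) :
    P[fun ω => a ω * xi ℱ P r s Q ω | ℱ r] =ᵐ[P] a := by
  refine (condExp_mul_of_aestronglyMeasurable_left ha hi (integrable_xi Q hT hrs)).trans ?_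
  filter_upwards [condExp_xi (P := P) Q hT hrs] with ω h
  simp [h]

/-- Since `a z` is `𝓕_s`-measurable, conditioning on `𝓕_s` replaces `ξ̄_{r,T}` by `ξ̄_{r,s}`.
Nonnegativity of the density carries integrability back from the product with `ξ̄_{r,s}` to the one
with `ξ̄_{r,T}`. -/
theorem coe_mul_genCondExp_xi (hT : ℱ ⊤ = mΩ) {r s : ι} (hrs : r ≤ s) {a z : Ω → ℝ}
    (ha : AEStronglyMeasurable[ℱ r] a P) (ha0 : 0 ≤ᵐ[P] a) (hz : AEStronglyMeasurable[ℱ s] z P)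
    (hi : Integrable (fun ω => a ω * xi ℱ P r s Q ω * z ω) P) :
    (fun ω => (a ω : EReal) * genCondExp P (ℱ r) (fun ω => ((xi ℱ P r ⊤ Q ω * z ω : ℝ) : EReal)) ω)
      =ᵐ[P] fun ω => ((P[fun ω => a ω * xi ℱ P r s Q ω * z ω | ℱ r]) ω : EReal) := by
  have hX := integrable_xi_top (P := P) Q hT r
  have haz : AEStronglyMeasurable[ℱ s] (fun ω => a ω * z ω) P := (ha.mono (ℱ.mono hrs)).mul hz
  have h1 : Integrable (fun ω => (a ω * z ω) * xi ℱ P r ⊤ Q ω) P := by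
    refine integrable_mul_of_integrable_mul_condExp (ℱ.le s) haz hX (xi_nonneg Q r ⊤) ?_
    refine hi.congr ?_
    filter_upwards [condExp_xi_top (P := P) Q hT hrs] with ω h
    rw [h]; ring
  have h2 : P[fun ω => (a ω * z ω) * xi ℱ P r ⊤ Q ω | ℱ s] =ᵐ[P]
      fun ω => a ω * xi ℱ P r s Q ω * z ω := by
    refine (condExp_mul_of_aestronglyMeasurable_left haz h1 hX).trans ?_
    filter_upwards [condExp_xi_top (P := P) Q hT hrs] with ω h
    simp only [Pi.mul_apply, h]; ring
  have h3 : Integrable (fun ω => a ω * (xi ℱ P r ⊤ Q ω * z ω)) P :=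
    h1.congr (.of_forall fun ω => by ring)
  refine (coe_mul_genCondExp (ℱ.le r) ha ha0 (hX.1.mul (hz.mono (ℱ.le s))) h3).trans ?_
  have h4 : P[fun ω => a ω * (xi ℱ P r ⊤ Q ω * z ω) | ℱ r] =ᵐ[P]
      P[fun ω => a ω * xi ℱ P r s Q ω * z ω | ℱ r] := by
    refine (condExp_congr_ae (.of_forall fun ω => ?_)).trans
      ((condExp_condExp_of_le (ℱ.mono hrs) (ℱ.le s)).symm.trans (condExp_congr_ae h2))
    ring
  filter_upwards [h4] with ω h
  exact congrArg _ h

end Densities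

/-! ### Conditional losses of a density. -/

section CondLoss

variable {Ω : Type*} {𝓖 𝓗 : MeasurableSpace Ω} {mΩ : MeasurableSpace Ω} {P : Measure Ω} {d : ℕ}
  {p q : ℝ≥0∞}

theorem dot_comm (v u : Vec d) : dot v u = dot u v := by
  simp only [dot, mul_comm]

/-- The conditional expectation `E[vᵀ(-Z) | 𝓖]`. -/
noncomputable def condLoss (P : Measure Ω) (𝓖 : MeasurableSpace Ω) (v : Ω → Vec d)
    (Z : Lp (Vec d) p P) : Ω → ℝ :=
  P[fun ω => dot (v ω) (-Z ω) | 𝓖]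

theorem integrable_condLoss {v : Ω → Vec d} {Z : Lp (Vec d) p P} :
    Integrable (condLoss P 𝓖 v Z) P := integrable_condExp

variable [p.HolderConjugate q]

theorem integrable_loss {v : Ω → Vec d} (hv : MemLp v q P) (Z : Lp (Vec d) p P) :
    Integrable (fun ω => dot (v ω) (-Z ω)) P := by
  simpa using (integrable_dot_Lp hv Z).neg

variable [IsFiniteMeasure P]

/-- Coordinatewise pull-out. The alternative in `h` asks nothing of `v` in coordinates where `Z`
vanishes; this is how non-eligible coordinates drop out when `Z` is an eligible portfolio. -/
theorem condExp_dot_eq (hm : 𝓖 ≤ mΩ) {v y Z : Ω → Vec d} (hv : MemLp v q P) (hZ : MemLp Z p P)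
    (hZm : AEStronglyMeasurable[𝓖] Z P)
    (h : ∀ i, P[fun ω => v ω i | 𝓖] =ᵐ[P] (fun ω => y ω i) ∨ ∀ᵐ ω ∂P, Z ω i = 0) :
    P[fun ω => dot (v ω) (Z ω) | 𝓖] =ᵐ[P] fun ω => dot (y ω) (Z ω) := by
  have : q.HolderConjugate p := ENNReal.HolderConjugate.symm
  have hq : 1 ≤ q := ENNReal.HolderConjugate.one_le q p
  have hi : ∀ i, Integrable (fun ω => v ω i * Z ω i) P := fun i =>
    (memLp_coord hv i).integrable_mul (memLp_coord hZ i)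
  have hterm : ∀ i, P[fun ω => v ω i * Z ω i | 𝓖] =ᵐ[P] fun ω => y ω i * Z ω i := by
    intro i
    rcases h i with h | h
    · refine (condExp_mul_of_aestronglyMeasurable_right (aestronglyMeasurable_coord hZm i) (hi i)
        ((memLp_coord hv i).integrable hq)).trans ?_
      filter_upwards [h] with ω e
      simp [e]
    · refine (condExp_congr_ae (g := fun _ => (0 : ℝ)) ?_).trans ?_
      · filter_upwards [h] with ω e
        simp [e]
      · filter_upwards [h] with ω e
        simp [e, condExp_const hm]
  have e : (fun ω => dot (v ω) (Z ω)) = ∑ i, fun ω => v ω i * Z ω i := by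
    ext ω; simp [dot]
  rw [e]
  refine (condExp_finsetSum (fun i _ => hi i) 𝓖).trans ?_
  filter_upwards [ae_all_iff.2 hterm] with ω e
  simp [dot, e]

theorem condLoss_eq_dot (hm : 𝓖 ≤ mΩ) {v y : Ω → Vec d} {Z : Lp (Vec d) p P} (hv : MemLp v q P)
    (hZm : AEStronglyMeasurable[𝓖] Z P)
    (h : ∀ i, P[fun ω => v ω i | 𝓖] =ᵐ[P] (fun ω => y ω i) ∨ ∀ᵐ ω ∂P, Z ω i = 0) :
    condLoss P 𝓖 v Z =ᵐ[P] fun ω => dot (y ω) (-Z ω) :=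
  condExp_dot_eq hm hv (Lp.memLp Z).neg hZm.neg fun i => (h i).imp id fun h => by
    filter_upwards [h] with ω h
    simp [h]

theorem condLoss_tower (h1 : 𝓖 ≤ 𝓗) (h2 : 𝓗 ≤ mΩ) (v : Ω → Vec d)
    (Z : Lp (Vec d) p P) : P[condLoss P 𝓗 v Z | 𝓖] =ᵐ[P] condLoss P 𝓖 v Z :=
  condExp_condExp_of_le h1 h2

theorem condLoss_add {v : Ω → Vec d} (hv : MemLp v q P) (Y Z : Lp (Vec d) p P) :
    condLoss P 𝓖 v (Y + Z) =ᵐ[P] fun ω => condLoss P 𝓖 v Y ω + condLoss P 𝓖 v Z ω := by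
  refine (condExp_congr_ae ?_).trans (condExp_add (integrable_loss hv Y) (integrable_loss hv Z) 𝓖)
  filter_upwards [Lp.coeFn_add Y Z] with ω h
  rw [h, Pi.add_apply, neg_add, dot_add_right, Pi.add_apply]

theorem condLoss_zero {v : Ω → Vec d} (hm : 𝓖 ≤ mΩ) :
    condLoss P 𝓖 v (0 : Lp (Vec d) p P) =ᵐ[P] fun _ => 0 := by
  refine (condExp_congr_ae (g := fun _ => (0 : ℝ)) ?_).trans ?_
  · filter_upwards [Lp.coeFn_zero (Vec d) p P] with ω h
    rw [h, Pi.zero_apply, neg_zero, dot_zero_right]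
  · rw [condExp_const hm]

theorem condLoss_congr {v v' : Ω → Vec d} (h : v =ᵐ[P] v') (Z : Lp (Vec d) p P) :
    condLoss P 𝓖 v Z =ᵐ[P] condLoss P 𝓖 v' Z :=
  condExp_congr_ae (by filter_upwards [h] with ω h; rw [h])

/-- If two densities have the same conditional expectations along the coordinates of `Z`, they
give the same conditional loss. -/
theorem condLoss_eq_of_condExp_eq (h1 : 𝓖 ≤ 𝓗) (h2 : 𝓗 ≤ mΩ) {v y : Ω → Vec d}
    {Z : Lp (Vec d) p P} (hv : MemLp v q P)
    (hZm : AEStronglyMeasurable[𝓗] Z P)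
    (h : ∀ i, P[fun ω => v ω i | 𝓗] =ᵐ[P] (fun ω => y ω i) ∨ ∀ᵐ ω ∂P, Z ω i = 0) :
    condLoss P 𝓖 v Z =ᵐ[P] condLoss P 𝓖 y Z :=
  (condLoss_tower h1 h2 v Z).symm.trans (condExp_congr_ae (condLoss_eq_dot h2 hv hZm h))

theorem integral_condLoss (hm : 𝓖 ≤ mΩ) (v : Ω → Vec d) (Z : Lp (Vec d) p P) :
    ∫ ω, condLoss P 𝓖 v Z ω ∂P = -pair P v Z := by
  rw [condLoss, integral_condExp hm, pair, ← integral_neg]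
  simp

end CondLoss

/-! ### Dual variables generated by a nonnegative random vector. -/

section ConditionalVector

variable {Ω ι : Type*} {mΩ : MeasurableSpace Ω} [LinearOrder ι]
  {P : Measure Ω} {ℱ : Filtration ι mΩ} {d : ℕ} {q : ℝ≥0∞}

/-- Every nonnegative random vector in `L^q` determines dual variables. -/
theorem exists_wStep [IsProbabilityMeasure P] (hq : 1 ≤ q) {v : Ω → Vec d} (hv : MemLp v q P) (hv0 : ∀ i, ∀ᵐ ω ∂P, 0 ≤ v ω i) (r : ι) :
    ∃ Q : Fin d → Measure Ω, IsVecProb P Q ∧ ∀ s, r ≤ s →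
      wStep ℱ P r s Q (fun ω => WithLp.toLp 2 fun i => (P[fun ω => v ω i | ℱ r]) ω)
        =ᵐ[P] fun ω => WithLp.toLp 2 fun i => (P[fun ω => v ω i | ℱ s]) ω := by
  choose Q h1 h2 h3 using fun i => exists_density_process (ℱ := ℱ) (r := r)
    ((memLp_coord hv i).integrable hq) (hv0 i)
  refine ⟨Q, fun i => ⟨h1 i, h2 i⟩, fun s hs => ?_⟩
  filter_upwards [ae_all_iff.2 fun i => h3 i s hs] with ω h
  ext i
  simpa [wStep] using h i

theorem memLp_condVec (hq : 1 ≤ q) {v : Ω → Vec d} (hv : MemLp v q P) (r : ι) :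
    MemLp (fun ω => WithLp.toLp 2 fun i => (P[fun ω => v ω i | ℱ r]) ω : Ω → Vec d) q P := by
  exact memLp_of_coord fun i => MemLp.condExp hq (memLp_coord hv i)

theorem aestronglyMeasurable_condVec (v : Ω → Vec d) (r : ι) :
    AEStronglyMeasurable[ℱ r]
      (fun ω => WithLp.toLp 2 fun i => (P[fun ω => v ω i | ℱ r]) ω : Ω → Vec d) P :=
  aestronglyMeasurable_of_coord fun _ => stronglyMeasurable_condExp.aestronglyMeasurable

end ConditionalVector

/-! ### Expectations under `Q` as conditional losses. -/

section Identification

variable {Ω ι : Type*} {mΩ : MeasurableSpace Ω} [LinearOrder ι] [OrderTop ι]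
  {P : Measure Ω} [IsProbabilityMeasure P] {ℱ : Filtration ι mΩ} {d : ℕ} {p q : ℝ≥0∞}
  [p.HolderConjugate q] {r s : ι} {Q : Fin d → Measure Ω}

/-- Coordinate by coordinate: where `w_i ≥ 0` the weight is pulled inside the conditional
expectation, and where `Z_i = 0` both sides vanish whatever the sign of `w_i`. All terms are thus
finite, so the sum in `EReal` is a real sum. -/
theorem dotQCondExp_eq (hT : ℱ ⊤ = mΩ) (hrs : r ≤ s) (hQ : IsVecProb P Q) {w : Ω → Vec d}
    (hw : AEStronglyMeasurable[ℱ r] w P) (hy : MemLp (wStep ℱ P r s Q w) q P)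
    {Z : Lp (Vec d) p P} (hZ : AEStronglyMeasurable[ℱ s] Z P)
    (h : ∀ i, (∀ᵐ ω ∂P, 0 ≤ w ω i) ∨ ∀ᵐ ω ∂P, Z ω i = 0) :
    dotQCondExp ℱ P r Q w (fun ω => -Z ω)
      =ᵐ[P] fun ω => (condLoss P (ℱ r) (wStep ℱ P r s Q w) Z ω : EReal) := by
  have : q.HolderConjugate p := ENNReal.HolderConjugate.symm
  have hi : ∀ i, Integrable (fun ω => w ω i * xi ℱ P r s (Q i) ω * (-Z ω) i) P := fun i =>
    (memLp_coord hy i).integrable_mul (memLp_coord (Lp.memLp Z).neg i)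
  have hterm : ∀ i, (fun ω => (w ω i : EReal) * QCondExp ℱ P r Q (fun ω => -Z ω) i ω) =ᵐ[P]
      fun ω => ((P[fun ω => w ω i * xi ℱ P r s (Q i) ω * (-Z ω) i | ℱ r]) ω : EReal) := by
    intro i
    have := (hQ i).1
    rcases h i with h | h
    · exact coe_mul_genCondExp_xi (Q i) hT hrs (aestronglyMeasurable_coord hw i) h
        (aestronglyMeasurable_coord hZ.neg i) (hi i)
    · have h1 : QCondExp ℱ P r Q (fun ω => -Z ω) i =ᵐ[P] fun _ => ((0 : ℝ) : EReal) := by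
        refine (genCondExp_congr (g := fun _ => ((0 : ℝ) : EReal)) ?_).trans
          ((genCondExp_coe (integrable_const (0 : ℝ))).trans ?_)
        · filter_upwards [h] with ω h
          simp [h]
        · rw [condExp_const (ℱ.le r)]
      have h2 : P[fun ω => w ω i * xi ℱ P r s (Q i) ω * (-Z ω) i | ℱ r] =ᵐ[P] fun _ => (0 : ℝ) := by
        refine (condExp_congr_ae (g := fun _ => (0 : ℝ)) ?_).trans ?_
        · filter_upwards [h] with ω h
          simp [h]
        · rw [condExp_const (ℱ.le r)]
      filter_upwards [h1, h2] with ω h1 h2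
      rw [h1, h2]
      simp
  have e : (fun ω => dot (wStep ℱ P r s Q w ω) (-Z ω))
      = ∑ i, fun ω => w ω i * xi ℱ P r s (Q i) ω * (-Z ω) i := by
    ext ω; simp [dot, wStep]
  have h3 := condExp_finsetSum (s := Finset.univ) (fun i _ => hi i) (ℱ r)
  filter_upwards [ae_all_iff.2 hterm, h3] with ω h1 h3
  rw [dotQCondExp, condLoss, e, h3, Finset.sum_apply]
  simp only [h1]
  exact (map_sum (⟨⟨fun x : ℝ => (x : EReal), rfl⟩, fun _ _ => rfl⟩ : ℝ →+ EReal) _ _).symm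

end Identification

/-! ### Essential suprema and infima. -/

section EssSupAPI

variable {Ω : Type*} {mΩ : MeasurableSpace Ω} {P : Measure Ω} [IsFiniteMeasure P]
  {S S' : Set (Ω → EReal)}

theorem isEssSup_essSupFam (P : Measure Ω) [IsFiniteMeasure P] (S : Set (Ω → EReal)) :
    IsEssSup P S (essSupFam P S) := (exists_isEssSup P S).choose_spec

theorem le_essSupFam {f : Ω → EReal} (hf : f ∈ S) : f ≤ᵐ[P] essSupFam P S :=
  (isEssSup_essSupFam P S).2.1 f hf

theorem essSupFam_le {h : Ω → EReal} (hm : AEMeasurable h P) (hS : ∀ f ∈ S, f ≤ᵐ[P] h) :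
    essSupFam P S ≤ᵐ[P] h := by
  refine ((isEssSup_essSupFam P S).2.2 (hm.mk h) hm.measurable_mk fun f hf => ?_).trans
    hm.ae_eq_mk.symm.le
  exact (hS f hf).trans hm.ae_eq_mk.le

theorem essSupFam_mono (h : ∀ f ∈ S, ∃ g ∈ S', f =ᵐ[P] g) :
    essSupFam P S ≤ᵐ[P] essSupFam P S' := by
  refine essSupFam_le (isEssSup_essSupFam P S').1.aemeasurable fun f hf => ?_
  obtain ⟨g, hg, e⟩ := h f hf
  exact e.le.trans (le_essSupFam hg)

theorem essSupFam_congr (h : ∀ f ∈ S, ∃ g ∈ S', f =ᵐ[P] g) (h' : ∀ g ∈ S', ∃ f ∈ S, g =ᵐ[P] f) :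
    essSupFam P S =ᵐ[P] essSupFam P S' := (essSupFam_mono h).antisymm (essSupFam_mono h')

theorem essInfFam_le {f : Ω → EReal} (hf : f ∈ S) : essInfFam P S ≤ᵐ[P] f := by
  filter_upwards [le_essSupFam (P := P) (mem_image_of_mem (fun f ω => -f ω) hf)] with ω h
  exact EReal.neg_le.1 h

theorem le_essInfFam {h : Ω → EReal} (hm : AEMeasurable h P) (hS : ∀ f ∈ S, h ≤ᵐ[P] f) :
    h ≤ᵐ[P] essInfFam P S := by
  have : essSupFam P ((fun f ω => -f ω) '' S) ≤ᵐ[P] fun ω => -h ω := by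
    refine essSupFam_le (measurable_neg.comp_aemeasurable hm) ?_
    rintro _ ⟨f, hf, rfl⟩
    filter_upwards [hS f hf] with ω h
    exact EReal.neg_le_neg_iff.2 h
  filter_upwards [this] with ω h
  exact EReal.le_neg_of_le_neg h

theorem essInfFam_mono (h : ∀ f ∈ S', ∃ g ∈ S, f =ᵐ[P] g) :
    essInfFam P S ≤ᵐ[P] essInfFam P S' := by
  refine le_essInfFam (isEssSup_essSupFam P _).1.neg.aemeasurable fun f hf => ?_
  obtain ⟨g, hg, e⟩ := h f hf
  exact (essInfFam_le hg).trans e.symm.le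

/-- The essential supremum of a nonempty family is attained by a countable subfamily. -/
theorem exists_seq_essSupFam (hne : S.Nonempty) (hm : ∀ f ∈ S, Measurable f) :
    ∃ f : ℕ → Ω → EReal, (∀ n, f n ∈ S) ∧ essSupFam P S =ᵐ[P] fun ω => ⨆ n, f n ω := by
  set H : Set (Ω → EReal) := {h | ∃ f : ℕ → Ω → EReal, (∀ n, f n ∈ S) ∧ h = fun ω => ⨆ n, f n ω}
  obtain ⟨f0, hf0⟩ := hne
  have hHne : H.Nonempty := ⟨_, fun _ => f0, fun _ => hf0, rfl⟩
  -- A bounded strictly decreasing transform: the largest countable supremum becomes the minimiser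
  -- of a finite integral, and strictness turns equality of integrals into equality almost
  -- everywhere.
  set φ : EReal → ℝ≥0∞ := fun x => (1 + EReal.exp x)⁻¹
  have hφm : Measurable φ := by
    have : Measurable EReal.exp := EReal.measurable_exp
    fun_prop
  have hφanti : StrictAnti φ := fun a b hab => ENNReal.inv_strictAnti
    ((ENNReal.add_lt_add_iff_left ENNReal.one_ne_top).2 (EReal.exp_strictMono hab))
  have hφle : ∀ x, φ x ≤ 1 := fun x => ENNReal.inv_le_one.2 le_self_add
  set F : (Ω → EReal) → ℝ≥0∞ := fun h => ∫⁻ ω, φ (h ω) ∂P with hF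
  obtain ⟨u, -, hu, huH⟩ := exists_seq_tendsto_sInf (hHne.image F) (OrderBot.bddBelow _)
  choose h hhH hhu using huH
  choose f hfS hfh using hhH
  -- Unpairing merges the countably many countable subfamilies of a minimising sequence into a
  -- single one.
  set g : Ω → EReal := fun ω => ⨆ n : ℕ, f n.unpair.1 n.unpair.2 ω with hg
  have hgm : Measurable g := Measurable.iSup fun n => hm _ (hfS _ _)
  have hle : ∀ n, h n ≤ g := fun n ω => by
    rw [hfh n]
    refine iSup_le fun k => ?_
    have := le_iSup (fun n : ℕ => f n.unpair.1 n.unpair.2 ω) (Nat.pair n k)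
    simpa using this
  have hgmin : F g ≤ sInf (F '' H) := by
    refine ge_of_tendsto' hu fun n => ?_
    rw [← hhu n]
    exact lintegral_mono fun ω => hφanti.antitone (hle n ω)
  refine ⟨_, fun n => hfS n.unpair.1 n.unpair.2, ?_⟩
  change essSupFam P S =ᵐ[P] g
  refine (essSupFam_le hgm.aemeasurable fun k hk => ?_).antisymm ?_
  · have hkm := hm k hk
    have hmax : (fun ω => g ω ⊔ k ω) ∈ H := by
      refine ⟨fun n => Nat.casesOn n k fun n => f n.unpair.1 n.unpair.2, fun n => ?_, ?_⟩
      · cases n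
        · exact hk
        · exact hfS _ _
      · ext ω
        refine le_antisymm (sup_le (iSup_le fun n => ?_) ?_) (iSup_le fun n => ?_)
        · exact le_iSup (fun n : ℕ => (Nat.casesOn n k fun n => f n.unpair.1 n.unpair.2 :
            Ω → EReal) ω) (n + 1)
        · exact le_iSup (fun n : ℕ => (Nat.casesOn n k fun n => f n.unpair.1 n.unpair.2 :
            Ω → EReal) ω) 0
        · cases n with
          | zero => exact le_sup_right
          | succ n => exact (le_iSup (fun n : ℕ => f n.unpair.1 n.unpair.2 ω) n).trans le_sup_left
    have h1 : F g ≤ F fun ω => g ω ⊔ k ω := hgmin.trans (sInf_le (mem_image_of_mem F hmax))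
    have hfin : F (fun ω => g ω ⊔ k ω) ≠ ∞ := by
      refine ne_top_of_le_ne_top (measure_ne_top P univ) ?_
      calc F (fun ω => g ω ⊔ k ω) ≤ ∫⁻ _, 1 ∂P := lintegral_mono fun ω => hφle _
        _ = P univ := by simp
    have hae := ae_eq_of_ae_le_of_lintegral_le (μ := P) (f := fun ω => φ (g ω ⊔ k ω))
      (g := fun ω => φ (g ω)) (.of_forall fun ω => hφanti.antitone le_sup_left) hfin
      (hφm.comp hgm).aemeasurable h1
    filter_upwards [hae] with ω hω
    exact sup_eq_left.1 (hφanti.injective hω)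
  · have := ae_all_iff.2 fun n : ℕ => le_essSupFam (P := P) (hfS n.unpair.1 n.unpair.2)
    filter_upwards [this] with ω h
    exact iSup_le h

end EssSupAPI

/-! ### Monotone convergence for extended real suprema. -/

section Suprema

theorem coe_iSup_ennreal (a : ℕ → ℝ≥0∞) : ((⨆ n, a n : ℝ≥0∞) : EReal) = ⨆ n, (a n : EReal) := by
  refine le_antisymm ?_ (iSup_le fun n => EReal.coe_ennreal_le_coe_ennreal_iff.2 (le_iSup a n))
  have h0 : 0 ≤ ⨆ n, (a n : EReal) :=
    (EReal.coe_ennreal_nonneg (a 0)).trans (le_iSup (fun n => (a n : EReal)) 0)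
  rw [← EReal.coe_toENNReal h0]
  refine EReal.coe_ennreal_le_coe_ennreal_iff.2 (iSup_le fun n => ?_)
  have := EReal.toENNReal_le_toENNReal (le_iSup (fun n => (a n : EReal)) n)
  simpa using this

theorem iSup_coe_real {x : ℕ → ℝ} (h : ∀ n, 0 ≤ x n) :
    ⨆ n, (x n : EReal) = ((⨆ n, ENNReal.ofReal (x n) : ℝ≥0∞) : EReal) := by
  rw [coe_iSup_ennreal]
  exact iSup_congr fun n => by
    rw [EReal.coe_ennreal_ofReal, max_eq_left (h n)]

/-- Nonnegativity moves the statement to `[0, ∞]`, where suprema of increasing sequences are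
additive. -/
theorem iSup_coe_add {x y : ℕ → ℝ} (hx : ∀ n, 0 ≤ x n) (hy : ∀ n, 0 ≤ y n) (hx' : Monotone x)
    (hy' : Monotone y) :
    (⨆ n, (x n : EReal)) + ⨆ n, (y n : EReal) = ⨆ n, ((x n + y n : ℝ) : EReal) := by
  rw [iSup_coe_real hx, iSup_coe_real hy, iSup_coe_real fun n => add_nonneg (hx n) (hy n),
    ← EReal.coe_ennreal_add, ENNReal.iSup_add_iSup_of_monotone]
  · congr 2
    ext n
    rw [ENNReal.ofReal_add (hx n) (hy n)]
  · exact fun i j h => ENNReal.ofReal_le_ofReal (hx' h)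
  · exact fun i j h => ENNReal.ofReal_le_ofReal (hy' h)

variable {Ω : Type*} {𝓖 : MeasurableSpace Ω} {mΩ : MeasurableSpace Ω} {P : Measure Ω}

/-- Monotone convergence for a sequence with bounded integrals. -/
theorem exists_integrable_iSup {c : ℕ → Ω → ℝ} (hc : ∀ n, Integrable (c n) P)
    (h0 : ∀ n, 0 ≤ᵐ[P] c n) (hmono : ∀ᵐ ω ∂P, Monotone fun n => c n ω) {K : ℝ}
    (hK : ∀ n, ∫ ω, c n ω ∂P ≤ K) :
    ∃ β : Ω → ℝ, Integrable β P ∧ (fun ω => ⨆ n, (c n ω : EReal)) =ᵐ[P] (fun ω => (β ω : EReal)) ∧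
      ∫ ω, β ω ∂P ≤ K := by
  have hK0 : 0 ≤ K := (integral_nonneg_of_ae (h0 0)).trans (hK 0)
  set b : Ω → ℝ≥0∞ := fun ω => ⨆ n, ENNReal.ofReal (c n ω)
  have hcm : ∀ n, AEMeasurable (fun ω => ENNReal.ofReal (c n ω)) P := fun n =>
    ENNReal.measurable_ofReal.comp_aemeasurable (hc n).1.aemeasurable
  have hbm : AEMeasurable b P := AEMeasurable.iSup hcm
  have hb : ∫⁻ ω, b ω ∂P ≤ ENNReal.ofReal K := by
    rw [lintegral_iSup' hcm]
    · refine iSup_le fun n => ?_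
      rw [← ofReal_integral_eq_lintegral_ofReal (hc n) (h0 n)]
      exact ENNReal.ofReal_le_ofReal (hK n)
    · filter_upwards [hmono] with ω h i j hij
      exact ENNReal.ofReal_le_ofReal (h hij)
  have hbt : ∫⁻ ω, b ω ∂P ≠ ∞ := ne_top_of_le_ne_top ENNReal.ofReal_ne_top hb
  refine ⟨fun ω => (b ω).toReal, integrable_toReal_of_lintegral_ne_top hbm hbt, ?_, ?_⟩
  · filter_upwards [ae_all_iff.2 h0, ae_lt_top' hbm hbt] with ω h h1
    rw [iSup_coe_real h, EReal.coe_ennreal_toReal h1.ne]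
  · rw [integral_toReal hbm (ae_lt_top' hbm hbt)]
    exact ENNReal.toReal_le_of_le_ofReal hK0 hb

theorem genCondExp_iSup [IsFiniteMeasure P] (hm : 𝓖 ≤ mΩ) {c : ℕ → Ω → ℝ}
    (hc : ∀ n, Integrable (c n) P) (h0 : ∀ n, 0 ≤ᵐ[P] c n)
    (hmono : ∀ᵐ ω ∂P, Monotone fun n => c n ω) :
    genCondExp P 𝓖 (fun ω => ⨆ n, (c n ω : EReal))
      =ᵐ[P] fun ω => ⨆ n, ((P[c n | 𝓖]) ω : EReal) := by
  have h1 : condLExp 𝓖 P (fun x => (⨆ n, (c n x : EReal)).toENNReal)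
      =ᵐ[P] condLExp 𝓖 P fun x => ⨆ n, ENNReal.ofReal (c n x) := by
    refine condLExp_congr_ae ?_
    filter_upwards [ae_all_iff.2 h0] with ω h
    rw [iSup_coe_real h, EReal.toENNReal_coe]
  have h2 : condLExp 𝓖 P (fun x => (-⨆ n, (c n x : EReal)).toENNReal) =ᵐ[P] 0 := by
    refine (condLExp_congr_ae (Y := 0) ?_).trans (by rw [condLExp_zero])
    filter_upwards [ae_all_iff.2 h0] with ω h
    rw [iSup_coe_real h, EReal.toENNReal_of_nonpos]
    · rfl
    · rw [EReal.neg_le, neg_zero]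
      exact EReal.coe_ennreal_nonneg _
  have h3 := condLExp_iSup (P := P) hm
    (fun n => ENNReal.measurable_ofReal.comp_aemeasurable (hc n).1.aemeasurable) (by
      filter_upwards [hmono] with ω h i j hij
      exact ENNReal.ofReal_le_ofReal (h hij))
  have h4 := ae_all_iff.2 fun n => condLExp_ofReal 𝓖 (hc n) (h0 n)
  filter_upwards [h1, h2, h3, h4, ae_all_iff.2 fun n => condExp_nonneg (m := 𝓖) (h0 n)]
    with ω e1 e2 e3 e4 e5
  rw [genCondExp, e1, e2, iSup_coe_real e5]
  simp only [Function.comp_def] at e3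
  rw [e3]
  simp only [e4]
  simp

end Suprema

/-! ### Penalties as increasing limits of conditional losses. -/

section Penalty

variable {Ω : Type*} {𝓖 𝓗 : MeasurableSpace Ω} {mΩ : MeasurableSpace Ω} {P : Measure Ω} {d : ℕ}
  {p q : ℝ≥0∞}

/-- The family `A` is stable under pasting along `𝓖`-measurable sets. -/
def StablePasting (P : Measure Ω) (𝓖 : MeasurableSpace Ω) (A : Set (Lp (Vec d) p P)) : Prop :=
  ∀ E, MeasurableSet[𝓖] E → ∀ X ∈ A, ∀ Y ∈ A, ∀ Z : Lp (Vec d) p P,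
    (∀ᵐ ω ∂P, (ω ∈ E → Z ω = X ω) ∧ (ω ∉ E → Z ω = Y ω)) → Z ∈ A

theorem StablePasting.mono {A : Set (Lp (Vec d) p P)} (h : StablePasting P 𝓗 A) (hm : 𝓖 ≤ 𝓗) :
    StablePasting P 𝓖 A := fun E hE => h E (hm E hE)

theorem StablePasting.inter {A B : Set (Lp (Vec d) p P)} (hA : StablePasting P 𝓖 A)
    (hB : StablePasting P 𝓖 B) : StablePasting P 𝓖 (A ∩ B) :=
  fun E hE X hX Y hY Z hZ => ⟨hA E hE X hX.1 Y hY.1 Z hZ, hB E hE X hX.2 Y hY.2 Z hZ⟩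

/-- The penalty `ess sup {E[vᵀ(-Z) | 𝓖] | Z ∈ A}` of a density `v`. -/
noncomputable def pen (P : Measure Ω) [IsFiniteMeasure P] (𝓖 : MeasurableSpace Ω)
    (A : Set (Lp (Vec d) p P)) (v : Ω → Vec d) : Ω → EReal :=
  essSupFam P {g | ∃ Z ∈ A, g = fun ω => (condLoss P 𝓖 v Z ω : EReal)}

theorem exists_paste [Fact (1 ≤ p)] {E : Set Ω} (hE : MeasurableSet E) (X Y : Lp (Vec d) p P) :
    ∃ Z : Lp (Vec d) p P, ∀ᵐ ω ∂P, (ω ∈ E → Z ω = X ω) ∧ (ω ∉ E → Z ω = Y ω) := by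
  obtain ⟨T, hT, -⟩ := exists_indicatorCLM (P := P) (d := d) (p := p) hE
  refine ⟨T X + (Y - T Y), ?_⟩
  filter_upwards [hT X, hT Y, Lp.coeFn_add (T X) (Y - T Y), Lp.coeFn_sub Y (T Y)] with ω h1 h2 h3 h4
  rw [h3, Pi.add_apply, h4, Pi.sub_apply, h1, h2]
  by_cases h : ω ∈ E <;> simp [h]

variable [IsFiniteMeasure P] {A : Set (Lp (Vec d) p P)} {v : Ω → Vec d}

theorem condLoss_le_pen {Z : Lp (Vec d) p P} (hZ : Z ∈ A) :
    ∀ᵐ ω ∂P, (condLoss P 𝓖 v Z ω : EReal) ≤ pen P 𝓖 A v ω :=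
  le_essSupFam ⟨Z, hZ, rfl⟩

theorem pen_le {h : Ω → EReal} (hm : AEMeasurable h P)
    (hA : ∀ Z ∈ A, ∀ᵐ ω ∂P, (condLoss P 𝓖 v Z ω : EReal) ≤ h ω) : pen P 𝓖 A v ≤ᵐ[P] h := by
  refine essSupFam_le hm ?_
  rintro _ ⟨Z, hZ, rfl⟩
  exact hA Z hZ

theorem pen_congr {v' : Ω → Vec d} (h : ∀ Z ∈ A, condLoss P 𝓖 v Z =ᵐ[P] condLoss P 𝓖 v' Z) :
    pen P 𝓖 A v =ᵐ[P] pen P 𝓖 A v' := by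
  refine essSupFam_congr ?_ ?_
  · rintro _ ⟨Z, hZ, rfl⟩
    refine ⟨_, ⟨Z, hZ, rfl⟩, ?_⟩
    filter_upwards [h Z hZ] with ω e
    rw [e]
  · rintro _ ⟨Z, hZ, rfl⟩
    refine ⟨_, ⟨Z, hZ, rfl⟩, ?_⟩
    filter_upwards [h Z hZ] with ω e
    rw [e]

theorem pen_nonneg (hm : 𝓖 ≤ mΩ) (h0 : 0 ∈ A) : ∀ᵐ ω ∂P, 0 ≤ pen P 𝓖 A v ω := by
  filter_upwards [condLoss_le_pen (v := v) (𝓖 := 𝓖) h0,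
    condLoss_zero (P := P) (p := p) (v := v) hm] with ω h1 h2
  rw [h2] at h1
  exact h1

theorem measurable_condLoss (hm : 𝓖 ≤ mΩ) (Z : Lp (Vec d) p P) :
    Measurable fun ω => (condLoss P 𝓖 v Z ω : EReal) :=
  (stronglyMeasurable_condExp.measurable.mono hm le_rfl).coe_real_ereal

variable [Fact (1 ≤ p)] [p.HolderConjugate q]

/-- The set where the loss of `X` dominates that of `Y` is `𝓖`-measurable, so pasting along it stays
in `A` and commutes with the conditional expectation. -/
theorem exists_condLoss_max (hm : 𝓖 ≤ mΩ) (hv : MemLp v q P) (hA : StablePasting P 𝓖 A)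
    {X Y : Lp (Vec d) p P} (hX : X ∈ A) (hY : Y ∈ A) :
    ∃ Z ∈ A, condLoss P 𝓖 v Z =ᵐ[P] fun ω => max (condLoss P 𝓖 v X ω) (condLoss P 𝓖 v Y ω) := by
  set E : Set Ω := {ω | condLoss P 𝓖 v Y ω ≤ condLoss P 𝓖 v X ω} with hEdef
  have hE : MeasurableSet[𝓖] E :=
    @measurableSet_le _ _ _ _ _ 𝓖 _ _ _ _ _ stronglyMeasurable_condExp.measurable
      stronglyMeasurable_condExp.measurable
  obtain ⟨Z, hZ⟩ := exists_paste (hm E hE) X Y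
  refine ⟨Z, hA E hE X hX Y hY Z hZ, ?_⟩
  have h1 : condLoss P 𝓖 v Z =ᵐ[P] P[E.indicator (fun ω => dot (v ω) (-X ω))
      + Eᶜ.indicator (fun ω => dot (v ω) (-Y ω)) | 𝓖] := by
    refine condExp_congr_ae ?_
    filter_upwards [hZ] with ω h
    by_cases hω : ω ∈ E
    · simp [hω, h.1 hω]
    · simp [hω, h.2 hω]
  have h2 := condExp_add (m := 𝓖) ((integrable_loss hv X).indicator (hm E hE))
    ((integrable_loss hv Y).indicator (hm _ hE.compl))
  filter_upwards [h1, h2, condExp_indicator (integrable_loss hv X) hE,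
    condExp_indicator (integrable_loss hv Y) hE.compl] with ω e1 e2 e3 e4
  rw [e1, e2, Pi.add_apply, e3, e4]
  by_cases hω : ω ∈ E
  · have : condLoss P 𝓖 v Y ω ≤ condLoss P 𝓖 v X ω := hω
    rw [max_eq_left this]
    simp [hω, condLoss]
  · have : condLoss P 𝓖 v X ω ≤ condLoss P 𝓖 v Y ω := (not_le.1 hω).le
    rw [max_eq_right this]
    simp [hω, condLoss]

/-- Pasting makes the family of losses closed under maxima, so the running maxima of a countable
subfamily attaining the supremum are themselves losses. Starting them from the loss of `0` makes
them nonnegative, as monotone convergence requires. -/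
theorem exists_seq_pen (hm : 𝓖 ≤ mΩ) (hv : MemLp v q P) (hA : StablePasting P 𝓖 A) (h0 : 0 ∈ A) :
    ∃ Z : ℕ → Lp (Vec d) p P, (∀ n, Z n ∈ A) ∧
      (∀ᵐ ω ∂P, Monotone fun n => condLoss P 𝓖 v (Z n) ω) ∧
      (∀ n, 0 ≤ᵐ[P] condLoss P 𝓖 v (Z n)) ∧
      pen P 𝓖 A v =ᵐ[P] fun ω => ⨆ n, (condLoss P 𝓖 v (Z n) ω : EReal) := by
  obtain ⟨f, hf, hsup⟩ := exists_seq_essSupFam (P := P)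
    (S := {g | ∃ Z ∈ A, g = fun ω => (condLoss P 𝓖 v Z ω : EReal)}) ⟨_, 0, h0, rfl⟩ (by
      rintro _ ⟨Z, -, rfl⟩
      exact measurable_condLoss hm Z)
  choose X hX hXf using hf
  choose mx hmxA hmx using fun X Y : A => exists_condLoss_max hm hv hA X.2 Y.2
  let Y : ℕ → A := fun n => Nat.rec ⟨mx ⟨0, h0⟩ ⟨X 0, hX 0⟩, hmxA _ _⟩
    (fun n y => ⟨mx y ⟨X (n + 1), hX (n + 1)⟩, hmxA _ _⟩) n
  have hY0 := hmx ⟨0, h0⟩ ⟨X 0, hX 0⟩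
  have hYs : ∀ n, condLoss P 𝓖 v (Y (n + 1)).1 =ᵐ[P] fun ω =>
      max (condLoss P 𝓖 v (Y n).1 ω) (condLoss P 𝓖 v (X (n + 1)) ω) := fun n => hmx (Y n) _
  have hmono : ∀ᵐ ω ∂P, Monotone fun n => condLoss P 𝓖 v (Y n).1 ω := by
    filter_upwards [ae_all_iff.2 hYs] with ω h
    exact monotone_nat_of_le_succ fun n => by rw [h n]; exact le_max_left _ _
  have hnn : 0 ≤ᵐ[P] condLoss P 𝓖 v (Y 0).1 := by
    filter_upwards [hY0, condLoss_zero (P := P) (p := p) (v := v) hm] with ω e e0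
    change 0 ≤ condLoss P 𝓖 v (Y 0).1 ω
    change condLoss P 𝓖 v (Y 0).1 ω = _ at e
    rw [e, e0]
    exact le_max_left _ _
  refine ⟨fun n => (Y n).1, fun n => (Y n).2, hmono, fun n => ?_, ?_⟩
  · filter_upwards [hnn, hmono] with ω h1 h2
    exact le_trans h1 (h2 (Nat.zero_le n))
  · refine Filter.EventuallyLE.antisymm ?_ ?_
    · filter_upwards [hsup, ae_all_iff.2 hYs, hY0] with ω e1 e2 e3
      change essSupFam P _ ω ≤ _
      rw [e1]
      refine iSup_le fun n => le_trans ?_ (le_iSup (fun n => (condLoss P 𝓖 v (Y n).1 ω : EReal)) n)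
      rw [hXf n]
      refine EReal.coe_le_coe_iff.2 ?_
      cases n with
      | zero => exact (le_max_right _ _).trans e3.ge
      | succ n => exact (le_max_right _ _).trans (e2 n).ge
    · have := ae_all_iff.2 fun n => condLoss_le_pen (P := P) (𝓖 := 𝓖) (v := v) (Y n).2
      filter_upwards [this] with ω h
      exact iSup_le h

/-- A penalty whose expectation is bounded above is integrable. -/
theorem exists_integrable_pen (hm : 𝓖 ≤ mΩ) (hv : MemLp v q P) (hA : StablePasting P 𝓖 A)
    (h0 : 0 ∈ A) {K : ℝ} (hK : ∀ Z ∈ A, -pair P v Z ≤ K) :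
    ∃ β : Ω → ℝ, Integrable β P ∧ pen P 𝓖 A v =ᵐ[P] (fun ω => (β ω : EReal)) ∧ ∫ ω, β ω ∂P ≤ K := by
  obtain ⟨Z, hZ, hmono, hnn, hsup⟩ := exists_seq_pen hm hv hA h0
  obtain ⟨β, h1, h2, h3⟩ := exists_integrable_iSup (fun n => integrable_condLoss) hnn hmono (K := K)
    fun n => by rw [integral_condLoss hm]; exact hK _ (hZ n)
  exact ⟨β, h1, hsup.trans h2, h3⟩

/-- The sequence attaining the `𝓗`-penalty works: monotone convergence moves the conditional
expectation inside the supremum, and the tower property turns the terms into `𝓖`-losses. -/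
theorem exists_seq_genCondExp_pen (h1 : 𝓖 ≤ 𝓗) (h2 : 𝓗 ≤ mΩ) (hv : MemLp v q P)
    (hA : StablePasting P 𝓗 A) (h0 : 0 ∈ A) :
    ∃ Z : ℕ → Lp (Vec d) p P, (∀ n, Z n ∈ A) ∧
      (∀ᵐ ω ∂P, Monotone fun n => condLoss P 𝓖 v (Z n) ω) ∧
      (∀ n, 0 ≤ᵐ[P] condLoss P 𝓖 v (Z n)) ∧
      genCondExp P 𝓖 (pen P 𝓗 A v) =ᵐ[P] fun ω => ⨆ n, (condLoss P 𝓖 v (Z n) ω : EReal) := by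
  obtain ⟨Z, hZ, hmono, hnn, hsup⟩ := exists_seq_pen h2 hv hA h0
  have ht : ∀ n, P[condLoss P 𝓗 v (Z n) | 𝓖] =ᵐ[P] condLoss P 𝓖 v (Z n) := fun n =>
    condLoss_tower h1 h2 v (Z n)
  refine ⟨Z, hZ, ?_, fun n => ?_, ?_⟩
  · have hstep : ∀ n, P[condLoss P 𝓗 v (Z n) | 𝓖] ≤ᵐ[P] P[condLoss P 𝓗 v (Z (n + 1)) | 𝓖] :=
      fun n => condExp_mono integrable_condLoss integrable_condLoss (by
        filter_upwards [hmono] with ω h using h n.le_succ)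
    filter_upwards [ae_all_iff.2 hstep, ae_all_iff.2 ht] with ω h e
    exact monotone_nat_of_le_succ fun n => by rw [← e, ← e]; exact h n
  · filter_upwards [condExp_nonneg (m := 𝓖) (hnn n), ht n] with ω h e
    rw [← e]; exact h
  · refine (genCondExp_congr hsup).trans ?_
    filter_upwards [genCondExp_iSup (𝓖 := 𝓖) (h1.trans h2) (fun n => integrable_condLoss) hnn hmono,
      ae_all_iff.2 ht] with ω e1 e2
    rw [e1]
    simp only [e2]

/-- The sum of a penalty and an expected penalty is the supremum of expected losses of sums. -/
theorem exists_seq_pen_add (h1 : 𝓖 ≤ 𝓗) (h2 : 𝓗 ≤ mΩ) (hv : MemLp v q P)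
    {B : Set (Lp (Vec d) p P)} (hA : StablePasting P 𝓖 A) (h0 : 0 ∈ A)
    (hB : StablePasting P 𝓗 B) (h0' : 0 ∈ B) :
    ∃ Z : ℕ → Lp (Vec d) p P, (∀ n, Z n ∈ A + B) ∧
      (∀ᵐ ω ∂P, Monotone fun n => condLoss P 𝓖 v (Z n) ω) ∧
      (∀ n, 0 ≤ᵐ[P] condLoss P 𝓖 v (Z n)) ∧
      (fun ω => pen P 𝓖 A v ω + genCondExp P 𝓖 (pen P 𝓗 B v) ω)
        =ᵐ[P] fun ω => ⨆ n, (condLoss P 𝓖 v (Z n) ω : EReal) := by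
  obtain ⟨X, hX, hXm, hXn, hXs⟩ := exists_seq_pen (h1.trans h2) hv hA h0
  obtain ⟨Y, hY, hYm, hYn, hYs⟩ := exists_seq_genCondExp_pen h1 h2 hv hB h0'
  have ha := ae_all_iff.2 fun n => condLoss_add (P := P) (𝓖 := 𝓖) hv (X n) (Y n)
  refine ⟨fun n => X n + Y n, fun n => add_mem_add (hX n) (hY n), ?_, fun n => ?_, ?_⟩
  · filter_upwards [hXm, hYm, ha] with ω m1 m2 e i j hij
    simp only [e]
    exact add_le_add (m1 hij) (m2 hij)
  · filter_upwards [hXn n, hYn n, ha] with ω m1 m2 e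
    rw [e]
    exact add_nonneg m1 m2
  · filter_upwards [hXm, hYm, ha, hXs, hYs, ae_all_iff.2 hXn, ae_all_iff.2 hYn]
      with ω m1 m2 e s1 s2 n1 n2
    simp only [e, s1, s2]
    exact iSup_coe_add n1 n2 m1 m2

end Penalty

/-! ### The test vectors `1_E e_i`. -/

section Boxes

variable {Ω : Type*} {mΩ : MeasurableSpace Ω} {P : Measure Ω} [IsFiniteMeasure P] {d : ℕ}
  {p q : ℝ≥0∞}

theorem memLp_box {E : Set Ω} (hE : MeasurableSet E) (i : Fin d) (r : ℝ≥0∞) :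
    MemLp (E.indicator fun _ => (EuclideanSpace.single i (1 : ℝ) : Vec d)) r P :=
  (memLp_const _).indicator hE

/-- The random vector `1_E e_i`. -/
noncomputable def box (P : Measure Ω) [IsFiniteMeasure P] (p : ℝ≥0∞) {E : Set Ω}
    (hE : MeasurableSet E) (i : Fin d) : Lp (Vec d) p P := (memLp_box (P := P) hE i p).toLp _

theorem coeFn_box {E : Set Ω} (hE : MeasurableSet E) (i : Fin d) :
    box P p hE i =ᵐ[P] E.indicator fun _ => EuclideanSpace.single i 1 := MemLp.coeFn_toLp _

theorem pair_box {E : Set Ω} (hE : MeasurableSet E) (i : Fin d) (v : Ω → Vec d) :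
    pair P v (box P p hE i) = ∫ ω in E, v ω i ∂P := by
  rw [pair, ← integral_indicator hE]
  refine integral_congr_ae ?_
  filter_upwards [coeFn_box (P := P) (p := p) hE i] with ω h
  rw [h]
  by_cases hω : ω ∈ E <;> simp [hω, dot_single]

theorem box_pair {E : Set Ω} (hE : MeasurableSet E) (i : Fin d) (X : Lp (Vec d) p P) :
    pair P (E.indicator fun _ => EuclideanSpace.single i 1) X = ∫ ω in E, X ω i ∂P := by
  rw [pair, ← integral_indicator hE]
  refine integral_congr_ae (.of_forall fun ω => ?_)
  by_cases hω : ω ∈ E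
  · simp [hω, dot_comm (EuclideanSpace.single i 1), dot_single]
  · simp [hω]

/-- Conditional expectation is self-adjoint: both integrals equal that of `E[y | 𝓖] E[x | 𝓖]`. -/
theorem integral_condExp_mul_comm {𝓖 : MeasurableSpace Ω} (hm : 𝓖 ≤ mΩ) [p.HolderConjugate q]
    {x y : Ω → ℝ} (hx : MemLp x p P) (hy : MemLp y q P) :
    ∫ ω, (P[y | 𝓖]) ω * x ω ∂P = ∫ ω, y ω * (P[x | 𝓖]) ω ∂P := by
  have : q.HolderConjugate p := ENNReal.HolderConjugate.symm
  have hq : 1 ≤ q := ENNReal.HolderConjugate.one_le q p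
  have hp : 1 ≤ p := ENNReal.HolderConjugate.one_le p q
  have h1 := condExp_mul_of_aestronglyMeasurable_left (m := 𝓖) (μ := P) (f := P[y | 𝓖]) (g := x)
    stronglyMeasurable_condExp.aestronglyMeasurable ((MemLp.condExp hq hy).integrable_mul hx)
    (hx.integrable hp)
  have h2 := condExp_mul_of_aestronglyMeasurable_right (m := 𝓖) (μ := P) (g := P[x | 𝓖]) (f := y)
    stronglyMeasurable_condExp.aestronglyMeasurable (hy.integrable_mul (MemLp.condExp hp hx))
    (hy.integrable hq)
  calc ∫ ω, (P[y | 𝓖]) ω * x ω ∂P = ∫ ω, (P[P[y | 𝓖] * x | 𝓖]) ω ∂P := (integral_condExp hm).symm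
    _ = ∫ ω, (P[y * P[x | 𝓖] | 𝓖]) ω ∂P := integral_congr_ae (h1.trans h2.symm)
    _ = _ := integral_condExp hm

end Boxes

theorem aestronglyMeasurable_indicator {Ω : Type*} {𝓖 mΩ : MeasurableSpace Ω} {P : Measure[mΩ] Ω}
    {d : ℕ} {f : Ω → Vec d} (hf : AEStronglyMeasurable[𝓖] f P) {E : Set Ω}
    (hE : MeasurableSet[𝓖] E) : AEStronglyMeasurable[𝓖] (E.indicator f) P := by
  refine ⟨E.indicator (hf.mk f), hf.stronglyMeasurable_mk.indicator hE, ?_⟩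
  filter_upwards [hf.ae_eq_mk] with ω h
  by_cases hω : ω ∈ E <;> simp [hω, h]

/-! ### Eligible portfolios: algebra and closedness. -/

section Eligible

variable {Ω ι : Type*} {mΩ : MeasurableSpace Ω} [LinearOrder ι]
  {P : Measure Ω} {ℱ : Filtration ι mΩ} {d m : ℕ} {p q : ℝ≥0∞} {r s : ι}

theorem mem_Mt {X : Lp (Vec d) p P} : X ∈ Mt ℱ P m r ↔
    AEStronglyMeasurable[ℱ r] X P ∧ ∀ᵐ ω ∂P, ∀ i : Fin d, m ≤ i.val → X ω i = 0 :=
  ⟨fun h => h.2, fun h => ⟨Lp.memLp X, h⟩⟩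

theorem mem_MtPos {X : Lp (Vec d) p P} : X ∈ MtPos ℱ P m r ↔
    X ∈ Mt ℱ P m r ∧ ∀ᵐ ω ∂P, ∀ i : Fin d, 0 ≤ X ω i :=
  ⟨fun h => ⟨⟨h.1, h.2.1, h.2.2.mono fun _ h => h.1⟩, h.2.2.mono fun _ h => h.2⟩,
    fun h => ⟨h.1.1, h.1.2.1, by filter_upwards [h.1.2.2, h.2] with ω h1 h2 using ⟨h1, h2⟩⟩⟩

/-- The eligible portfolios as a subspace. -/
noncomputable def MtSub (ℱ : Filtration ι mΩ) (P : Measure Ω) (d m : ℕ) (p : ℝ≥0∞) (r : ι) :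
    Submodule ℝ (Lp (Vec d) p P) where
  carrier := Mt ℱ P m r
  zero_mem' := by
    refine mem_Mt.2 ⟨?_, ?_⟩
    · exact (aestronglyMeasurable_const (b := (0 : Vec d))).congr (Lp.coeFn_zero _ _ _).symm
    · filter_upwards [Lp.coeFn_zero (Vec d) p P] with ω h i _
      rw [h]; rfl
  add_mem' := by
    intro X Y hX hY
    have hX := mem_Mt.1 hX
    have hY := mem_Mt.1 hY
    refine mem_Mt.2 ⟨(hX.1.add hY.1).congr (Lp.coeFn_add X Y).symm, ?_⟩
    filter_upwards [Lp.coeFn_add X Y, hX.2, hY.2] with ω h h1 h2 i hi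
    rw [h, Pi.add_apply, PiLp.add_apply, h1 i hi, h2 i hi, add_zero]
  smul_mem' := by
    intro c X hX
    have hX := mem_Mt.1 hX
    refine mem_Mt.2 ⟨(hX.1.const_smul c).congr (Lp.coeFn_smul c X).symm, ?_⟩
    filter_upwards [Lp.coeFn_smul c X, hX.2] with ω h h1 i hi
    rw [h, Pi.smul_apply, PiLp.smul_apply, h1 i hi, smul_zero]

theorem Mt_mono (h : r ≤ s) : (Mt ℱ P m r : Set (Lp (Vec d) p P)) ⊆ Mt ℱ P m s := fun _ hX =>
  mem_Mt.2 ⟨(mem_Mt.1 hX).1.mono (ℱ.mono h), (mem_Mt.1 hX).2⟩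

theorem zero_mem_MtPos : (0 : Lp (Vec d) p P) ∈ MtPos ℱ P m r := by
  refine mem_MtPos.2 ⟨(MtSub ℱ P d m p r).zero_mem, ?_⟩
  filter_upwards [Lp.coeFn_zero (Vec d) p P] with ω h i
  rw [h]; rfl

theorem MtPos_add {X Y : Lp (Vec d) p P} (hX : X ∈ MtPos ℱ P m r) (hY : Y ∈ MtPos ℱ P m r) :
    X + Y ∈ MtPos ℱ P m r := by
  have hX := mem_MtPos.1 hX
  have hY := mem_MtPos.1 hY
  refine mem_MtPos.2 ⟨(MtSub ℱ P d m p r).add_mem hX.1 hY.1, ?_⟩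
  filter_upwards [Lp.coeFn_add X Y, hX.2, hY.2] with ω h h1 h2 i
  rw [h, Pi.add_apply, PiLp.add_apply]
  exact add_nonneg (h1 i) (h2 i)

theorem MtPos_smul {X : Lp (Vec d) p P} (hX : X ∈ MtPos ℱ P m r) {c : ℝ} (hc : 0 ≤ c) :
    c • X ∈ MtPos ℱ P m r := by
  have hX := mem_MtPos.1 hX
  refine mem_MtPos.2 ⟨(MtSub ℱ P d m p r).smul_mem c hX.1, ?_⟩
  filter_upwards [Lp.coeFn_smul c X, hX.2] with ω h h1 i
  rw [h, Pi.smul_apply, PiLp.smul_apply]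
  exact mul_nonneg hc (h1 i)

theorem stablePasting_Mt : StablePasting P (ℱ r) (Mt ℱ P m r : Set (Lp (Vec d) p P)) := by
  classical
  intro E hE X hX Y hY Z hZ
  have hX := mem_Mt.1 hX
  have hY := mem_Mt.1 hY
  refine mem_Mt.2 ⟨?_, ?_⟩
  · refine AEStronglyMeasurable.congr (f := fun ω => E.indicator X ω + Eᶜ.indicator Y ω)
      ((aestronglyMeasurable_indicator hX.1 hE).add
        (aestronglyMeasurable_indicator hY.1 hE.compl)) ?_
    filter_upwards [hZ] with ω h
    by_cases hω : ω ∈ E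
    · simp [hω, h.1 hω]
    · simp [hω, h.2 hω]
  · filter_upwards [hZ, hX.2, hY.2] with ω h h1 h2 i hi
    by_cases hω : ω ∈ E
    · rw [h.1 hω, h1 i hi]
    · rw [h.2 hω, h2 i hi]

theorem convex_MtPos : Convex ℝ (MtPos ℱ P m r : Set (Lp (Vec d) p P)) :=
  fun _ hX _ hY _ _ ha hb _ => MtPos_add (MtPos_smul hX ha) (MtPos_smul hY hb)

variable [IsFiniteMeasure P]

theorem box_mem_MtPos {E : Set Ω} (hE : MeasurableSet[ℱ r] E) {i : Fin d} (hi : i.val < m) :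
    box P p (ℱ.le r E hE) i ∈ MtPos ℱ P m r := by
  have hb := coeFn_box (P := P) (p := p) (ℱ.le r E hE) i
  refine mem_MtPos.2 ⟨mem_Mt.2 ⟨?_, ?_⟩, ?_⟩
  · exact AEStronglyMeasurable.congr (aestronglyMeasurable_indicator
      aestronglyMeasurable_const hE) hb.symm
  · filter_upwards [hb] with ω h j hj
    have : j ≠ i := fun e => by rw [e] at hj; omega
    rw [h]
    by_cases hω : ω ∈ E <;> simp [hω, this]
  · filter_upwards [hb] with ω h j
    rw [h]
    by_cases hω : ω ∈ E
    · by_cases hj : j = i <;> simp [hω, hj]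
    · simp [hω]

theorem box_nonneg {E : Set Ω} (hE : MeasurableSet E) (i : Fin d) :
    ∀ᵐ ω ∂P, ∀ j, 0 ≤ (box P p hE i : Lp (Vec d) p P) ω j := by
  filter_upwards [coeFn_box (P := P) (p := p) hE i] with ω h j
  rw [h]
  by_cases hω : ω ∈ E
  · by_cases hj : j = i <;> simp [hω, hj]
  · simp [hω]

variable [Fact (1 ≤ p)] [p.HolderConjugate q]

theorem nonneg_of_pair_nonneg {v : Ω → Vec d} (hv : MemLp v q P)
    (h : ∀ Y : Lp (Vec d) p P, (∀ᵐ ω ∂P, ∀ i, 0 ≤ Y ω i) → 0 ≤ pair P v Y) (i : Fin d) :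
    ∀ᵐ ω ∂P, 0 ≤ v ω i := by
  have : q.HolderConjugate p := ENNReal.HolderConjugate.symm
  have hq : 1 ≤ q := ENNReal.HolderConjugate.one_le q p
  refine ae_nonneg_of_forall_setIntegral_nonneg ((memLp_coord hv i).integrable hq) fun E hE _ => ?_
  rw [← pair_box (p := p) hE i]
  exact h _ (box_nonneg hE i)

theorem condExp_eq_of_pair_eq {v w : Ω → Vec d} (hv : MemLp v q P) (hw : MemLp w q P)
    (hwm : AEStronglyMeasurable[ℱ r] w P)
    (h : ∀ u ∈ (Mt ℱ P m r : Set (Lp (Vec d) p P)), pair P v u = pair P w u) {i : Fin d}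
    (hi : i.val < m) : P[fun ω => v ω i | ℱ r] =ᵐ[P] fun ω => w ω i := by
  have : q.HolderConjugate p := ENNReal.HolderConjugate.symm
  have hq : 1 ≤ q := ENNReal.HolderConjugate.one_le q p
  refine (ae_eq_condExp_of_forall_setIntegral_eq (ℱ.le r) ((memLp_coord hv i).integrable hq)
    (fun E _ _ => ((memLp_coord hw i).integrable hq).integrableOn) (fun E hE _ => ?_)
    (aestronglyMeasurable_coord hwm i)).symm
  rw [← pair_box (p := p) (ℱ.le r E hE) i, ← pair_box (p := p) (ℱ.le r E hE) i]
  exact (h _ (mem_MtPos.1 (box_mem_MtPos hE hi)).1).symm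

/-- Nonnegativity is tested by integrals over measurable sets, that is, by pairings with `1_E e_i`;
the set is an intersection of closed half-spaces, also for the weak* topology. -/
theorem isClosed_ae_nonneg (i : Fin d) :
    IsClosed[lpTop d p P] {X : Lp (Vec d) p P | ∀ᵐ ω ∂P, 0 ≤ X ω i} := by
  have : Fact (1 ≤ p.conjExponent) := ⟨ENNReal.HolderConjugate.one_le _ p⟩
  let _ := lpTop d p P
  have hp : 1 ≤ p := Fact.out
  have e : {X : Lp (Vec d) p P | ∀ᵐ ω ∂P, 0 ≤ X ω i}
      = ⋂ (E : Set Ω) (_ : MeasurableSet E),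
        {X | 0 ≤ pair P (E.indicator fun _ => EuclideanSpace.single i 1) X} := by
    ext X
    simp only [mem_ofPred_eq, mem_iInter]
    constructor
    · intro h E hE
      rw [box_pair hE]
      exact setIntegral_nonneg_of_ae h
    · intro h
      refine ae_nonneg_of_forall_setIntegral_nonneg
        ((memLp_coord (Lp.memLp X) i).integrable hp) fun E hE _ => ?_
      rw [← box_pair hE]
      exact h E hE
  rw [e]
  exact isClosed_iInter fun E => isClosed_iInter fun hE =>
    isClosed_le_pair (q := p.conjExponent) (memLp_box hE i _) 0

theorem isClosed_ae_eq_zero (i : Fin d) :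
    IsClosed[lpTop d p P] {X : Lp (Vec d) p P | ∀ᵐ ω ∂P, X ω i = 0} := by
  let _ := lpTop d p P
  have := lpTop_isTopologicalAddGroup (d := d) (p := p) (P := P)
  have e : {X : Lp (Vec d) p P | ∀ᵐ ω ∂P, X ω i = 0}
      = {X : Lp (Vec d) p P | ∀ᵐ ω ∂P, 0 ≤ X ω i}
        ∩ (fun X => -X) ⁻¹' {X : Lp (Vec d) p P | ∀ᵐ ω ∂P, 0 ≤ X ω i} := by
    ext X
    simp only [mem_ofPred_eq, mem_inter_iff, mem_preimage]
    constructor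
    · intro h
      refine ⟨h.mono fun ω h => h.ge, ?_⟩
      filter_upwards [h, Lp.coeFn_neg X] with ω h1 h2
      rw [h2]; simp [h1]
    · rintro ⟨h1, h2⟩
      filter_upwards [h1, h2, Lp.coeFn_neg X] with ω h1 h2 h3
      rw [h3] at h2
      simp only [Pi.neg_apply, PiLp.neg_apply, Left.nonneg_neg_iff] at h2
      exact le_antisymm h2 h1
  rw [e]
  exact (isClosed_ae_nonneg i).inter ((isClosed_ae_nonneg i).preimage continuous_neg)

/-- A coordinate is `𝓕_r`-measurable exactly when it equals its conditional expectation. By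
self-adjointness this means that `X` annihilates every `(1_E - E[1_E | 𝓕_r]) e_i`, so the set is an
intersection of closed hyperplanes. -/
theorem isClosed_aestronglyMeasurable :
    IsClosed[lpTop d p P] {X : Lp (Vec d) p P | AEStronglyMeasurable[ℱ r] X P} := by
  set q := p.conjExponent
  have hqp : q.HolderConjugate p := ENNReal.HolderConjugate.symm
  have hq : 1 ≤ q := ENNReal.HolderConjugate.one_le _ p
  have hp : 1 ≤ p := Fact.out
  let _ := lpTop d p P
  let V : Set Ω → Fin d → Ω → Vec d := fun E i ω => EuclideanSpace.single i
    (E.indicator (fun _ => (1 : ℝ)) ω - (P[E.indicator fun _ => (1 : ℝ) | ℱ r]) ω)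
  have hE1 : ∀ E, MeasurableSet E → MemLp (E.indicator fun _ => (1 : ℝ)) q P := fun E hE =>
    (memLp_const _).indicator hE
  have hV : ∀ E i, MeasurableSet E → MemLp (V E i) q P := fun E i hE => by
    have h0 : MemLp (fun ω => E.indicator (fun _ => (1 : ℝ)) ω
      - (P[E.indicator fun _ => (1 : ℝ) | ℱ r]) ω) q P := (hE1 E hE).sub (MemLp.condExp hq (hE1 E hE))
    refine memLp_of_coord fun j => ?_
    by_cases hj : j = i
    · simpa [V, hj] using h0
    · simp [V, hj]
  have hpair : ∀ E i (X : Lp (Vec d) p P), MeasurableSet E → pair P (V E i) X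
      = ∫ ω in E, X ω i ∂P - ∫ ω in E, (P[fun ω => X ω i | ℱ r]) ω ∂P := fun E i X hE => by
    have hXi := memLp_coord (Lp.memLp X) i
    have h1 := integral_condExp_mul_comm (ℱ.le r) hXi (hE1 E hE)
    have h2 : ∀ f : Ω → ℝ, ∫ ω, E.indicator (fun _ => (1 : ℝ)) ω * f ω ∂P = ∫ ω in E, f ω ∂P :=
      fun f => by
        rw [← integral_indicator hE]
        congr 1 with ω
        by_cases hω : ω ∈ E <;> simp [hω]
    rw [h2] at h1
    have h3 := integral_sub ((hE1 E hE).integrable_mul hXi)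
      ((MemLp.condExp (m := ℱ r) hq (hE1 E hE)).integrable_mul hXi)
    simp only [Pi.mul_apply] at h3
    rw [← h1, ← h2, ← h3, pair]
    congr 1 with ω
    rw [dot_comm, dot_single]
    ring
  have e : {X : Lp (Vec d) p P | AEStronglyMeasurable[ℱ r] X P}
      = ⋂ (E : Set Ω) (i : Fin d) (_ : MeasurableSet E), {X | pair P (V E i) X = 0} := by
    ext X
    simp only [mem_ofPred_eq, mem_iInter]
    have hXi := fun i => (memLp_coord (Lp.memLp X) i).integrable hp
    constructor
    · intro h E i hE
      rw [hpair E i X hE, sub_eq_zero]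
      refine integral_congr_ae (ae_restrict_of_ae ?_)
      exact (condExp_of_aestronglyMeasurable' (ℱ.le r) (aestronglyMeasurable_coord h i) (hXi i)).symm
    · intro h
      refine aestronglyMeasurable_of_coord fun i => ?_
      refine AEStronglyMeasurable.congr (f := P[fun ω => X ω i | ℱ r])
        stronglyMeasurable_condExp.aestronglyMeasurable ?_
      refine Integrable.ae_eq_of_forall_setIntegral_eq _ _ integrable_condExp (hXi i)
        fun E hE _ => ?_
      have := h E i hE
      rw [hpair E i X hE, sub_eq_zero] at this
      exact this.symm
  rw [e]
  exact isClosed_iInter fun E => isClosed_iInter fun i => isClosed_iInter fun hE =>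
    isClosed_pair_eq (hV E i hE) 0

theorem isClosed_Mt : IsClosed[lpTop d p P] (Mt ℱ P m r : Set (Lp (Vec d) p P)) := by
  let _ := lpTop d p P
  have e : (Mt ℱ P m r : Set (Lp (Vec d) p P)) = {X : Lp (Vec d) p P | AEStronglyMeasurable[ℱ r] X P} ∩
      ⋂ (i : Fin d) (_ : m ≤ i.val), {X : Lp (Vec d) p P | ∀ᵐ ω ∂P, X ω i = 0} := by
    ext X
    simp only [mem_Mt, mem_inter_iff, mem_ofPred_eq, mem_iInter, ae_all_iff]
  rw [e]
  exact isClosed_aestronglyMeasurable.inter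
    (isClosed_iInter fun i => isClosed_iInter fun _ => isClosed_ae_eq_zero i)

theorem isClosed_MtPos : IsClosed[lpTop d p P] (MtPos ℱ P m r : Set (Lp (Vec d) p P)) := by
  let _ := lpTop d p P
  have e : (MtPos ℱ P m r : Set (Lp (Vec d) p P)) = Mt ℱ P m r ∩
      ⋂ (i : Fin d), {X : Lp (Vec d) p P | ∀ᵐ ω ∂P, 0 ≤ X ω i} := by
    ext X
    simp only [mem_MtPos, mem_inter_iff, mem_ofPred_eq, mem_iInter, ae_all_iff]
  rw [e]
  exact isClosed_Mt.inter (isClosed_iInter fun i => isClosed_ae_nonneg i)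

end Eligible

/-! ### Risk measures with `R(0) = M_+`. -/

section Regular

variable {Ω ι : Type*} {mΩ : MeasurableSpace Ω} [LinearOrder ι]
  {P : Measure Ω} {ℱ : Filtration ι mΩ} {d m : ℕ} {p q : ℝ≥0∞} {r s t : ι}

/-- The scalarization weights `L^q_r(M_+^+ \ M^⊥)`. -/
def weights (ℱ : Filtration ι mΩ) (P : Measure Ω) (q : ℝ≥0∞) (d m : ℕ) (r : ι) :
    Set (Ω → Vec d) :=
  {w | MemLp w q P ∧ AEStronglyMeasurable[ℱ r] w P ∧
    ∀ᵐ ω ∂P, (∀ i : Fin d, i.val < m → 0 ≤ w ω i) ∧ ∃ i : Fin d, i.val < m ∧ 0 < w ω i}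

/-- A conditional risk measure with `R(0) = L^p(M_+)` that is conditionally convex and convex upper
continuous, with integrable scalarizations. -/
structure RegularRiskMeasure [Fact (1 ≤ p)] [IsFiniteMeasure P] (ℱ : Filtration ι mΩ) (q : ℝ≥0∞)
    (m : ℕ) (r : ι) (R : Lp (Vec d) p P → Set (Lp (Vec d) p P)) : Prop where
  subset_Mt : ∀ X, R X ⊆ Mt ℱ P m r
  upper : ∀ X, ∀ u ∈ R X, ∀ k ∈ (MtPos ℱ P m r : Set (Lp (Vec d) p P)), u + k ∈ R X
  monotone : ∀ X Y : Lp (Vec d) p P, (∀ᵐ ω ∂P, ∀ i, 0 ≤ (Y - X : Lp (Vec d) p P) ω i) → R X ⊆ R Y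
  translative : ∀ X, ∀ u ∈ Mt ℱ P m r, R (X + u) = (fun v => v - u) '' R X
  zero_eq : R 0 = MtPos ℱ P m r
  convex : IsConditionallyConvex ℱ P r R
  cuc : IsCUC ℱ P m r R
  nonempty : ∀ X, (R X).Nonempty
  integrable : ∀ w ∈ weights ℱ P q d m r, ∀ X, MemL1 P (scalarization P R w X)

theorem isLowerClosedConvex_of [Fact (1 ≤ p)] {D : Set (Lp (Vec d) p P)} (h1 : D ⊆ Mt ℱ P m r)
    (h2 : IsClosed[lpTop d p P] D) (h3 : Convex ℝ D)
    (h4 : ∀ u ∈ D, ∀ k ∈ (MtPos ℱ P m r : Set (Lp (Vec d) p P)), u - k ∈ D) :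
    IsLowerClosedConvex ℱ P m r D := by
  let _ := lpTop d p P
  have e : D + -(MtPos ℱ P m r : Set (Lp (Vec d) p P)) = D := by
    refine Subset.antisymm ?_ fun u hu => ?_
    · rintro _ ⟨u, hu, k, hk, rfl⟩
      simpa using h4 u hu (-k) hk
    · exact ⟨u, hu, 0, by simpa using zero_mem_MtPos, add_zero u⟩
  refine ⟨h1, ?_⟩
  rw [e, h3.convexHull_eq]
  exact h2.closure_eq.symm

namespace RegularRiskMeasure

variable [Fact (1 ≤ p)] [IsProbabilityMeasure P] {R : Lp (Vec d) p P → Set (Lp (Vec d) p P)}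

theorem mem_iff (h : RegularRiskMeasure ℱ q m r R) {X u : Lp (Vec d) p P} (hu : u ∈ Mt ℱ P m r) :
    u ∈ R X ↔ X + u ∈ acceptance R := by
  change _ ↔ 0 ∈ R (X + u)
  rw [h.translative X u hu]
  constructor
  · exact fun hX => ⟨u, hX, sub_self u⟩
  · rintro ⟨v, hv, e⟩
    rwa [← sub_eq_zero.1 e]

theorem zero_mem (h : RegularRiskMeasure ℱ q m r R) : (0 : Lp (Vec d) p P) ∈ acceptance R := by
  change 0 ∈ R 0
  rw [h.zero_eq]
  exact zero_mem_MtPos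

theorem mem_of_nonneg (h : RegularRiskMeasure ℱ q m r R) {X Y u : Lp (Vec d) p P} (hu : u ∈ R X) (hY : ∀ᵐ ω ∂P, ∀ i, 0 ≤ Y ω i) :
    u ∈ R (X + Y) := by
  refine h.monotone X (X + Y) ?_ hu
  rwa [add_sub_cancel_left]

theorem convex_comb (h : RegularRiskMeasure ℱ q m r R) {X Y u v : Lp (Vec d) p P} (hu : u ∈ R X) (hv : v ∈ R Y) {a b : ℝ}
    (ha : 0 ≤ a) (hb : 0 ≤ b) (hab : a + b = 1) : a • u + b • v ∈ R (a • X + b • Y) := by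
  have key : ∀ X Y : Lp (Vec d) p P, ∀ᵐ ω ∂P, (a • X + b • Y : Lp (Vec d) p P) ω
      = a • X ω + (1 - a) • Y ω := fun X Y => by
    have hb' : 1 - a = b := by linarith
    filter_upwards [Lp.coeFn_add (a • X) (b • Y), Lp.coeFn_smul a X, Lp.coeFn_smul b Y]
      with ω h1 h2 h3
    rw [h1, Pi.add_apply, h2, h3, hb']
    rfl
  exact h.convex (fun _ => a) stronglyMeasurable_const (fun _ => ⟨ha, by linarith⟩) X Y u v _ _ hu hv
    (key X Y) (key u v)

/-- Conditional convexity with `λ = 1_E`. -/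
theorem stablePasting (h : RegularRiskMeasure ℱ q m r R) : StablePasting P (ℱ r) (acceptance R) := by
  classical
  intro E hE X hX Y hY Z hZ
  refine h.convex (E.indicator fun _ => 1) (stronglyMeasurable_const.indicator hE) (fun ω => ?_)
    X Y 0 0 Z 0 hX hY ?_ ?_
  · by_cases hω : ω ∈ E <;> simp [hω]
  · filter_upwards [hZ] with ω hω
    by_cases hE : ω ∈ E
    · simp [hE, hω.1 hE]
    · simp [hE, hω.2 hE]
  · filter_upwards [Lp.coeFn_zero (Vec d) p P] with ω h0
    rw [h0]
    simp

theorem convex_acceptance (h : RegularRiskMeasure ℱ q m r R) : Convex ℝ (acceptance R) := fun X hX Y hY a b ha hb hab => by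
  have := h.convex_comb (X := X) (Y := Y) (u := 0) (v := 0) hX hY ha hb hab
  rwa [smul_zero, smul_zero, add_zero] at this

theorem isClosed_meets (h : RegularRiskMeasure ℱ q m r R) {D : Set (Lp (Vec d) p P)} (h1 : D ⊆ Mt ℱ P m r)
    (h2 : IsClosed[lpTop d p P] D) (h3 : Convex ℝ D)
    (h4 : ∀ u ∈ D, ∀ k ∈ (MtPos ℱ P m r : Set (Lp (Vec d) p P)), u - k ∈ D) :
    IsClosed[lpTop d p P] {X | (R X ∩ D).Nonempty} :=
  h.cuc D (isLowerClosedConvex_of h1 h2 h3 h4)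

variable [p.HolderConjugate q]

/-- Since `R(X)` is stable under adding `M_+`, it contains `0` exactly when it meets `-M_+`; convex
upper continuity applies to that set. -/
theorem isClosed_acceptance (h : RegularRiskMeasure ℱ q m r R) : IsClosed[lpTop d p P] (acceptance R) := by
  let _ := lpTop d p P
  have := lpTop_isTopologicalAddGroup (d := d) (p := p) (P := P)
  have e : acceptance R = {X | (R X ∩ -(MtPos ℱ P m r : Set (Lp (Vec d) p P))).Nonempty} := by
    ext X
    constructor
    · exact fun hX => ⟨0, hX, by simpa using zero_mem_MtPos⟩
    · rintro ⟨u, hu, hk⟩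
      have := h.upper X u hu (-u) hk
      rwa [add_neg_cancel] at this
  rw [e]
  refine h.isClosed_meets ?_ (isClosed_MtPos.preimage continuous_neg) convex_MtPos.neg ?_
  · intro u hu
    have := (MtSub ℱ P d m p r).neg_mem (mem_MtPos.1 hu).1
    rwa [neg_neg] at this
  · intro u hu k hk
    have := MtPos_add hu hk
    rw [mem_neg, neg_sub]
    rwa [neg_add_eq_sub] at this

end RegularRiskMeasure

end Regular

/-! ### Pairing with scalarization weights. -/

section Weights

variable {Ω ι : Type*} {mΩ : MeasurableSpace Ω} [LinearOrder ι]
  {P : Measure Ω} {ℱ : Filtration ι mΩ} {d m : ℕ} {p q : ℝ≥0∞} {r s t : ι} {w : Ω → Vec d}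

theorem pair_weight_nonneg (hw : w ∈ weights ℱ P q d m r) {k : Lp (Vec d) p P}
    (hk : k ∈ MtPos ℱ P m r) : 0 ≤ pair P w k := by
  have hk := mem_MtPos.1 hk
  refine integral_nonneg_of_ae ?_
  filter_upwards [hw.2.2, hk.2, (mem_Mt.1 hk.1).2] with ω h1 h2 h3
  refine Finset.sum_nonneg fun i _ => ?_
  by_cases hi : i.val < m
  · exact mul_nonneg (h1.1 i hi) (h2 i)
  · rw [h3 i (not_lt.1 hi), mul_zero]

theorem exists_pair_weight_eq_one [IsProbabilityMeasure P] [p.HolderConjugate q]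
    (hw : w ∈ weights ℱ P q d m r) :
    ∃ u ∈ (Mt ℱ P m r : Set (Lp (Vec d) p P)), pair P w u = 1 := by
  have : q.HolderConjugate p := ENNReal.HolderConjugate.symm
  have hq : 1 ≤ q := ENNReal.HolderConjugate.one_le q p
  by_cases hz : ∀ i : Fin d, i.val < m → ∫ ω, w ω i ∂P = 0
  · exfalso
    have hae : ∀ᵐ ω ∂P, ∀ i : Fin d, i.val < m → w ω i = 0 := by
      rw [ae_all_iff]
      intro i
      by_cases hi : i.val < m
      · have h0 : 0 ≤ᵐ[P] fun ω => w ω i := by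
          filter_upwards [hw.2.2] with ω h using h.1 i hi
        filter_upwards [(integral_eq_zero_iff_of_nonneg_ae h0
          ((memLp_coord hw.1 i).integrable hq)).1 (hz i hi)] with ω h _ using h
      · exact .of_forall fun ω h => absurd h hi
    have hf : ∀ᵐ _ ∂P, False := by
      filter_upwards [hae, hw.2.2] with ω h1 h2
      obtain ⟨i, hi, h3⟩ := h2.2
      exact h3.ne' (h1 i hi)
    exact hf.exists.elim fun _ h => h
  · push Not at hz
    obtain ⟨i, hi, hne⟩ := hz
    refine ⟨(∫ ω, w ω i ∂P)⁻¹ • box P p (ℱ.le r univ MeasurableSet.univ) i,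
      (MtSub ℱ P d m p r).smul_mem _ (mem_MtPos.1 (box_mem_MtPos MeasurableSet.univ hi)).1, ?_⟩
    rw [pair_smul, pair_box, setIntegral_univ, inv_mul_cancel₀ hne]

end Weights

/-! ### Dual densities for scalarizations. -/

section Dual

variable {Ω ι : Type*} {mΩ : MeasurableSpace Ω} [LinearOrder ι]
  {P : Measure Ω} {ℱ : Filtration ι mΩ} {d m : ℕ} {p q : ℝ≥0∞} {r s t : ι}
  [Fact (1 ≤ p)] [IsProbabilityMeasure P] {R : Lp (Vec d) p P → Set (Lp (Vec d) p P)}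
  [p.HolderConjugate q] {w : Ω → Vec d}

/-- Dual representation of the scalarizations: a lower bound of `E[wᵀu]` on `R(X)` is separated by
a nonnegative density. -/
theorem RegularRiskMeasure.exists_dual (h : RegularRiskMeasure ℱ q m r R)
    (hw : w ∈ weights ℱ P q d m r) {X : Lp (Vec d) p P} {c : ℝ} (hX : ∀ u ∈ R X, c < pair P w u) :
    ∃ v : Ω → Vec d, MemLp v q P ∧ (∀ i, ∀ᵐ ω ∂P, 0 ≤ v ω i) ∧
      (∀ i : Fin d, i.val < m → P[fun ω => v ω i | ℱ r] =ᵐ[P] fun ω => w ω i) ∧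
      ∃ K, (∀ Z ∈ acceptance R, -pair P v Z ≤ K) ∧ K < -pair P v X - c := by
  -- The positions that can be made acceptable at price at most `c`. Upper continuity, applied to
  -- the half-space of cheap portfolios in `M`, makes this set closed; `X` lies outside it.
  set L : Set (Lp (Vec d) p P) := {Z | (R Z ∩ {u ∈ Mt ℱ P m r | pair P w u ≤ c}).Nonempty} with hL
  have hLc : IsClosed[lpTop d p P] L := by
    let _ := lpTop d p P
    refine h.isClosed_meets (fun u hu => hu.1) (isClosed_Mt.inter (isClosed_pair_le hw.1 c)) ?_ ?_
    · exact (MtSub ℱ P d m p r).convex.inter (convex_halfSpace_le (pairLin hw.1).isLinear c)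
    · intro u hu k hk
      refine ⟨(MtSub ℱ P d m p r).sub_mem hu.1 (mem_MtPos.1 hk).1, ?_⟩
      have := pair_weight_nonneg hw hk
      have hu2 : pair P w u ≤ c := hu.2
      change pair P w (u - k) ≤ c
      rw [pair_sub hw.1]
      linarith
  have hLconv : Convex ℝ L := by
    rintro X ⟨u, hu, hu', hu2⟩ Y ⟨v, hv, hv', hv2⟩ a b ha hb hab
    refine ⟨a • u + b • v, h.convex_comb hu hv ha hb hab, (MtSub ℱ P d m p r).add_mem
      ((MtSub ℱ P d m p r).smul_mem a hu') ((MtSub ℱ P d m p r).smul_mem b hv'), ?_⟩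
    rw [pair_add hw.1, pair_smul, pair_smul]
    calc a * pair P w u + b * pair P w v ≤ a * c + b * c :=
          add_le_add (mul_le_mul_of_nonneg_left hu2 ha) (mul_le_mul_of_nonneg_left hv2 hb)
      _ = c := by rw [← add_mul, hab, one_mul]
  have hXL : X ∉ L := by
    rintro ⟨u, hu, -, hu2⟩
    exact absurd (hX u hu) (not_lt.2 hu2)
  obtain ⟨v, hv, K, hK1, hK2⟩ := exists_separation (q := q) hLconv hLc hXL
  have hmem : ∀ Z ∈ acceptance R, ∀ u ∈ (Mt ℱ P m r : Set (Lp (Vec d) p P)), pair P w u ≤ c → Z - u ∈ L := by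
    intro Z hZ u hu hc
    refine ⟨u, (h.mem_iff hu).2 ?_, hu, hc⟩
    rwa [sub_add_cancel]
  have hsep : ∀ Z ∈ acceptance R, ∀ u ∈ (Mt ℱ P m r : Set (Lp (Vec d) p P)), pair P w u ≤ c →
      K ≤ pair P v Z - pair P v u := fun Z hZ u hu hc => by
    rw [← pair_sub hv]
    exact hK2 _ (hmem Z hZ u hu hc)
  obtain ⟨u1, hu1, hw1⟩ := exists_pair_weight_eq_one (p := p) hw
  set S := MtSub ℱ P d m p r
  -- If `u` had nonpositive price but positive `v`-value, then adding the multiple `a` of it to `c •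
  -- u1` would push the separated value below `K`; `a` is chosen to overshoot by `1`.
  have hcone : ∀ u ∈ (Mt ℱ P m r : Set (Lp (Vec d) p P)), pair P w u ≤ 0 → pair P v u ≤ 0 := by
    intro u hu hwu
    by_contra! hpos
    set a : ℝ := (|K| + |pair P v (c • u1)| + 1) / pair P v u
    have ha : 0 ≤ a := by positivity
    have h1 := hsep 0 h.zero_mem (c • u1 + a • u) (S.add_mem (S.smul_mem c hu1) (S.smul_mem a hu))
      (by rw [pair_add hw.1, pair_smul, pair_smul, hw1]; nlinarith)
    have ha' : a * pair P v u = |K| + |pair P v (c • u1)| + 1 := div_mul_cancel₀ _ hpos.ne'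
    rw [pair_zero, pair_add hv, pair_smul a, ha'] at h1
    linarith [neg_abs_le K, neg_abs_le (pair P v (c • u1))]
  -- Applying `hcone` to both signs of the part of `u` with price zero shows that on `M` the
  -- functional `v` is a multiple of `w`.
  have hlin : ∀ u ∈ (Mt ℱ P m r : Set (Lp (Vec d) p P)), pair P v u = pair P w u * pair P v u1 := by
    intro u hu
    have hz : u - pair P w u • u1 ∈ Mt ℱ P m r := S.sub_mem hu (S.smul_mem _ hu1)
    have hz' : pair P w (u - pair P w u • u1) = 0 := by
      rw [pair_sub hw.1, pair_smul, hw1]; ring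
    have h1 := hcone _ hz hz'.le
    have h2 := hcone _ (S.neg_mem hz) (by rw [pair_neg, hz', neg_zero])
    rw [pair_neg, pair_sub hv, pair_smul] at h2
    rw [pair_sub hv, pair_smul] at h1
    linarith
  have hl0 : 0 ≤ pair P v u1 := by
    have := hcone _ (S.neg_mem hu1) (by rw [pair_neg, hw1]; norm_num)
    rw [pair_neg] at this
    linarith
  -- Nonemptiness of `R X` enters here: if the multiple were zero, `v` would vanish on `M` and the
  -- acceptable position `X + u0` would have the same `v`-value as `X`, against the strict
  -- separation. Dividing by `l` then normalizes `v` to agree with `w`.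
  have hl : 0 < pair P v u1 := by
    refine lt_of_le_of_ne hl0 fun he => ?_
    obtain ⟨u0, hu0⟩ := h.nonempty X
    have hu0' := h.subset_Mt X hu0
    have h1 := hsep (X + u0) ((h.mem_iff hu0').1 hu0) (c • u1) (S.smul_mem c hu1)
      (by rw [pair_smul, hw1, mul_one])
    rw [pair_add hv, hlin u0 hu0', pair_smul, ← he] at h1
    linarith
  set l := pair P v u1
  have hscale : ∀ Z : Lp (Vec d) p P, pair P (fun ω => l⁻¹ • v ω) Z = l⁻¹ * pair P v Z := by
    intro Z
    rw [pair, pair, ← integral_const_mul]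
    congr 1 with ω
    rw [dot_smul_left]
  have hv' : MemLp (fun ω => l⁻¹ • v ω) q P := hv.const_smul l⁻¹
  have hcu : c • u1 ∈ Mt ℱ P m r := S.smul_mem c hu1
  have hpc : pair P w (c • u1) = c := by rw [pair_smul, hw1, mul_one]
  refine ⟨fun ω => l⁻¹ • v ω, hv', nonneg_of_pair_nonneg (p := p) hv' fun Y hY => ?_, fun i hi => ?_,
    -c - l⁻¹ * K, fun Z hZ => ?_, ?_⟩
  · rw [hscale]
    refine mul_nonneg (inv_nonneg.2 hl0) ?_
    by_contra! hneg
    set a : ℝ := (|K| + |pair P v (0 - c • u1)| + 1) / -pair P v Y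
    have hYn : 0 < -pair P v Y := by linarith
    have ha : 0 ≤ a := by positivity
    obtain ⟨u, hu, hu'⟩ := hmem 0 h.zero_mem _ hcu hpc.le
    have hin : (0 - c • u1) + a • Y ∈ L := by
      refine ⟨u, h.mem_of_nonneg hu ?_, hu'⟩
      filter_upwards [Lp.coeFn_smul a Y, hY] with ω e1 e2 i
      rw [e1]
      exact mul_nonneg ha (e2 i)
    have h1 := hK2 _ hin
    have ha' : a * -pair P v Y = |K| + |pair P v (0 - c • u1)| + 1 := div_mul_cancel₀ _ hYn.ne'
    rw [pair_add hv, pair_smul a] at h1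
    linarith [neg_abs_le K, le_abs_self (pair P v (0 - c • u1))]
  · refine condExp_eq_of_pair_eq (p := p) hv' hw.1 hw.2.1 (fun u hu => ?_) hi
    rw [hscale, hlin u hu]
    field_simp
  · have h1 := hsep Z hZ _ hcu hpc.le
    rw [pair_smul] at h1
    rw [hscale]
    have h2 : l⁻¹ * K ≤ l⁻¹ * (pair P v Z - c * l) :=
      mul_le_mul_of_nonneg_left h1 (inv_nonneg.2 hl0)
    have h3 : l⁻¹ * (pair P v Z - c * l) = l⁻¹ * pair P v Z - c := by field_simp
    linarith
  · rw [hscale]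
    have : l⁻¹ * pair P v X < l⁻¹ * K := mul_lt_mul_of_pos_left hK1 (inv_pos.2 hl)
    linarith

end Dual

/-! ### Only eligible coordinates of a weight matter. -/

section WeakDuality

variable {Ω ι : Type*} {mΩ : MeasurableSpace Ω} [LinearOrder ι]
  {P : Measure Ω} {ℱ : Filtration ι mΩ} {d m : ℕ} {p q : ℝ≥0∞} {r s t : ι}

theorem dot_congr_of_eligible {y y' u : Vec d} (h : ∀ i : Fin d, i.val < m → y i = y' i)
    (hu : ∀ i : Fin d, m ≤ i.val → u i = 0) : dot y u = dot y' u := by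
  refine Finset.sum_congr rfl fun i _ => ?_
  by_cases hi : i.val < m
  · rw [h i hi]
  · rw [hu i (not_lt.1 hi), mul_zero, mul_zero]

theorem condLoss_eligible [p.HolderConjugate q] [IsFiniteMeasure P] {v y : Ω → Vec d}
    (hv : MemLp v q P)
    (hy : ∀ i : Fin d, i.val < m → P[fun ω => v ω i | ℱ r] =ᵐ[P] fun ω => y ω i)
    {u : Lp (Vec d) p P} (hu : u ∈ Mt ℱ P m r) :
    condLoss P (ℱ r) v u =ᵐ[P] fun ω => dot (y ω) (-u ω) := by
  refine condLoss_eq_dot (ℱ.le r) hv (mem_Mt.1 hu).1 fun i => ?_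
  by_cases hi : i.val < m
  · exact Or.inl (hy i hi)
  · exact Or.inr ((mem_Mt.1 hu).2.mono fun ω h => h i (not_lt.1 hi))

variable [IsFiniteMeasure P]

theorem scalarization_congr {R : Lp (Vec d) p P → Set (Lp (Vec d) p P)} {X : Lp (Vec d) p P}
    (hR : R X ⊆ Mt ℱ P m r) {y y' : Ω → Vec d}
    (h : ∀ i : Fin d, i.val < m → (fun ω => y ω i) =ᵐ[P] fun ω => y' ω i) :
    scalarization P R y X =ᵐ[P] scalarization P R y' X := by
  have key : ∀ y y' : Ω → Vec d, (∀ i : Fin d, i.val < m → (fun ω => y ω i) =ᵐ[P] fun ω => y' ω i) →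
      scalarization P R y X ≤ᵐ[P] scalarization P R y' X := by
    intro y y' h
    refine essInfFam_mono ?_
    rintro _ ⟨u, hu, rfl⟩
    refine ⟨_, ⟨u, hu, rfl⟩, ?_⟩
    have h' : ∀ᵐ ω ∂P, ∀ i : Fin d, i.val < m → y ω i = y' ω i := by
      rw [ae_all_iff]
      intro i
      by_cases hi : i.val < m
      · filter_upwards [h i hi] with ω e _ using e
      · exact .of_forall fun ω hi' => absurd hi' hi
    filter_upwards [h', (mem_Mt.1 (hR hu)).2] with ω h1 h2
    rw [dot_congr_of_eligible h1 h2]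
  exact (key y y' h).antisymm (key y' y fun i hi => (h i hi).symm)

theorem scalarization_le {R : Lp (Vec d) p P → Set (Lp (Vec d) p P)} {X u : Lp (Vec d) p P}
    (hu : u ∈ R X) (y : Ω → Vec d) :
    ∀ᵐ ω ∂P, scalarization P R y X ω ≤ (dot (y ω) (u ω) : EReal) :=
  essInfFam_le ⟨u, hu, rfl⟩

end WeakDuality

/-! ### Weak duality, and separation by densities with admissible weights. -/

section Separation

variable {Ω ι : Type*} {mΩ : MeasurableSpace Ω} [LinearOrder ι]
  {P : Measure Ω} {ℱ : Filtration ι mΩ} {d m : ℕ} {p q : ℝ≥0∞} {r s t : ι}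
  [Fact (1 ≤ p)] [IsProbabilityMeasure P] {R : Lp (Vec d) p P → Set (Lp (Vec d) p P)}
  [p.HolderConjugate q]

/-- For `u ∈ R X` the position `X + u` is acceptable, so its loss is at most the penalty; the loss
of `u` itself is `-yᵀu`, because `u` is eligible and `𝓕_r`-measurable. -/
theorem RegularRiskMeasure.weak_duality (h : RegularRiskMeasure ℱ q m r R) {v y : Ω → Vec d}
    (hv : MemLp v q P)
    (hy : ∀ i : Fin d, i.val < m → P[fun ω => v ω i | ℱ r] =ᵐ[P] fun ω => y ω i)
    (X : Lp (Vec d) p P) :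
    ∀ᵐ ω ∂P, (condLoss P (ℱ r) v X ω : EReal) - pen P (ℱ r) (acceptance R) v ω
      ≤ scalarization P R y X ω := by
  refine le_essInfFam (h := fun ω => (condLoss P (ℱ r) v X ω : EReal) -
    pen P (ℱ r) (acceptance R) v ω) ?_ ?_
  · refine Measurable.aemeasurable ?_
    simp only [sub_eq_add_neg]
    exact (measurable_condLoss (ℱ.le r) X).add (isEssSup_essSupFam P _).1.neg
  · rintro _ ⟨u, hu, rfl⟩
    have hu' := h.subset_Mt X hu
    filter_upwards [condLoss_le_pen (𝓖 := ℱ r) (v := v) ((h.mem_iff hu').1 hu),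
      condLoss_add (𝓖 := ℱ r) hv X u, condLoss_eligible hv hy hu'] with ω h1 h2 h3
    rw [h2, h3, dot_neg_right] at h1
    refine EReal.sub_le_of_le_add' ?_
    revert h1
    generalize pen P (ℱ r) (acceptance R) v ω = β
    intro h1
    induction β with
    | bot => exact absurd h1 (EReal.bot_lt_coe _).not_ge
    | top => simp
    | coe x =>
      norm_cast at h1 ⊢
      linarith

theorem RegularRiskMeasure.nonneg_mem (h : RegularRiskMeasure ℱ q m r R) {Y : Lp (Vec d) p P}
    (hY : ∀ᵐ ω ∂P, ∀ i, 0 ≤ Y ω i) : Y ∈ acceptance R := by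
  have := h.mem_of_nonneg h.zero_mem hY
  rwa [zero_add] at this

theorem one_mem_weights (hm : 0 < m) (hmd : m ≤ d) :
    (fun _ => WithLp.toLp 2 fun i => if i.val < m then 1 else 0) ∈ weights ℱ P q d m r := by
  refine ⟨memLp_const _, aestronglyMeasurable_const, .of_forall fun ω => ⟨fun i hi => ?_,
    ⟨0, by omega⟩, hm, ?_⟩⟩
  · simp [hi]
  · simp [hm]

/-- Separation of a point from a closed convex set containing the acceptance set, by a density
whose conditional expectation is a scalarization weight. -/
theorem RegularRiskMeasure.exists_separating_density (h : RegularRiskMeasure ℱ q m s R)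
    (hts : t ≤ s) (hmpos : 0 < m) (hmd : m ≤ d)
    {S : Set (Lp (Vec d) p P)} (hSconv : Convex ℝ S) (hSc : IsClosed[lpTop d p P] S)
    (hAS : acceptance R ⊆ S) {X : Lp (Vec d) p P} (hX : X ∉ S) :
    ∃ v : Ω → Vec d, MemLp v q P ∧ (∀ i, ∀ᵐ ω ∂P, 0 ≤ v ω i) ∧
      (fun ω => WithLp.toLp 2 fun i => (P[fun ω => v ω i | ℱ t]) ω) ∈ weights ℱ P q d m t ∧
      (∃ K, ∀ Z ∈ acceptance R, -pair P v Z ≤ K) ∧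
      ∃ E, MeasurableSet[ℱ t] E ∧ ∃ K, (∀ Z ∈ S, ∫ ω in E, dot (v ω) (-Z ω) ∂P ≤ K) ∧
        K < ∫ ω in E, dot (v ω) (-X ω) ∂P := by
  classical
  have : q.HolderConjugate p := ENNReal.HolderConjugate.symm
  have hq : 1 ≤ q := ENNReal.HolderConjugate.one_le q p
  obtain ⟨v, hv, K, hK1, hK2⟩ := exists_separation (q := q) hSconv hSc hX
  have hv0 : ∀ i, ∀ᵐ ω ∂P, 0 ≤ v ω i := by
    refine nonneg_of_pair_nonneg (p := p) hv fun Y hY => ?_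
    by_contra! hneg
    set a : ℝ := (|K| + 1) / -pair P v Y
    have hYn : 0 < -pair P v Y := by linarith
    have ha : 0 ≤ a := by positivity
    have h1 := hK2 (a • Y) (hAS (h.nonneg_mem (by
      filter_upwards [Lp.coeFn_smul a Y, hY] with ω e1 e2 i
      rw [e1]
      exact mul_nonneg ha (e2 i))))
    have ha' : a * -pair P v Y = |K| + 1 := div_mul_cancel₀ _ hYn.ne'
    rw [pair_smul a] at h1
    linarith [neg_abs_le K]
  have hvi : ∀ i, Integrable (fun ω => v ω i) P := fun i => (memLp_coord hv i).integrable hq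
  -- On `E` the conditional expectation of `v` is a weight already; off `E` the eligible coordinates
  -- of `v` vanish.
  set E : Set Ω := ⋃ (i : Fin d) (_ : i.val < m), {ω | 0 < (P[fun ω => v ω i | ℱ t]) ω} with hEdef
  have hE : MeasurableSet[ℱ t] E := MeasurableSet.iUnion fun i => MeasurableSet.iUnion fun _ =>
    measurableSet_condExp_pos
  have hE' := ℱ.le t E hE
  have hEs := ℱ.mono hts E hE
  have hmemE : ∀ ω, ω ∉ E → ∀ i : Fin d, i.val < m → ¬ 0 < (P[fun ω => v ω i | ℱ t]) ω := by
    intro ω hω i hi hpos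
    exact hω (mem_iUnion₂.2 ⟨i, hi, hpos⟩)
  have hvM : ∀ᵐ ω ∂P, ω ∉ E → ∀ i : Fin d, i.val < m → v ω i = 0 := by
    have := ae_all_iff.2 fun i => eq_zero_of_condExp_eq_zero (ℱ.le t) (hvi i) (hv0 i)
    filter_upwards [this] with ω h1 hω i hi
    exact h1 i (hmemE ω hω i hi)
  -- Off `E` the other coordinates vanish too. For every `k`, the position `-k 1_{Eᶜ} e_i` becomes
  -- acceptable after adding some eligible `u`, since `R` is never empty. Pasted with `0` on `E`,
  -- this `u` contributes nothing under `v`, so the separating bound forces `∫_{Eᶜ} v_i ≤ 0`.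
  have hvE : ∀ᵐ ω ∂P, ω ∉ E → ∀ i : Fin d, v ω i = 0 := by
    rw [← ae_all_iff] at hv0
    have hperp : ∀ i : Fin d, m ≤ i.val → ∀ᵐ ω ∂P, ω ∉ E → v ω i = 0 := by
      intro i hi
      have hk : ∀ k : ℕ, K ≤ -k * ∫ ω in Eᶜ, v ω i ∂P := by
        intro k
        set Z : Lp (Vec d) p P := (-k : ℝ) • box P p hE'.compl i with hZ
        obtain ⟨u, hu⟩ := h.nonempty Z
        have hu' := h.subset_Mt Z hu
        obtain ⟨W, hW⟩ := exists_paste hE' 0 (Z + u)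
        have hWA := h.stablePasting E hEs 0 h.zero_mem _ ((h.mem_iff hu').1 hu) W hW
        have hWZ : pair P v W = pair P v Z := by
          refine integral_congr_ae ?_
          filter_upwards [hW, hvM, (mem_Mt.1 hu').2, Lp.coeFn_add Z u,
            Lp.coeFn_zero (Vec d) p P, Lp.coeFn_smul (-k : ℝ) (box P p hE'.compl i),
            coeFn_box (P := P) (p := p) hE'.compl i] with ω e1 e2 e3 e4 e5 e6 e7
          by_cases hω : ω ∈ E
          · rw [e1.1 hω, e5, hZ, e6, Pi.smul_apply, e7]
            simp [hω]
          · have hd : dot (v ω) (u ω) = 0 := by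
              refine Finset.sum_eq_zero fun j _ => ?_
              by_cases hj : j.val < m
              · rw [e2 hω j hj, zero_mul]
              · rw [e3 j (not_lt.1 hj), mul_zero]
            rw [e1.2 hω, e4, Pi.add_apply, dot_add_right, hd, add_zero]
        have := hK2 W (hAS hWA)
        rwa [hWZ, hZ, pair_smul, pair_box] at this
      have hle : ∫ ω in Eᶜ, v ω i ∂P ≤ 0 := by
        by_contra! hpos
        obtain ⟨k, hk'⟩ := exists_nat_gt (-K / ∫ ω in Eᶜ, v ω i ∂P)
        rw [div_lt_iff₀ hpos] at hk'
        have := hk k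
        linarith
      have h0 : 0 ≤ᵐ[P.restrict Eᶜ] fun ω => v ω i :=
        ae_restrict_of_ae (hv0.mono fun ω h => h i)
      have := (integral_eq_zero_iff_of_nonneg_ae h0 (hvi i).integrableOn).1
        (le_antisymm hle (integral_nonneg_of_ae h0))
      filter_upwards [(ae_restrict_iff' hE'.compl).1 this] with ω h1 hω using h1 hω
    have hperp' : ∀ᵐ ω ∂P, ∀ i : Fin d, m ≤ i.val → ω ∉ E → v ω i = 0 := by
      rw [ae_all_iff]
      intro i
      by_cases hi : m ≤ i.val
      · filter_upwards [hperp i hi] with ω h1 _ using h1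
      · exact .of_forall fun ω h1 => absurd h1 hi
    filter_upwards [hvM, hperp'] with ω h1 h2 hω i
    by_cases hi : i.val < m
    · exact h1 hω i hi
    · exact h2 i (not_lt.1 hi) hω
  -- A density for the weight `(1,…,1,0,…,0)` with bounded losses on the acceptance set will replace
  -- `v` off `E`. The value `-1` is a strict lower bound because prices are nonnegative on `R 0 =
  -- M_+`.
  obtain ⟨v₀, hv₀, hv₀0, hv₀1, K₀, hK₀, -⟩ := h.exists_dual (one_mem_weights hmpos hmd)
    (X := 0) (c := -1) fun u hu => by
      rw [h.zero_eq] at hu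
      linarith [pair_weight_nonneg (one_mem_weights (q := q) (P := P) hmpos hmd) hu]
  have hv₀i : ∀ i, Integrable (fun ω => v₀ ω i) P := fun i => (memLp_coord hv₀ i).integrable hq
  set v' : Ω → Vec d := E.indicator v + Eᶜ.indicator v₀ with hv'def
  have hv' : MemLp v' q P := (hv.indicator hE').add (hv₀.indicator hE'.compl)
  have hin : ∀ ω ∈ E, v' ω = v ω := fun ω hω => by simp [hv'def, hω]
  have hout : ∀ ω, ω ∉ E → v' ω = v₀ ω := fun ω hω => by simp [hv'def, hω]
  have hloss : ∀ Z : Lp (Vec d) p P,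
      ∫ ω in E, dot (v' ω) (-Z ω) ∂P = -pair P v Z := fun Z => by
    rw [← integral_indicator hE', pair, ← integral_neg]
    refine integral_congr_ae ?_
    filter_upwards [hvE] with ω h1
    by_cases hω : ω ∈ E
    · rw [indicator_of_mem hω, hin ω hω, dot_neg_right]
    · rw [indicator_of_notMem hω]
      have : v ω = 0 := by ext i; exact h1 hω i
      rw [this, dot_zero_left, neg_zero]
  have hcond : ∀ᵐ ω ∂P, ∀ i, (P[fun ω => v' ω i | ℱ t]) ω = if ω ∈ E
      then (P[fun ω => v ω i | ℱ t]) ω else (P[fun ω => v₀ ω i | ℱ t]) ω := by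
    rw [ae_all_iff]
    intro i
    have e : (fun ω => v' ω i)
        = E.indicator (fun ω => v ω i) + Eᶜ.indicator (fun ω => v₀ ω i) := by
      ext ω
      by_cases hω : ω ∈ E
      · simp [hin ω hω, hω]
      · simp [hout ω hω, hω]
    filter_upwards [condExp_add (m := ℱ t) ((hvi i).indicator hE') ((hv₀i i).indicator hE'.compl),
      condExp_indicator (hvi i) hE, condExp_indicator (hv₀i i) hE.compl] with ω e1 e2 e3
    rw [e, e1, Pi.add_apply, e2, e3]
    by_cases hω : ω ∈ E <;> simp [hω]
  have hv₀t : ∀ i : Fin d, i.val < m → P[fun ω => v₀ ω i | ℱ t] =ᵐ[P] fun _ => 1 := by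
    intro i hi
    have h1 : P[fun ω => v₀ ω i | ℱ s] =ᵐ[P] fun _ => (1 : ℝ) := by
      filter_upwards [hv₀1 i hi] with ω e
      rw [e]
      simp [hi]
    refine (condExp_condExp_of_le (ℱ.mono hts) (ℱ.le s)).symm.trans ((condExp_congr_ae h1).trans ?_)
    rw [condExp_const (ℱ.le t)]
  refine ⟨v', hv', fun i => ?_, ⟨?_, aestronglyMeasurable_condVec v' t, ?_⟩, ⟨-K + K₀, fun Z hZ => ?_⟩,
    E, hE, -K, fun Z hZ => ?_, ?_⟩
  · filter_upwards [hv0 i, hv₀0 i] with ω h1 h2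
    by_cases hω : ω ∈ E
    · rwa [hin ω hω]
    · rwa [hout ω hω]
  · exact memLp_condVec hq hv' t
  · have h1 : ∀ᵐ ω ∂P, ∀ i : Fin d, i.val < m → (P[fun ω => v₀ ω i | ℱ t]) ω = 1 := by
      rw [ae_all_iff]
      intro i
      by_cases hi : i.val < m
      · filter_upwards [hv₀t i hi] with ω h1 _ using h1
      · exact .of_forall fun ω h1 => absurd h1 hi
    have h2 := ae_all_iff.2 fun i => condExp_nonneg (m := ℱ t) (f := fun ω => v ω i) (hv0 i)
    filter_upwards [h1, h2, hcond] with ω h1 h2 h3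
    simp only [h3]
    by_cases hω : ω ∈ E
    · simp only [hω, if_true]
      refine ⟨fun i _ => h2 i, ?_⟩
      obtain ⟨i, hi, hpos⟩ := mem_iUnion₂.1 hω
      exact ⟨i, hi, hpos⟩
    · simp only [hω, if_false]
      refine ⟨fun i hi => by rw [h1 i hi]; exact zero_le_one, ⟨⟨0, by omega⟩, hmpos, ?_⟩⟩
      rw [h1 _ hmpos]
      exact zero_lt_one
  -- The restriction of `Z` to `Eᶜ` is acceptable by pasting with `0`, so its loss under `v₀` is at
  -- most `K₀`.
  · obtain ⟨W, hW⟩ := exists_paste hE' 0 Z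
    have hWA := h.stablePasting E hEs 0 h.zero_mem Z hZ W hW
    have e : pair P v' Z = pair P v Z + pair P v₀ W := by
      rw [pair, pair, pair, ← integral_add (integrable_dot_Lp hv Z) (integrable_dot_Lp hv₀ W)]
      refine integral_congr_ae ?_
      filter_upwards [hW, hvE, Lp.coeFn_zero (Vec d) p P] with ω e1 e2 e3
      by_cases hω : ω ∈ E
      · rw [hin ω hω, e1.1 hω, e3, Pi.zero_apply, dot_zero_right, add_zero]
      · have : v ω = 0 := by ext i; exact e2 hω i
        rw [hout ω hω, e1.2 hω, this, dot_zero_left, zero_add]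
    have h1 := hK2 Z (hAS hZ)
    have h2 := hK₀ W hWA
    rw [e]
    linarith
  · rw [hloss]
    linarith [hK2 Z hZ]
  · rw [hloss]
    linarith

end Separation

/-! ### Extended real inequalities. -/

section EReal

theorem neg_add_le_of_le {a b : EReal} {x z : ℝ} (ha : (x : EReal) ≤ a)
    (hb : b ≤ ((x + z : ℝ) : EReal)) : -a + b ≤ z := by
  calc -a + b ≤ -(x : EReal) + ((x + z : ℝ) : EReal) :=
        add_le_add (EReal.neg_le_neg_iff.2 ha) hb
    _ = z := by norm_cast; ring_nf

theorem le_add_of_neg_add_le_zero {a b : EReal} {x y : ℝ} (ha : 0 ≤ a)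
    (hb : ((x - y : ℝ) : EReal) ≤ b) (h : -a + b ≤ 0) : (x : EReal) ≤ a + y := by
  have h1 : -a + ((x - y : ℝ) : EReal) ≤ 0 := (add_le_add le_rfl hb).trans h
  induction a with
  | bot => simp at ha
  | top => simp
  | coe a =>
    norm_cast at h1 ⊢
    linarith

theorem le_neg_add_of_add_le {a g ρ : EReal} {x y z : ℝ} (ha : 0 ≤ a) (hg : g = (y : EReal))
    (h : a + g ≤ z) (hb : ((x - y : ℝ) : EReal) ≤ ρ) : ((x - z : ℝ) : EReal) ≤ -a + ρ := by
  subst hg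
  refine le_trans ?_ (add_le_add le_rfl hb)
  induction a with
  | bot => simp at ha
  | top => simp at h
  | coe a =>
    norm_cast at h ⊢
    linarith

end EReal

/-! ### Measurability of generalized conditional expectations. -/

section Measurability

variable {Ω : Type*} {𝓖 : MeasurableSpace Ω} {mΩ : MeasurableSpace Ω} {P : Measure Ω}

theorem measurable_genCondExp (f : Ω → EReal) :
    Measurable (genCondExp P 𝓖 f) := by
  have h : ∀ f : Ω → ℝ≥0∞, Measurable fun ω => (condLExp 𝓖 P f ω : EReal) := fun f =>
    measurable_coe_ennreal_ereal.comp (measurable_condLExp' _ _ _)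
  have e : genCondExp P 𝓖 f = fun ω => (condLExp 𝓖 P (fun x => (f x).toENNReal) ω : EReal)
      + -(condLExp 𝓖 P (fun x => (-f x).toENNReal) ω : EReal) := rfl
  rw [e]
  exact (h _).add (h _).neg

end Measurability

/-! ### Inclusions of acceptance sets in terms of single densities. -/

section Composition

variable {Ω ι : Type*} {mΩ : MeasurableSpace Ω} [LinearOrder ι]
  {P : Measure Ω} {ℱ : Filtration ι mΩ} {d m : ℕ} {p q : ℝ≥0∞} {s t : ι}
  [Fact (1 ≤ p)] [IsProbabilityMeasure P] {Rt Rs : Lp (Vec d) p P → Set (Lp (Vec d) p P)}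
  [p.HolderConjugate q]

/-- The componentwise conditional expectation of a random vector. -/
noncomputable def condVec (ℱ : Filtration ι mΩ) (P : Measure Ω) (r : ι) (v : Ω → Vec d) :
    Ω → Vec d := fun ω => WithLp.toLp 2 fun i => (P[fun ω => v ω i | ℱ r]) ω

/-- The contribution of the density `v` to the recursive bound. -/
noncomputable def stepBound (ℱ : Filtration ι mΩ) (m : ℕ) (t s : ι)
    (Rt Rs : Lp (Vec d) p P → Set (Lp (Vec d) p P)) (v : Ω → Vec d) (X : Lp (Vec d) p P) :
    Ω → EReal := fun ω =>
  -pen P (ℱ t) (steppedAcceptance ℱ P m s Rt) v ω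
    + genCondExp P (ℱ t) (scalarization P Rs (condVec ℱ P s v) X) ω

theorem measurable_stepBound (v : Ω → Vec d) (X : Lp (Vec d) p P) :
    Measurable (stepBound ℱ m t s Rt Rs v X) :=
  (isEssSup_essSupFam P _).1.neg.add (measurable_genCondExp _)

theorem zero_mem_steppedAcceptance (ht : RegularRiskMeasure ℱ q m t Rt) :
    0 ∈ steppedAcceptance ℱ P m s Rt := ⟨ht.zero_mem, (MtSub ℱ P d m p s).zero_mem⟩

theorem stablePasting_steppedAcceptance (ht : RegularRiskMeasure ℱ q m t Rt) (hts : t ≤ s) :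
    StablePasting P (ℱ t) (steppedAcceptance ℱ P m s Rt) :=
  ht.stablePasting.inter (stablePasting_Mt.mono (ℱ.mono hts))

theorem convex_steppedAcceptance (ht : RegularRiskMeasure ℱ q m t Rt) :
    Convex ℝ (steppedAcceptance ℱ P m s Rt) :=
  ht.convex_acceptance.inter (MtSub ℱ P d m p s).convex

/-- A sum of closed sets need not be closed; here `X = Z + W` with `Z ∈ A_{t,s}` and `W ∈ A_s` says
exactly that `-Z ∈ R_s(X)`. So the sum consists of the `X` for which `R_s(X)` meets `-A_{t,s}`, a
closed convex set stable under subtracting `M_{s,+}`. -/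
theorem isClosed_acceptance_add (ht : RegularRiskMeasure ℱ q m t Rt)
    (hs : RegularRiskMeasure ℱ q m s Rs) :
    IsClosed[lpTop d p P] (steppedAcceptance ℱ P m s Rt + acceptance Rs) := by
  let _ := lpTop d p P
  have := lpTop_isTopologicalAddGroup (d := d) (p := p) (P := P)
  have e : steppedAcceptance ℱ P m s Rt + acceptance Rs
      = {X | (Rs X ∩ -steppedAcceptance ℱ P m s Rt).Nonempty} := by
    ext X
    constructor
    · rintro ⟨Z, hZ, W, hW, rfl⟩
      refine ⟨-Z, (hs.mem_iff ((MtSub ℱ P d m p s).neg_mem hZ.2)).2 ?_, by simpa using hZ⟩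
      simpa using hW
    · rintro ⟨u, hu, hu'⟩
      refine ⟨-u, hu', X + u, (hs.mem_iff (hs.subset_Mt X hu)).1 hu, ?_⟩
      exact neg_add_cancel_comm_assoc u X
  rw [e]
  refine hs.isClosed_meets ?_ ((ht.isClosed_acceptance.inter isClosed_Mt).preimage continuous_neg)
    (convex_steppedAcceptance ht).neg ?_
  · intro u hu
    have := (MtSub ℱ P d m p s).neg_mem hu.2
    rwa [neg_neg] at this
  · intro u hu k hk
    have hk' := mem_MtPos.1 hk
    have h1 := ht.mem_of_nonneg hu.1 hk'.2
    have h2 := (MtSub ℱ P d m p s).add_mem hu.2 hk'.1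
    rw [mem_neg, neg_sub, ← neg_add_eq_sub]
    exact ⟨h1, h2⟩

/-- Losses are additive along the decomposition `Z = Y + W`, and the loss of `W` at time `t` is the
conditional expectation of its loss at time `s`. -/
theorem pen_le_add_of_subset (hts : t ≤ s)
    (hsub : acceptance Rt ⊆ steppedAcceptance ℱ P m s Rt + acceptance Rs)
    {v : Ω → Vec d} (hv : MemLp v q P) :
    pen P (ℱ t) (acceptance Rt) v ≤ᵐ[P] fun ω =>
      pen P (ℱ t) (steppedAcceptance ℱ P m s Rt) v ω
        + genCondExp P (ℱ t) (pen P (ℱ s) (acceptance Rs) v) ω := by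
  refine pen_le ((isEssSup_essSupFam P _).1.add (measurable_genCondExp _)).aemeasurable
    fun Z hZ => ?_
  obtain ⟨Y, hY, W, hW, rfl⟩ := hsub hZ
  have h1 := coe_le_genCondExp (𝓖 := ℱ t) (integrable_condLoss (P := P))
    (condLoss_le_pen (𝓖 := ℱ s) (v := v) hW)
  filter_upwards [condLoss_le_pen (𝓖 := ℱ t) (v := v) hY, h1,
    condLoss_tower (ℱ.mono hts) (ℱ.le s) v W, condLoss_add (𝓖 := ℱ t) hv Y W] with ω e1 e2 e3 e4
  rw [e4, EReal.coe_add, ← e3]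
  exact add_le_add e1 e2

/-- The left side is a supremum of losses of members of `A_{t,s} + A_s`, which lie in `A_t`. -/
theorem add_le_pen_of_subset (ht : RegularRiskMeasure ℱ q m t Rt)
    (hs : RegularRiskMeasure ℱ q m s Rs) (hts : t ≤ s)
    (hsub : steppedAcceptance ℱ P m s Rt + acceptance Rs ⊆ acceptance Rt)
    {v : Ω → Vec d} (hv : MemLp v q P) :
    (fun ω => pen P (ℱ t) (steppedAcceptance ℱ P m s Rt) v ω
        + genCondExp P (ℱ t) (pen P (ℱ s) (acceptance Rs) v) ω)
      ≤ᵐ[P] pen P (ℱ t) (acceptance Rt) v := by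
  obtain ⟨Z, hZ, -, -, hsup⟩ := exists_seq_pen_add (ℱ.mono hts) (ℱ.le s) hv
    (stablePasting_steppedAcceptance ht hts) (zero_mem_steppedAcceptance ht) hs.stablePasting
    hs.zero_mem
  filter_upwards [hsup, ae_all_iff.2 fun n => condLoss_le_pen (𝓖 := ℱ t) (v := v) (hsub (hZ n))]
    with ω e1 e2
  rw [e1]
  exact iSup_le e2

/-- A criterion for membership in a closed convex set containing the acceptance set. -/
theorem mem_of_condLoss_le (hs : RegularRiskMeasure ℱ q m s Rs) (hts : t ≤ s) (hm : 0 < m)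
    (hmd : m ≤ d) {S : Set (Lp (Vec d) p P)} (hSconv : Convex ℝ S) (hSc : IsClosed[lpTop d p P] S)
    (hAS : acceptance Rs ⊆ S) {X : Lp (Vec d) p P}
    (H : ∀ v : Ω → Vec d, MemLp v q P → (∀ i, ∀ᵐ ω ∂P, 0 ≤ v ω i) →
      condVec ℱ P t v ∈ weights ℱ P q d m t → (∃ K, ∀ Z ∈ acceptance Rs, -pair P v Z ≤ K) →
      ∃ Z : ℕ → Lp (Vec d) p P, (∀ n, Z n ∈ S) ∧
        (∀ᵐ ω ∂P, Monotone fun n => condLoss P (ℱ t) v (Z n) ω) ∧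
        (∀ n, 0 ≤ᵐ[P] condLoss P (ℱ t) v (Z n)) ∧
        ∀ᵐ ω ∂P, (condLoss P (ℱ t) v X ω : EReal) ≤ ⨆ n, (condLoss P (ℱ t) v (Z n) ω : EReal)) :
    X ∈ S := by
  by_contra hX
  obtain ⟨v, hv, hv0, hvw, hbd, E, hE, K, hK1, hK2⟩ :=
    hs.exists_separating_density hts hm hmd hSconv hSc hAS hX
  obtain ⟨Z, hZ, hmono, hnn, hle⟩ := H v hv hv0 hvw hbd
  have hint : ∀ Z : Lp (Vec d) p P, ∫ ω in E, condLoss P (ℱ t) v Z ω ∂P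
      = ∫ ω in E, dot (v ω) (-Z ω) ∂P := fun Z =>
    setIntegral_condExp (ℱ.le t) (integrable_loss hv Z) hE
  -- The integrals over `E` of the losses of `Z n` stay below `K`, and so does that of their
  -- supremum. As this supremum dominates the loss of `X`, the separation is contradicted.
  obtain ⟨β, hβ, hβe, hβK⟩ := exists_integrable_iSup (P := P.restrict E)
    (c := fun n => condLoss P (ℱ t) v (Z n)) (fun n => integrable_condLoss.integrableOn)
    (fun n => ae_restrict_of_ae (hnn n)) (ae_restrict_of_ae hmono) (K := K) fun n => by
      rw [hint]; exact hK1 _ (hZ n)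
  have h1 : ∫ ω in E, condLoss P (ℱ t) v X ω ∂P ≤ ∫ ω in E, β ω ∂P := by
    refine integral_mono_ae integrable_condLoss.integrableOn hβ ?_
    filter_upwards [ae_restrict_of_ae hle, hβe] with ω e1 e2
    rw [e2] at e1
    exact EReal.coe_le_coe_iff.1 e1
  rw [hint] at h1
  linarith

theorem subset_add_of_condLoss_le (ht : RegularRiskMeasure ℱ q m t Rt)
    (hs : RegularRiskMeasure ℱ q m s Rs) (hts : t ≤ s) (hm : 0 < m) (hmd : m ≤ d)
    (H : ∀ v : Ω → Vec d, MemLp v q P → (∀ i, ∀ᵐ ω ∂P, 0 ≤ v ω i) →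
      condVec ℱ P t v ∈ weights ℱ P q d m t → (∃ K, ∀ Z ∈ acceptance Rs, -pair P v Z ≤ K) →
      ∀ X ∈ acceptance Rt, ∀ᵐ ω ∂P, (condLoss P (ℱ t) v X ω : EReal) ≤
        pen P (ℱ t) (steppedAcceptance ℱ P m s Rt) v ω
        + genCondExp P (ℱ t) (pen P (ℱ s) (acceptance Rs) v) ω) :
    acceptance Rt ⊆ steppedAcceptance ℱ P m s Rt + acceptance Rs := by
  intro X hX
  refine mem_of_condLoss_le hs hts hm hmd ((convex_steppedAcceptance ht).add hs.convex_acceptance)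
    (isClosed_acceptance_add ht hs) ?_ fun v hv hv0 hvw hbd => ?_
  · intro Z hZ
    exact ⟨0, zero_mem_steppedAcceptance ht, Z, hZ, zero_add Z⟩
  · obtain ⟨Z, hZ, h1, h2, hsup⟩ := exists_seq_pen_add (ℱ.mono hts) (ℱ.le s) hv
      (stablePasting_steppedAcceptance ht hts) (zero_mem_steppedAcceptance ht) hs.stablePasting
      hs.zero_mem
    refine ⟨Z, hZ, h1, h2, ?_⟩
    filter_upwards [hsup, H v hv hv0 hvw hbd X hX] with ω e1 e2
    rwa [← e1]

/-- A bipolar argument for `A_t`: by weak duality a nonpositive scalarization bounds the loss of `X`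
by the penalty, for every density that could separate `X` from `A_t`. -/
theorem mem_acceptance_of_scalarization_le_zero (ht : RegularRiskMeasure ℱ q m t Rt) (hm : 0 < m)
    (hmd : m ≤ d) {X : Lp (Vec d) p P}
    (H : ∀ w ∈ weights ℱ P q d m t, ∀ᵐ ω ∂P, scalarization P Rt w X ω ≤ 0) :
    X ∈ acceptance Rt := by
  refine mem_of_condLoss_le ht le_rfl hm hmd ht.convex_acceptance ht.isClosed_acceptance
    Subset.rfl fun v hv hv0 hvw hbd => ?_
  obtain ⟨Z, hZ, h1, h2, hsup⟩ := exists_seq_pen (ℱ.le t) hv ht.stablePasting ht.zero_mem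
  refine ⟨Z, hZ, h1, h2, ?_⟩
  filter_upwards [hsup, H _ hvw, ht.weak_duality hv (y := condVec ℱ P t v)
    (fun i _ => Filter.EventuallyEq.rfl) X, pen_nonneg (v := v) (ℱ.le t) ht.zero_mem]
    with ω e1 e2 e3 e4
  rw [← e1]
  have := e3.trans e2
  revert this e4
  generalize pen P (ℱ t) (acceptance Rt) v ω = a
  intro e4 this
  induction a with
  | bot => simp at e4
  | top => simp
  | coe a =>
    norm_cast at this ⊢
    linarith

/-- Here `u - Z ∈ R_s(X)`, so the scalarization at `s` is at most the loss of `Z - u`. After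
conditioning on `𝓕_t`, the loss of `Z` is absorbed by the penalty over `A_{t,s}`. -/
theorem stepBound_le (hs : RegularRiskMeasure ℱ q m s Rs) (hts : t ≤ s) {v : Ω → Vec d}
    (hv : MemLp v q P) {X Z u : Lp (Vec d) p P} (hZ : Z ∈ steppedAcceptance ℱ P m s Rt)
    (hu : u ∈ Mt ℱ P m t) (hX : X + u - Z ∈ acceptance Rs) :
    ∀ᵐ ω ∂P, stepBound ℱ m t s Rt Rs v X ω ≤ ((-condLoss P (ℱ t) v u ω : ℝ) : EReal) := by
  have huZ : u - Z ∈ Mt ℱ P m s := (MtSub ℱ P d m p s).sub_mem (Mt_mono hts hu) hZ.2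
  have hmem : u - Z ∈ Rs X := (hs.mem_iff huZ).2 (by rwa [← add_sub_assoc])
  have hZu : Z - u ∈ Mt ℱ P m s := (MtSub ℱ P d m p s).sub_mem hZ.2 (Mt_mono hts hu)
  have h1 : ∀ᵐ ω ∂P, scalarization P Rs (condVec ℱ P s v) X ω
      ≤ (condLoss P (ℱ s) v (Z - u) ω : EReal) := by
    filter_upwards [scalarization_le hmem (condVec ℱ P s v),
      condLoss_eligible (y := condVec ℱ P s v) hv (fun i _ => Filter.EventuallyEq.rfl) hZu,
      Lp.coeFn_sub Z u, Lp.coeFn_sub u Z] with ω e1 e2 e3 e4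
    rw [e2, e3, Pi.sub_apply, neg_sub]
    rwa [e4, Pi.sub_apply] at e1
  have h2 := genCondExp_le_coe (𝓖 := ℱ t) integrable_condLoss h1
  have h3 := condLoss_add (𝓖 := ℱ t) hv (Z - u) u
  rw [sub_add_cancel] at h3
  filter_upwards [h2, h3, condLoss_tower (ℱ.mono hts) (ℱ.le s) v (Z - u),
    condLoss_le_pen (𝓖 := ℱ t) (v := v) hZ] with ω e2 e3 e4 e5
  refine neg_add_le_of_le e5 (e2.trans ?_)
  rw [e4, e3]
  simp

/-- For each `u ∈ R_t(X)`, decompose the acceptable position `X + u`; the loss of `u` at time `t` is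
`-wᵀu`. -/
theorem stepBound_le_scalarization (ht : RegularRiskMeasure ℱ q m t Rt)
    (hs : RegularRiskMeasure ℱ q m s Rs) (hts : t ≤ s)
    (hsub : acceptance Rt ⊆ steppedAcceptance ℱ P m s Rt + acceptance Rs)
    {v w : Ω → Vec d} (hv : MemLp v q P)
    (hw : ∀ i : Fin d, i.val < m → P[fun ω => v ω i | ℱ t] =ᵐ[P] fun ω => w ω i)
    (X : Lp (Vec d) p P) : stepBound ℱ m t s Rt Rs v X ≤ᵐ[P] scalarization P Rt w X := by
  refine le_essInfFam (measurable_stepBound v X).aemeasurable ?_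
  rintro _ ⟨u, hu, rfl⟩
  have hu' := ht.subset_Mt X hu
  obtain ⟨Z, hZ, W, hW, e⟩ := hsub ((ht.mem_iff hu').1 hu)
  have hX : X + u - Z ∈ acceptance Rs := by
    rwa [← e, add_sub_cancel_left]
  filter_upwards [stepBound_le hs hts hv hZ hu' hX, condLoss_eligible hv hw hu'] with ω e1 e2
  rw [e2] at e1
  simpa using e1

theorem stepBound_le_zero (hs : RegularRiskMeasure ℱ q m s Rs) (hts : t ≤ s) {v : Ω → Vec d} (hv : MemLp v q P)
    {X : Lp (Vec d) p P} (hX : X ∈ steppedAcceptance ℱ P m s Rt + acceptance Rs) :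
    ∀ᵐ ω ∂P, stepBound ℱ m t s Rt Rs v X ω ≤ 0 := by
  obtain ⟨Z, hZ, W, hW, rfl⟩ := hX
  filter_upwards [stepBound_le (X := Z + W) (u := 0) hs hts hv hZ (MtSub ℱ P d m p t).zero_mem
    (by simpa using hW), condLoss_zero (P := P) (p := p) (v := v) (ℱ.le t)] with ω e1 e2
  rw [e2] at e1
  simpa using e1

/-- A lower bound for the conditional expectation of the scalarization by weak duality. -/
theorem le_genCondExp_scalarization (hs : RegularRiskMeasure ℱ q m s Rs) (hts : t ≤ s)
    {v : Ω → Vec d} (hv : MemLp v q P) {β : Ω → ℝ} (hβ : Integrable β P)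
    (hβe : pen P (ℱ s) (acceptance Rs) v =ᵐ[P] fun ω => (β ω : EReal)) (X : Lp (Vec d) p P) :
    ∀ᵐ ω ∂P, ((condLoss P (ℱ t) v X ω - (P[β | ℱ t]) ω : ℝ) : EReal) ≤
      genCondExp P (ℱ t) (scalarization P Rs (condVec ℱ P s v) X) ω := by
  have h1 : ∀ᵐ ω ∂P, (((condLoss P (ℱ s) v X - β) ω : ℝ) : EReal)
      ≤ scalarization P Rs (condVec ℱ P s v) X ω := by
    filter_upwards [hs.weak_duality hv (y := condVec ℱ P s v)
      (fun i _ => Filter.EventuallyEq.rfl) X, hβe] with ω e1 e2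
    rw [e2] at e1
    exact_mod_cast e1
  have h2 := coe_le_genCondExp (𝓖 := ℱ t) (integrable_condLoss.sub hβ) h1
  filter_upwards [h2, condExp_sub integrable_condLoss hβ (ℱ t),
    condLoss_tower (ℱ.mono hts) (ℱ.le s) v X] with ω e1 e2 e3
  rwa [e2, Pi.sub_apply, e3] at e1

/-- For `X ∈ A_t` the scalarization at `t`, and hence the step bound, is nonpositive. Inserting weak
duality at `s` turns this into a bound of the loss of `X` by the sum of penalties. Separating
densities have bounded losses on `A_s`, so the penalty at `s` is integrable and may be subtracted.
-/
theorem subset_add_of_stepBound_le (ht : RegularRiskMeasure ℱ q m t Rt)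
    (hs : RegularRiskMeasure ℱ q m s Rs) (hts : t ≤ s) (hm : 0 < m) (hmd : m ≤ d)
    (H : ∀ v : Ω → Vec d, MemLp v q P → (∀ i, ∀ᵐ ω ∂P, 0 ≤ v ω i) →
      condVec ℱ P t v ∈ weights ℱ P q d m t → ∀ X,
      stepBound ℱ m t s Rt Rs v X ≤ᵐ[P] scalarization P Rt (condVec ℱ P t v) X) :
    acceptance Rt ⊆ steppedAcceptance ℱ P m s Rt + acceptance Rs := by
  refine subset_add_of_condLoss_le ht hs hts hm hmd fun v hv hv0 hvw ⟨K, hK⟩ X hX => ?_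
  obtain ⟨β, hβ, hβe, -⟩ := exists_integrable_pen (ℱ.le s) hv hs.stablePasting hs.zero_mem hK
  have h1 := (genCondExp_congr (𝓖 := ℱ t) hβe).trans (genCondExp_coe hβ)
  filter_upwards [h1, le_genCondExp_scalarization hs hts hv hβ hβe X, H v hv hv0 hvw X,
    scalarization_le (R := Rt) hX (condVec ℱ P t v), Lp.coeFn_zero (Vec d) p P,
    pen_nonneg (v := v) (ℱ.le t) (zero_mem_steppedAcceptance (s := s) ht)] with ω e1 e2 e3 e4 e5 e6
  rw [e5, Pi.zero_apply, dot_zero_right] at e4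
  rw [e1]
  exact le_add_of_neg_add_le_zero e6 e2 (e3.trans e4)

/-- Take an `ε`-optimal dual density `v` for the scalarization at `t`, and let `h` be the loss of
`X` minus the penalty over `A_t`. Weak duality at `t` gives `h ≤ ρ`, near-optimality gives the
integral, and the penalty inequality with weak duality at `s` puts `h` below the step bound. -/
theorem exists_le_stepBound (ht : RegularRiskMeasure ℱ q m t Rt)
    (hs : RegularRiskMeasure ℱ q m s Rs) (hts : t ≤ s)
    (H : ∀ v : Ω → Vec d, MemLp v q P → (∀ i, ∀ᵐ ω ∂P, 0 ≤ v ω i) →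
      condVec ℱ P t v ∈ weights ℱ P q d m t →
      (fun ω => pen P (ℱ t) (steppedAcceptance ℱ P m s Rt) v ω
        + genCondExp P (ℱ t) (pen P (ℱ s) (acceptance Rs) v) ω)
      ≤ᵐ[P] pen P (ℱ t) (acceptance Rt) v)
    {w : Ω → Vec d} (hw : w ∈ weights ℱ P q d m t) (X : Lp (Vec d) p P) {ρ : Ω → ℝ}
    (hρ : Integrable ρ P) (hρe : scalarization P Rt w X =ᵐ[P] fun ω => (ρ ω : EReal))
    {ε : ℝ} (hε : 0 < ε) :
    ∃ v : Ω → Vec d, MemLp v q P ∧ (∀ i, ∀ᵐ ω ∂P, 0 ≤ v ω i) ∧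
      (∀ i : Fin d, i.val < m → P[fun ω => v ω i | ℱ t] =ᵐ[P] fun ω => w ω i) ∧
      ∃ h : Ω → ℝ, Integrable h P ∧ h ≤ᵐ[P] ρ ∧ ∫ ω, ρ ω ∂P - ε < ∫ ω, h ω ∂P ∧
        ∀ᵐ ω ∂P, (h ω : EReal) ≤ stepBound ℱ m t s Rt Rs v X ω := by
  have : q.HolderConjugate p := ENNReal.HolderConjugate.symm
  have hq : 1 ≤ q := ENNReal.HolderConjugate.one_le q p
  obtain ⟨v, hv, hv0, hvw, K, hK1, hK2⟩ := ht.exists_dual hw (X := X) (c := ∫ ω, ρ ω ∂P - ε)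
    fun u hu => by
      refine (sub_lt_self _ hε).trans_le (integral_mono_ae hρ (integrable_dot_Lp hw.1 u) ?_)
      filter_upwards [hρe, scalarization_le hu w] with ω e1 e2
      rw [e1] at e2
      exact EReal.coe_le_coe_iff.1 e2
  have hcw : condVec ℱ P t v ∈ weights ℱ P q d m t := by
    refine ⟨memLp_condVec hq hv t, aestronglyMeasurable_condVec v t, ?_⟩
    have h1 : ∀ᵐ ω ∂P, ∀ i : Fin d, i.val < m → (P[fun ω => v ω i | ℱ t]) ω = w ω i := by
      rw [ae_all_iff]
      intro i
      by_cases hi : i.val < m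
      · filter_upwards [hvw i hi] with ω h1 _ using h1
      · exact .of_forall fun ω h1 => absurd h1 hi
    filter_upwards [h1, hw.2.2] with ω e1 e2
    refine ⟨fun i hi => ?_, ?_⟩
    · exact (e2.1 i hi).trans (e1 i hi).ge
    · obtain ⟨i, hi, hpos⟩ := e2.2
      exact ⟨i, hi, hpos.trans_le (e1 i hi).ge⟩
  obtain ⟨β, hβ, hβe, hβK⟩ := exists_integrable_pen (ℱ.le t) hv ht.stablePasting ht.zero_mem hK1
  have hle := H v hv hv0 hcw
  have hnn := pen_nonneg (v := v) (ℱ.le t) (zero_mem_steppedAcceptance (s := s) ht)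
  -- The penalty over `A_{t,s}` is nonnegative, so the conditional expectation of the time-`s`
  -- penalty is at most `β`; this bounds the losses on `A_s` and makes that penalty integrable.
  have hbd : ∀ Z ∈ acceptance Rs, -pair P v Z ≤ ∫ ω, β ω ∂P := by
    intro Z hZ
    rw [← integral_condLoss (ℱ.le t)]
    refine integral_mono_ae integrable_condLoss hβ ?_
    have h1 := coe_le_genCondExp (𝓖 := ℱ t) (integrable_condLoss (P := P))
      (condLoss_le_pen (𝓖 := ℱ s) (v := v) hZ)
    filter_upwards [h1, condLoss_tower (ℱ.mono hts) (ℱ.le s) v Z, hle, hβe, hnn]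
      with ω e1 e2 e3 e4 e5
    rw [e2] at e1
    rw [e4] at e3
    refine EReal.coe_le_coe_iff.1 (e1.trans (le_trans ?_ e3))
    calc _ = 0 + genCondExp P (ℱ t) (pen P (ℱ s) (acceptance Rs) v) ω := (zero_add _).symm
      _ ≤ _ := add_le_add e5 le_rfl
  obtain ⟨γ, hγ, hγe, -⟩ := exists_integrable_pen (ℱ.le s) hv hs.stablePasting hs.zero_mem hbd
  have h1 := (genCondExp_congr (𝓖 := ℱ t) hγe).trans (genCondExp_coe hγ)
  refine ⟨v, hv, hv0, hvw, fun ω => condLoss P (ℱ t) v X ω - β ω, integrable_condLoss.sub hβ, ?_, ?_,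
    ?_⟩
  · filter_upwards [ht.weak_duality hv hvw X, hβe, hρe] with ω e1 e2 e3
    rw [e2, e3] at e1
    exact_mod_cast e1
  · rw [integral_sub integrable_condLoss hβ, integral_condLoss (ℱ.le t)]
    linarith
  · filter_upwards [h1, le_genCondExp_scalarization hs hts hv hγ hγe X, hle, hβe, hnn]
      with ω e1 e2 e3 e4 e5
    rw [e4] at e3
    exact le_neg_add_of_add_le e5 e1 e3 e2

/-- With `ε = 1/(n+1)`, the differences `ρ - h n ≥ 0` have integrals tending to zero, so their
infimum vanishes almost surely and `ρ` is the supremum of the `h n`, each of which is at most `g`.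
-/
theorem scalarization_le_of_stepBound_le (ht : RegularRiskMeasure ℱ q m t Rt)
    (hs : RegularRiskMeasure ℱ q m s Rs) (hts : t ≤ s)
    (H : ∀ v : Ω → Vec d, MemLp v q P → (∀ i, ∀ᵐ ω ∂P, 0 ≤ v ω i) →
      condVec ℱ P t v ∈ weights ℱ P q d m t →
      (fun ω => pen P (ℱ t) (steppedAcceptance ℱ P m s Rt) v ω
        + genCondExp P (ℱ t) (pen P (ℱ s) (acceptance Rs) v) ω)
      ≤ᵐ[P] pen P (ℱ t) (acceptance Rt) v)
    {w : Ω → Vec d} (hw : w ∈ weights ℱ P q d m t) (X : Lp (Vec d) p P) {g : Ω → EReal}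
    (hg : ∀ v : Ω → Vec d, MemLp v q P → (∀ i, ∀ᵐ ω ∂P, 0 ≤ v ω i) →
      (∀ i : Fin d, i.val < m → P[fun ω => v ω i | ℱ t] =ᵐ[P] fun ω => w ω i) →
      stepBound ℱ m t s Rt Rs v X ≤ᵐ[P] g) :
    scalarization P Rt w X ≤ᵐ[P] g := by
  obtain ⟨ρ, hρ, hρe⟩ := ht.integrable w hw X
  choose v hv hv0 hvw h hh hhρ hhint hhle using fun n : ℕ =>
    exists_le_stepBound ht hs hts H hw X hρ hρe (Nat.one_div_pos_of_nat (α := ℝ) (n := n))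
  have hm : ∀ n, AEMeasurable (fun ω => ENNReal.ofReal (ρ ω - h n ω)) P := fun n =>
    ENNReal.measurable_ofReal.comp_aemeasurable (hρ.sub (hh n)).1.aemeasurable
  have hz : ∫⁻ ω, ⨅ n, ENNReal.ofReal (ρ ω - h n ω) ∂P = 0 := by
    have hle : ∀ n : ℕ, ∫⁻ ω, ⨅ n, ENNReal.ofReal (ρ ω - h n ω) ∂P
        ≤ ENNReal.ofReal (1 / ((n : ℝ) + 1)) := fun n => by
      refine (lintegral_mono fun ω => iInf_le _ n).trans ?_
      have hi : Integrable (fun ω => ρ ω - h n ω) P := hρ.sub (hh n)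
      rw [← ofReal_integral_eq_lintegral_ofReal hi]
      · refine ENNReal.ofReal_le_ofReal ?_
        rw [integral_sub hρ (hh n)]
        linarith [hhint n]
      · filter_upwards [hhρ n] with ω e
        exact sub_nonneg.2 e
    have hlim : Filter.Tendsto (fun n : ℕ => ENNReal.ofReal (1 / ((n : ℝ) + 1))) Filter.atTop
        (𝓝 0) := by
      simpa using ENNReal.tendsto_ofReal (tendsto_one_div_add_atTop_nhds_zero_nat (𝕜 := ℝ))
    exact le_antisymm (ge_of_tendsto' hlim hle) zero_le
  have hz' := (lintegral_eq_zero_iff' (AEMeasurable.iInf hm)).1 hz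
  have hg' := ae_all_iff.2 fun n => hg (v n) (hv n) (hv0 n) (hvw n)
  filter_upwards [hz', hρe, hg', ae_all_iff.2 hhle] with ω e1 e2 e3 e4
  rw [e2]
  refine le_of_forall_lt fun c hc => ?_
  obtain ⟨x, hx1, hx2⟩ := EReal.lt_iff_exists_real_btwn.1 hc
  have hpos : ⨅ n, ENNReal.ofReal (ρ ω - h n ω) < ENNReal.ofReal (ρ ω - x) := by
    change ⨅ n, ENNReal.ofReal (ρ ω - h n ω) = 0 at e1
    rw [e1]
    exact ENNReal.ofReal_pos.2 (sub_pos.2 (EReal.coe_lt_coe_iff.1 hx2))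
  obtain ⟨n, hn⟩ := iInf_lt_iff.1 hpos
  have hxn : x < h n ω := by
    have := (ENNReal.ofReal_lt_ofReal_iff'.1 hn).1
    linarith
  exact hx1.trans ((EReal.coe_lt_coe_iff.2 hxn).trans_le ((e4 n).trans (e3 n)))

end Composition

/-! ### The cones `M_+^+` and `M^⊥` in coordinates. -/

section Cones

variable {d m : ℕ}

theorem single_mem_eligible {i : Fin d} (hi : i.val < m) :
    (EuclideanSpace.single i (1 : ℝ) : Vec d) ∈ eligible d m := fun j hj => by
  have : j ≠ i := fun e => by rw [e] at hj; omega
  simp [this]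

theorem mem_posDual_eligiblePos {v : Vec d} :
    v ∈ posDual (eligiblePos d m) ↔ ∀ i : Fin d, i.val < m → 0 ≤ v i := by
  constructor
  · intro h i hi
    have := h (EuclideanSpace.single i 1) ⟨single_mem_eligible hi, fun j => by
      by_cases hj : j = i <;> simp [hj]⟩
    simpa [dot_single] using this
  · intro h u hu
    refine Finset.sum_nonneg fun i _ => ?_
    by_cases hi : i.val < m
    · exact mul_nonneg (h i hi) (hu.2 i)
    · rw [hu.1 i (not_lt.1 hi), mul_zero]

theorem mem_perp_eligible {v : Vec d} :
    v ∈ perp (eligible d m) ↔ ∀ i : Fin d, i.val < m → v i = 0 := by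
  constructor
  · intro h i hi
    have := h (EuclideanSpace.single i 1) (single_mem_eligible hi)
    simpa [dot_single] using this
  · intro h u hu
    refine Finset.sum_eq_zero fun i _ => ?_
    by_cases hi : i.val < m
    · rw [h i hi, zero_mul]
    · rw [hu i (not_lt.1 hi), mul_zero]

theorem mem_posDual_diff_perp {v : Vec d} :
    v ∈ posDual (eligiblePos d m) \ perp (eligible d m) ↔
      (∀ i : Fin d, i.val < m → 0 ≤ v i) ∧ ∃ i : Fin d, i.val < m ∧ 0 < v i := by
  rw [mem_sdiff, mem_posDual_eligiblePos, mem_perp_eligible]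
  refine and_congr_right fun h => ?_
  push Not
  refine exists_congr fun i => and_congr_right fun hi => ?_
  exact ⟨fun hne => lt_of_le_of_ne (h i hi) hne.symm, fun hpos => hpos.ne'⟩

end Cones

/-! ### Weights as selections of `M_+^+ \ M^⊥`. -/

section Weights

variable {Ω ι : Type*} {mΩ : MeasurableSpace Ω} [LinearOrder ι]
  {P : Measure Ω} {ℱ : Filtration ι mΩ} {d m : ℕ} {p q : ℝ≥0∞} {r s t : ι}

theorem ae_forall_lt {f g : Ω → Vec d}
    (h : ∀ i : Fin d, i.val < m → (fun ω => f ω i) =ᵐ[P] fun ω => g ω i) :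
    ∀ᵐ ω ∂P, ∀ i : Fin d, i.val < m → f ω i = g ω i := by
  rw [ae_all_iff]
  intro i
  by_cases hi : i.val < m
  · filter_upwards [h i hi] with ω e _ using e
  · exact .of_forall fun ω h' => absurd h' hi

theorem LSel_eq_weights {G : Ω → Set (Vec d)} (hG : ∀ᵐ ω ∂P, G ω = eligiblePos d m) :
    LSel ℱ P q r (fun ω => posDual (G ω) \ perp (eligible d m)) = weights ℱ P q d m r := by
  ext w
  refine and_congr_right fun _ => and_congr_right fun _ => ?_
  refine Filter.eventually_congr ?_
  filter_upwards [hG] with ω e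
  rw [e, mem_posDual_diff_perp]

end Weights

/-! ### Dictionary between dual variables and densities. -/

section Identification

variable {Ω ι : Type*} {mΩ : MeasurableSpace Ω} [LinearOrder ι] [OrderTop ι]
  {P : Measure Ω} [IsProbabilityMeasure P] {ℱ : Filtration ι mΩ} {d m : ℕ} {p q : ℝ≥0∞}
  [Fact (1 ≤ p)] [p.HolderConjugate q] {r s t : ι} {Q S : Fin d → Measure Ω} {w y : Ω → Vec d}

theorem penalty_eq_pen (hT : ℱ ⊤ = mΩ) (hrs : r ≤ s) (hQ : IsVecProb P Q)
    (hw : AEStronglyMeasurable[ℱ r] w P) (hy : MemLp (wStep ℱ P r s Q w) q P)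
    {A : Set (Lp (Vec d) p P)} (hA : ∀ Z ∈ A, AEStronglyMeasurable[ℱ s] Z P ∧
      ∀ i, (∀ᵐ ω ∂P, 0 ≤ w ω i) ∨ ∀ᵐ ω ∂P, Z ω i = 0) :
    penalty ℱ P r A Q w =ᵐ[P] pen P (ℱ r) A (wStep ℱ P r s Q w) := by
  refine essSupFam_congr ?_ ?_
  · rintro _ ⟨Z, hZ, rfl⟩
    exact ⟨_, ⟨Z, hZ, rfl⟩, dotQCondExp_eq hT hrs hQ hw hy (hA Z hZ).1 (hA Z hZ).2⟩
  · rintro _ ⟨Z, hZ, rfl⟩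
    exact ⟨_, ⟨Z, hZ, rfl⟩, (dotQCondExp_eq hT hrs hQ hw hy (hA Z hZ).1 (hA Z hZ).2).symm⟩

theorem condExp_wStep (hT : ℱ ⊤ = mΩ) (hrs : r ≤ s) (hQ : IsVecProb P Q) (hq : 1 ≤ q)
    (hw : AEStronglyMeasurable[ℱ r] w P) (hy : MemLp (wStep ℱ P r s Q w) q P) (i : Fin d) :
    P[fun ω => wStep ℱ P r s Q w ω i | ℱ r] =ᵐ[P] fun ω => w ω i := by
  have := (hQ i).1
  exact condExp_mul_xi (Q i) hT hrs (aestronglyMeasurable_coord hw i)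
    ((memLp_coord hy i).integrable hq)

variable {Rt Rs : Lp (Vec d) p P → Set (Lp (Vec d) p P)}

/-- Members of `A` are eligible and `𝓕_s`-measurable, so they only see `E[v_i | 𝓕_s]` for `i < m`.
-/
theorem pen_stepped_congr (hts : t ≤ s) {A : Set (Lp (Vec d) p P)} (hA : A ⊆ Mt ℱ P m s)
    {v : Ω → Vec d} (hv : MemLp v q P)
    (hvy : ∀ i : Fin d, i.val < m → P[fun ω => v ω i | ℱ s] =ᵐ[P] fun ω => y ω i) :
    pen P (ℱ t) A v =ᵐ[P] pen P (ℱ t) A y :=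
  pen_congr fun Z hZ => condLoss_eq_of_condExp_eq (ℱ.mono hts) (ℱ.le s) hv (mem_Mt.1 (hA hZ)).1
    fun i => by
      by_cases hi : i.val < m
      · exact Or.inl (hvy i hi)
      · exact Or.inr ((mem_Mt.1 (hA hZ)).2.mono fun ω h => h i (not_lt.1 hi))

/-- Admissible stepped dual variables define a density. -/
theorem dualSteppedAt_spec (hT : ℱ ⊤ = mΩ) (hts : t ≤ s) {mperp : Ω → Vec d}
    (h : (Q, mperp) ∈ dualSteppedAt ℱ P p q m t s w) (Rt : Lp (Vec d) p P → Set (Lp (Vec d) p P)) :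
    MemLp (wStep ℱ P t s Q (w + mperp)) q P ∧
      AEStronglyMeasurable[ℱ s] (wStep ℱ P t s Q (w + mperp)) P ∧
      (∀ i : Fin d, i.val < m →
        P[fun ω => wStep ℱ P t s Q (w + mperp) ω i | ℱ t] =ᵐ[P] fun ω => w ω i) ∧
      penalty ℱ P t (steppedAcceptance ℱ P m s Rt) Q (w + mperp) =ᵐ[P]
        pen P (ℱ t) (steppedAcceptance ℱ P m s Rt) (wStep ℱ P t s Q (w + mperp)) := by
  have : q.HolderConjugate p := ENNReal.HolderConjugate.symm
  have hq : 1 ≤ q := ENNReal.HolderConjugate.one_le q p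
  obtain ⟨h1, h2, h3, h4⟩ := h
  have hy := h4.1.1
  refine ⟨hy, h4.1.2.1, fun i hi => ?_, penalty_eq_pen hT hts h2 h3.2.1 hy fun Z hZ =>
    ⟨(mem_Mt.1 hZ.2).1, fun i => ?_⟩⟩
  · refine (condExp_wStep hT hts h2 hq h3.2.1 hy i).trans ?_
    filter_upwards [h1.2.2] with ω e
    have := mem_perp_eligible.1 e i hi
    simp only [Pi.add_apply, PiLp.add_apply, this, add_zero]
  · by_cases hi : i.val < m
    · refine Or.inl ?_
      filter_upwards [h3.2.2] with ω e
      exact mem_posDual_eligiblePos.1 e.1 i hi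
    · exact Or.inr ((mem_Mt.1 hZ.2).2.mono fun ω h => h i (not_lt.1 hi))

/-- Admissible terminal dual variables define a nonnegative density. -/
theorem dualTerminalAt_spec (hT : ℱ ⊤ = mΩ) {nperp : Ω → Vec d}
    (h : (S, nperp) ∈ dualTerminalAt ℱ P q m s y) (A : Set (Lp (Vec d) p P)) :
    MemLp (wStep ℱ P s ⊤ S (y + nperp)) q P ∧
      (∀ i, ∀ᵐ ω ∂P, 0 ≤ wStep ℱ P s ⊤ S (y + nperp) ω i) ∧
      (∀ i : Fin d, i.val < m →
        P[fun ω => wStep ℱ P s ⊤ S (y + nperp) ω i | ℱ s] =ᵐ[P] fun ω => y ω i) ∧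
      penalty ℱ P s A S (y + nperp) =ᵐ[P] pen P (ℱ s) A (wStep ℱ P s ⊤ S (y + nperp)) := by
  have : q.HolderConjugate p := ENNReal.HolderConjugate.symm
  have hq : 1 ≤ q := ENNReal.HolderConjugate.one_le q p
  obtain ⟨h1, h2, h3, h4⟩ := h
  have hz := h4.1
  have h0 : ∀ i, ∀ᵐ ω ∂P, 0 ≤ wStep ℱ P s ⊤ S (y + nperp) ω i := fun i =>
    h4.2.2.mono fun ω h => h i
  have hc := condExp_wStep hT le_top h2 hq h3.2.1 hz
  refine ⟨hz, h0, fun i hi => (hc i).trans ?_, penalty_eq_pen hT le_top h2 h3.2.1 hz fun Z _ =>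
    ⟨?_, fun i => Or.inl ?_⟩⟩
  · filter_upwards [h1.2.2] with ω e
    have := mem_perp_eligible.1 e i hi
    simp only [Pi.add_apply, PiLp.add_apply, this, add_zero]
  · rw [hT]
    exact (Lp.memLp Z).1
  · filter_upwards [hc i, condExp_nonneg (m := ℱ s)
      (f := fun ω => wStep ℱ P s ⊤ S (y + nperp) ω i) (h0 i)] with ω e1 e2
    rw [← e1]
    exact e2

theorem extendedPenalty_eq_pen {A : Set (Lp (Vec d) p P)} {mperp nperp : Ω → Vec d}
    (hz : MemLp (wStep ℱ P s ⊤ S (wStep ℱ P t s Q (w + mperp) + nperp)) q P) :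
    extendedPenalty ℱ P t s A w Q mperp S nperp =ᵐ[P]
      pen P (ℱ t) A (wStep ℱ P s ⊤ S (wStep ℱ P t s Q (w + mperp) + nperp)) := by
  refine essSupFam_congr ?_ ?_
  · rintro _ ⟨Z, hZ, rfl⟩
    exact ⟨_, ⟨Z, hZ, rfl⟩, genCondExp_coe (integrable_loss hz Z)⟩
  · rintro _ ⟨Z, hZ, rfl⟩
    exact ⟨_, ⟨Z, hZ, rfl⟩, (genCondExp_coe (integrable_loss hz Z)).symm⟩

/-- Every nonnegative density is given by admissible stepped dual variables. -/
theorem exists_mem_dualSteppedAt (hts : t ≤ s) {v : Ω → Vec d}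
    (hv : MemLp v q P) (hv0 : ∀ i, ∀ᵐ ω ∂P, 0 ≤ v ω i) (hw : w ∈ weights ℱ P q d m t)
    (hvw : ∀ i : Fin d, i.val < m → P[fun ω => v ω i | ℱ t] =ᵐ[P] fun ω => w ω i) :
    ∃ (Q : Fin d → Measure Ω) (mperp : Ω → Vec d),
      (Q, mperp) ∈ dualSteppedAt ℱ P p q m t s w ∧
      wStep ℱ P t s Q (w + mperp) =ᵐ[P] condVec ℱ P s v := by
  have : q.HolderConjugate p := ENNReal.HolderConjugate.symm
  have hq : 1 ≤ q := ENNReal.HolderConjugate.one_le q p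
  obtain ⟨Q, hQ, hstep⟩ := exists_wStep (ℱ := ℱ) hq hv hv0 t
  have e : w + (condVec ℱ P t v - w) = condVec ℱ P t v := add_sub_cancel _ _
  have hae := ae_forall_lt (f := condVec ℱ P t v) (g := w) hvw
  have hst : wStep ℱ P t s Q (condVec ℱ P t v) =ᵐ[P] condVec ℱ P s v := hstep s hts
  -- This `m_⊥` vanishes in the eligible coordinates and makes `w + m_⊥` equal to `E[v | 𝓕_t]`, the
  -- starting point of the density process.
  refine ⟨Q, condVec ℱ P t v - w, ⟨⟨(memLp_condVec hq hv t).sub hw.1,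
    (aestronglyMeasurable_condVec v t).sub hw.2.1, ?_⟩, hQ, ?_, ⟨?_, ?_, ?_⟩, ?_⟩, ?_⟩
  · filter_upwards [hae] with ω h
    refine mem_perp_eligible.2 fun i hi => ?_
    rw [Pi.sub_apply, PiLp.sub_apply, h i hi, sub_self]
  · simp only [e]
    refine ⟨memLp_condVec hq hv t, aestronglyMeasurable_condVec v t, ?_⟩
    filter_upwards [hae, hw.2.2] with ω h1 h2
    refine mem_posDual_diff_perp.2 ⟨fun i hi => ?_, ?_⟩
    · rw [h1 i hi]
      exact h2.1 i hi
    · obtain ⟨i, hi, hpos⟩ := h2.2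
      exact ⟨i, hi, by rwa [h1 i hi]⟩
  · simp only [e]
    exact (memLp_congr_ae hst).2 (memLp_condVec hq hv s)
  · simp only [e]
    exact (aestronglyMeasurable_condVec v s).congr hst.symm
  · exact .of_forall fun _ => mem_univ _
  · intro k hk
    simp only [e]
    refine integral_nonneg_of_ae ?_
    have hv' := ae_all_iff.2 fun i => condExp_nonneg (m := ℱ s) (f := fun ω => v ω i) (hv0 i)
    filter_upwards [hst, hv', (mem_MtPos.1 hk).2] with ω e1 e2 e3
    rw [e1]
    exact Finset.sum_nonneg fun i _ => mul_nonneg (e2 i) (e3 i)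
  · rw [e]
    exact hst

/-- Every nonnegative density is given by admissible terminal dual variables. -/
theorem exists_mem_dualTerminalAt (hT : ℱ ⊤ = mΩ) {v : Ω → Vec d} (hq : 1 ≤ q)
    (hv : MemLp v q P) (hv0 : ∀ i, ∀ᵐ ω ∂P, 0 ≤ v ω i) (hy : y =ᵐ[P] condVec ℱ P s v) :
    ∃ (S : Fin d → Measure Ω) (nperp : Ω → Vec d),
      (S, nperp) ∈ dualTerminalAt ℱ P q m s y ∧
      wStep ℱ P s ⊤ S (y + nperp) =ᵐ[P] v := by
  obtain ⟨S, hS, hstep⟩ := exists_wStep (ℱ := ℱ) hq hv hv0 s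
  have e : y + (condVec ℱ P s v - y) = condVec ℱ P s v := add_sub_cancel _ _
  have hym := (memLp_congr_ae hy).2 (memLp_condVec hq hv s)
  have hym' := (aestronglyMeasurable_condVec v s).congr hy.symm
  have hst : wStep ℱ P s ⊤ S (condVec ℱ P s v) =ᵐ[P] v := by
    refine (hstep ⊤ le_top).trans ?_
    have : ∀ i, P[fun ω => v ω i | ℱ ⊤] =ᵐ[P] fun ω => v ω i := fun i => by
      rw [hT]
      exact condExp_of_aestronglyMeasurable' le_rfl (memLp_coord hv i).1
        ((memLp_coord hv i).integrable hq)
    filter_upwards [ae_all_iff.2 this] with ω h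
    ext i
    exact h i
  -- As before, `n_⊥` corrects `y` to `E[v | 𝓕_s]`. Here it is null almost surely.
  refine ⟨S, condVec ℱ P s v - y, ⟨⟨(memLp_condVec hq hv s).sub hym,
    (aestronglyMeasurable_condVec v s).sub hym', ?_⟩, hS, ?_, ?_, ?_, ?_⟩, ?_⟩
  · filter_upwards [hy] with ω h
    refine mem_perp_eligible.2 fun i hi => ?_
    rw [Pi.sub_apply, PiLp.sub_apply, h, sub_self]
  · simp only [e]
    refine ⟨memLp_condVec hq hv s, aestronglyMeasurable_condVec v s, ?_⟩
    have hv' := ae_all_iff.2 fun i => condExp_nonneg (m := ℱ s) (f := fun ω => v ω i) (hv0 i)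
    filter_upwards [hv'] with ω h
    exact mem_posDual_eligiblePos.2 fun i _ => h i
  · simp only [e]
    exact (memLp_congr_ae hst).2 hv
  · simp only [e]
    rw [hT]
    exact hv.1.congr hst.symm
  · simp only [e]
    filter_upwards [hst, ae_all_iff.2 hv0] with ω h1 h2
    rw [h1]
    exact h2
  · rw [e]
    exact hst

theorem stepBound_congr (hts : t ≤ s) (hRs : ∀ X, Rs X ⊆ Mt ℱ P m s) {v : Ω → Vec d}
    (hv : MemLp v q P)
    (hvy : ∀ i : Fin d, i.val < m → P[fun ω => v ω i | ℱ s] =ᵐ[P] fun ω => y ω i)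
    (X : Lp (Vec d) p P) :
    stepBound ℱ m t s Rt Rs v X =ᵐ[P] fun ω =>
      -pen P (ℱ t) (steppedAcceptance ℱ P m s Rt) y ω
        + genCondExp P (ℱ t) (scalarization P Rs y X) ω := by
  have h1 := pen_stepped_congr (A := steppedAcceptance ℱ P m s Rt) hts inter_subset_right hv hvy
  have h2 := genCondExp_congr (𝓖 := ℱ t) (scalarization_congr (hRs X) (y := condVec ℱ P s v) hvy)
  filter_upwards [h1, h2] with ω e1 e2
  rw [stepBound, e1, e2]

end Identification

/-! ### The two equivalences for regular risk measures. -/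

section Main

variable {Ω ι : Type*} {mΩ : MeasurableSpace Ω} [LinearOrder ι] [OrderTop ι]
  {P : Measure Ω} [IsProbabilityMeasure P] {ℱ : Filtration ι mΩ} {d m : ℕ} {p q : ℝ≥0∞}
  [Fact (1 ≤ p)] [p.HolderConjugate q] {s t : ι}
  {Rt Rs : Lp (Vec d) p P → Set (Lp (Vec d) p P)} {w : Ω → Vec d}

theorem stepBound_le_recursiveBound (hts : t ≤ s) (hT : ℱ ⊤ = mΩ)
    (hs : RegularRiskMeasure ℱ q m s Rs)
    (hw : w ∈ weights ℱ P q d m t) (X : Lp (Vec d) p P) {v : Ω → Vec d} (hv : MemLp v q P)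
    (hv0 : ∀ i, ∀ᵐ ω ∂P, 0 ≤ v ω i)
    (hvw : ∀ i : Fin d, i.val < m → P[fun ω => v ω i | ℱ t] =ᵐ[P] fun ω => w ω i) :
    stepBound ℱ m t s Rt Rs v X ≤ᵐ[P] recursiveBound ℱ P q m t s Rt Rs w X := by
  obtain ⟨Q, mperp, hQ, hy⟩ := exists_mem_dualSteppedAt (p := p) hts hv hv0 hw hvw
  have h1 := stepBound_congr (Rt := Rt) (Rs := Rs) hts hs.subset_Mt hv
    (y := wStep ℱ P t s Q (w + mperp)) (fun i _ => by
      filter_upwards [hy] with ω e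
      rw [e]
      rfl) X
  have h2 := (dualSteppedAt_spec hT hts hQ Rt).2.2.2
  -- Because `R_s(0) = M_{s,+}`, membership in `R_s(0)^+` is the cone condition of `𝒲_{t,s}`.
  have h3 : _ ≤ᵐ[P] recursiveBound ℱ P q m t s Rt Rs w X := le_essSupFam
    ⟨Q, mperp, hQ, by rw [hs.zero_eq]; exact hQ.2.2.2, rfl⟩
  filter_upwards [h1, h2, h3] with ω e1 e2 e3
  rw [e1, ← e2]
  exact e3

/-- The vector `w_t^s(Q, w + m_⊥)` serves as its own density, being `𝓕_s`-measurable. Its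
non-eligible coordinates may be negative, hence the hypothesis cannot be restricted to nonnegative
`v`. -/
theorem recursiveBound_le (hts : t ≤ s) (hT : ℱ ⊤ = mΩ) (hs : RegularRiskMeasure ℱ q m s Rs)
    {X : Lp (Vec d) p P} {g : Ω → EReal} (hg : AEMeasurable g P)
    (h : ∀ v : Ω → Vec d, MemLp v q P →
      (∀ i : Fin d, i.val < m → P[fun ω => v ω i | ℱ t] =ᵐ[P] fun ω => w ω i) →
      stepBound ℱ m t s Rt Rs v X ≤ᵐ[P] g) :
    recursiveBound ℱ P q m t s Rt Rs w X ≤ᵐ[P] g := by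
  have : q.HolderConjugate p := ENNReal.HolderConjugate.symm
  have hq : 1 ≤ q := ENNReal.HolderConjugate.one_le q p
  refine essSupFam_le hg ?_
  rintro _ ⟨Q, mperp, hQ, -, rfl⟩
  obtain ⟨h1, h2, h3, h4⟩ := dualSteppedAt_spec hT hts hQ Rt
  have h5 := stepBound_congr (Rt := Rt) (Rs := Rs) hts hs.subset_Mt h1
    (y := wStep ℱ P t s Q (w + mperp)) (fun i _ =>
      condExp_of_aestronglyMeasurable' (ℱ.le s) (aestronglyMeasurable_coord h2 i)
        ((memLp_coord h1 i).integrable hq)) X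
  filter_upwards [h4, h5, h _ h1 h3] with ω e1 e2 e3
  rw [e2] at e3
  rwa [e1]

/-- The three penalty functions of admissible dual variables, in terms of a single density. -/
theorem penalties_eq (hts : t ≤ s) (hT : ℱ ⊤ = mΩ) {Q S : Fin d → Measure Ω}
    {mperp nperp : Ω → Vec d} (hQ : (Q, mperp) ∈ dualSteppedAt ℱ P p q m t s w)
    (hS : (S, nperp) ∈ dualTerminalAt ℱ P q m s (wStep ℱ P t s Q (w + mperp)))
    (Rt Rs : Lp (Vec d) p P → Set (Lp (Vec d) p P)) :
    ∃ v : Ω → Vec d, v = wStep ℱ P s ⊤ S (wStep ℱ P t s Q (w + mperp) + nperp) ∧ MemLp v q P ∧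
      extendedPenalty ℱ P t s (acceptance Rt) w Q mperp S nperp
        =ᵐ[P] pen P (ℱ t) (acceptance Rt) v ∧
      (fun ω => penalty ℱ P t (steppedAcceptance ℱ P m s Rt) Q (w + mperp) ω
          + genCondExp P (ℱ t) (penalty ℱ P s (acceptance Rs) S
              (wStep ℱ P t s Q (w + mperp) + nperp)) ω) =ᵐ[P] fun ω =>
        pen P (ℱ t) (steppedAcceptance ℱ P m s Rt) v ω
          + genCondExp P (ℱ t) (pen P (ℱ s) (acceptance Rs) v) ω := by
  obtain ⟨h1, h2, h3, h4⟩ := dualSteppedAt_spec hT hts hQ Rt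
  obtain ⟨k1, k2, k3, k4⟩ := dualTerminalAt_spec hT hS (acceptance Rs)
  refine ⟨_, rfl, k1, extendedPenalty_eq_pen k1, ?_⟩
  filter_upwards [h4, genCondExp_congr (𝓖 := ℱ t) k4,
    pen_stepped_congr (A := steppedAcceptance ℱ P m s Rt) hts inter_subset_right k1 k3]
    with ω e1 e2 e3
  rw [e1, e2, e3]

/-- Every nonnegative density is given by admissible dual variables. -/
theorem exists_dual_variables (hts : t ≤ s) (hT : ℱ ⊤ = mΩ) {v : Ω → Vec d}
    (hv : MemLp v q P) (hv0 : ∀ i, ∀ᵐ ω ∂P, 0 ≤ v ω i)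
    (hw : condVec ℱ P t v ∈ weights ℱ P q d m t) :
    ∃ (Q S : Fin d → Measure Ω) (mperp nperp : Ω → Vec d),
      (Q, mperp) ∈ dualSteppedAt ℱ P p q m t s (condVec ℱ P t v) ∧
      (S, nperp) ∈ dualTerminalAt ℱ P q m s (wStep ℱ P t s Q (condVec ℱ P t v + mperp)) ∧
      wStep ℱ P s ⊤ S (wStep ℱ P t s Q (condVec ℱ P t v + mperp) + nperp) =ᵐ[P] v := by
  have : q.HolderConjugate p := ENNReal.HolderConjugate.symm
  have hq : 1 ≤ q := ENNReal.HolderConjugate.one_le q p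
  obtain ⟨Q, mperp, hQ, hy⟩ := exists_mem_dualSteppedAt (p := p) hts hv hv0 hw
    fun i _ => Filter.EventuallyEq.rfl
  obtain ⟨S, nperp, hS, hz⟩ := exists_mem_dualTerminalAt (m := m) hT hq hv hv0 hy
  exact ⟨Q, S, mperp, nperp, hQ, hS, hz⟩

theorem pen_congr_ae {A : Set (Lp (Vec d) p P)} {𝓖 : MeasurableSpace Ω} {v v' : Ω → Vec d}
    (h : v =ᵐ[P] v') : pen P 𝓖 A v =ᵐ[P] pen P 𝓖 A v' :=
  pen_congr fun Z _ => condLoss_congr h Z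

/-- Both consequences of the inclusion come from decomposing acceptable positions. Both converses
hold because every density that could separate a point from `A_{t,s} + A_s` is realised by dual
variables. -/
theorem tfae_subset (ht : RegularRiskMeasure ℱ q m t Rt) (hs : RegularRiskMeasure ℱ q m s Rs)
    (hts : t ≤ s) (hT : ℱ ⊤ = mΩ) (hm : 0 < m) (hmd : m ≤ d) :
    List.TFAE [
      acceptance Rt ⊆ steppedAcceptance ℱ P m s Rt + acceptance Rs,
      ∀ (X : Lp (Vec d) p P) (w : Ω → Vec d), w ∈ weights ℱ P q d m t →
        recursiveBound ℱ P q m t s Rt Rs w X ≤ᵐ[P] scalarization P Rt w X,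
      ∀ (w : Ω → Vec d), w ∈ weights ℱ P q d m t →
        ∀ (Q : Fin d → Measure Ω) (mperp : Ω → Vec d),
        (Q, mperp) ∈ dualSteppedAt ℱ P p q m t s w →
        ∀ (S : Fin d → Measure Ω) (nperp : Ω → Vec d),
        (S, nperp) ∈ dualTerminalAt ℱ P q m s (wStep ℱ P t s Q (w + mperp)) →
        extendedPenalty ℱ P t s (acceptance Rt) w Q mperp S nperp ≤ᵐ[P] fun ω =>
          penalty ℱ P t (steppedAcceptance ℱ P m s Rt) Q (w + mperp) ω
          + genCondExp P (ℱ t) (penalty ℱ P s (acceptance Rs) S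
              (wStep ℱ P t s Q (w + mperp) + nperp)) ω] := by
  tfae_have 1 → 2 := fun h X w hw =>
    recursiveBound_le hts hT hs (isEssSup_essSupFam P _).1.neg.aemeasurable fun v hv hvw =>
      stepBound_le_scalarization ht hs hts h hv hvw X
  tfae_have 2 → 1 := fun h => subset_add_of_stepBound_le ht hs hts hm hmd fun v hv hv0 hvw X =>
    (stepBound_le_recursiveBound hts hT hs hvw X hv hv0 fun i _ => Filter.EventuallyEq.rfl).trans
      (h X _ hvw)
  tfae_have 1 → 3 := by
    intro h w hw Q mperp hQ S nperp hS
    obtain ⟨v, -, hv, e1, e2⟩ := penalties_eq hts hT hQ hS Rt Rs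
    exact (e1.le.trans (pen_le_add_of_subset hts h hv)).trans e2.symm.le
  tfae_have 3 → 1 := by
    intro h
    refine subset_add_of_condLoss_le ht hs hts hm hmd fun v hv hv0 hvw _ X hX => ?_
    obtain ⟨Q, S, mperp, nperp, hQ, hS, hz⟩ := exists_dual_variables (p := p) hts hT hv hv0 hvw
    obtain ⟨v', rfl, -, e1, e2⟩ := penalties_eq hts hT hQ hS Rt Rs
    filter_upwards [h _ hvw Q mperp hQ S nperp hS, e1, e2,
      pen_congr_ae (𝓖 := ℱ t) (A := acceptance Rt) hz,
      pen_congr_ae (𝓖 := ℱ t) (A := steppedAcceptance ℱ P m s Rt) hz,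
      genCondExp_congr (𝓖 := ℱ t) (pen_congr_ae (𝓖 := ℱ s) (A := acceptance Rs) hz),
      condLoss_le_pen (𝓖 := ℱ t) (v := v) hX] with ω h e1 e2 e3 e4 e5 e6
    rw [e1, e2, e3, e4, e5] at h
    exact e6.trans h
  tfae_finish

/-- A cycle: penalties over a sum are suprema over its members, near-optimal densities pass from
penalties to scalarizations, and since the step bound is nonpositive on `A_{t,s} + A_s`, so is the
scalarization there, which means acceptance. -/
theorem tfae_superset (ht : RegularRiskMeasure ℱ q m t Rt) (hs : RegularRiskMeasure ℱ q m s Rs)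
    (hts : t ≤ s) (hT : ℱ ⊤ = mΩ) (hm : 0 < m) (hmd : m ≤ d) :
    List.TFAE [
      steppedAcceptance ℱ P m s Rt + acceptance Rs ⊆ acceptance Rt,
      ∀ (X : Lp (Vec d) p P) (w : Ω → Vec d), w ∈ weights ℱ P q d m t →
        scalarization P Rt w X ≤ᵐ[P] recursiveBound ℱ P q m t s Rt Rs w X,
      ∀ (w : Ω → Vec d), w ∈ weights ℱ P q d m t →
        ∀ (Q : Fin d → Measure Ω) (mperp : Ω → Vec d),
        (Q, mperp) ∈ dualSteppedAt ℱ P p q m t s w →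
        ∀ (S : Fin d → Measure Ω) (nperp : Ω → Vec d),
        (S, nperp) ∈ dualTerminalAt ℱ P q m s (wStep ℱ P t s Q (w + mperp)) →
        (fun ω => penalty ℱ P t (steppedAcceptance ℱ P m s Rt) Q (w + mperp) ω
          + genCondExp P (ℱ t) (penalty ℱ P s (acceptance Rs) S
              (wStep ℱ P t s Q (w + mperp) + nperp)) ω) ≤ᵐ[P]
        extendedPenalty ℱ P t s (acceptance Rt) w Q mperp S nperp] := by
  tfae_have 1 → 3 := by
    intro h w hw Q mperp hQ S nperp hS
    obtain ⟨v, -, hv, e1, e2⟩ := penalties_eq hts hT hQ hS Rt Rs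
    exact (e2.le.trans (add_le_pen_of_subset ht hs hts h hv)).trans e1.symm.le
  tfae_have 3 → 2 := by
    intro h X w hw
    refine scalarization_le_of_stepBound_le ht hs hts (fun v hv hv0 hvw => ?_) hw X
      fun v hv hv0 hvw => stepBound_le_recursiveBound hts hT hs hw X hv hv0 hvw
    obtain ⟨Q, S, mperp, nperp, hQ, hS, hz⟩ := exists_dual_variables (p := p) hts hT hv hv0 hvw
    obtain ⟨v', rfl, -, e1, e2⟩ := penalties_eq hts hT hQ hS Rt Rs
    filter_upwards [h _ hvw Q mperp hQ S nperp hS, e1, e2,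
      pen_congr_ae (𝓖 := ℱ t) (A := acceptance Rt) hz,
      pen_congr_ae (𝓖 := ℱ t) (A := steppedAcceptance ℱ P m s Rt) hz,
      genCondExp_congr (𝓖 := ℱ t) (pen_congr_ae (𝓖 := ℱ s) (A := acceptance Rs) hz)]
      with ω h e1 e2 e3 e4 e5
    rwa [e1, e2, e3, e4, e5] at h
  tfae_have 2 → 1 := by
    intro h X hX
    refine mem_acceptance_of_scalarization_le_zero ht hm hmd fun w hw => ?_
    exact (h X w hw).trans (recursiveBound_le hts hT hs aemeasurable_const fun v hv _ =>
      stepBound_le_zero hs hts hv hX)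
  tfae_finish

end Main

/-! ### Deterministic vectors on events. -/

section Constants

variable {Ω ι : Type*} {mΩ : MeasurableSpace Ω} [LinearOrder ι]
  {P : Measure Ω} [IsFiniteMeasure P] {ℱ : Filtration ι mΩ} {d m : ℕ} {p : ℝ≥0∞} {r : ι}

/-- The random vector `1_E x`. -/
noncomputable def indLp (P : Measure Ω) [IsFiniteMeasure P] (p : ℝ≥0∞) {E : Set Ω}
    (hE : MeasurableSet E) (x : Vec d) : Lp (Vec d) p P :=
  ((memLp_const x).indicator hE : MemLp (E.indicator fun _ => x) p P).toLp _

theorem coeFn_indLp {E : Set Ω} (hE : MeasurableSet E) (x : Vec d) :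
    indLp P p hE x =ᵐ[P] E.indicator fun _ => x := MemLp.coeFn_toLp _

theorem indLp_mem_Mt {E : Set Ω} (hE : MeasurableSet[ℱ r] E) {x : Vec d} (hx : x ∈ eligible d m) :
    indLp P p (ℱ.le r E hE) x ∈ Mt ℱ P m r := by
  have hb := coeFn_indLp (P := P) (p := p) (ℱ.le r E hE) x
  refine mem_Mt.2 ⟨AEStronglyMeasurable.congr (aestronglyMeasurable_indicator
      aestronglyMeasurable_const hE) hb.symm, ?_⟩
  filter_upwards [hb] with ω h i hi
  rw [h]
  by_cases hω : ω ∈ E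
  · rw [indicator_of_mem hω, hx i hi]
  · rw [indicator_of_notMem hω, PiLp.zero_apply]

theorem indLp_mem_MtPos {E : Set Ω} (hE : MeasurableSet[ℱ r] E) {x : Vec d}
    (hx : x ∈ eligiblePos d m) : indLp P p (ℱ.le r E hE) x ∈ MtPos ℱ P m r := by
  refine mem_MtPos.2 ⟨indLp_mem_Mt hE hx.1, ?_⟩
  filter_upwards [coeFn_indLp (P := P) (p := p) (ℱ.le r E hE) x] with ω h i
  rw [h]
  by_cases hω : ω ∈ E
  · rw [indicator_of_mem hω]
    exact hx.2 i
  · rw [indicator_of_notMem hω, PiLp.zero_apply]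

theorem isClosed_eligible : IsClosed (eligible d m) := by
  have e : eligible d m = ⋂ (i : Fin d) (_ : m ≤ i.val), {x : Vec d | x i = 0} := by
    ext x; simp [eligible]
  rw [e]
  exact isClosed_iInter fun i => isClosed_iInter fun _ =>
    isClosed_eq (by fun_prop) continuous_const

theorem isClosed_eligiblePos : IsClosed (eligiblePos d m) := by
  have e : orthant d = ⋂ i : Fin d, {x : Vec d | 0 ≤ x i} := by
    ext x; simp [orthant]
  refine isClosed_eligible.inter ?_
  rw [e]
  exact isClosed_iInter fun i => isClosed_le continuous_const (by fun_prop)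

/-- A random closed set contains a deterministic set as soon as it contains each of its points. -/
theorem ae_subset_of_forall_mem {G : Ω → Set (Vec d)} (hG : ∀ ω, IsClosed (G ω)) {K : Set (Vec d)}
    {E : Set Ω} (h : ∀ x ∈ K, ∀ᵐ ω ∂P, ω ∈ E → x ∈ G ω) : ∀ᵐ ω ∂P, ω ∈ E → K ⊆ G ω := by
  obtain ⟨T, hTK, hTc, hKT⟩ :=
    (TopologicalSpace.IsSeparable.of_separableSpace K).exists_countable_dense_subset
  have h' : ∀ᵐ ω ∂P, ∀ x ∈ T, ω ∈ E → x ∈ G ω := (ae_ball_iff hTc).2 fun x hx => h x (hTK hx)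
  filter_upwards [h'] with ω hω hE
  exact hKT.trans (closure_minimal (fun x hx => hω x hx hE) (hG ω))

end Constants

/-! ### `R(0)` is a closed convex cone that is proper on every event. -/

section ZeroRisk

variable {Ω ι : Type*} {mΩ : MeasurableSpace Ω} [LinearOrder ι] [OrderTop ι]
  {P : Measure Ω} [IsProbabilityMeasure P] {ℱ : Filtration ι mΩ} {d m : ℕ} {p : ℝ≥0∞}
  [Fact (1 ≤ p)] {r : ι} {R : Lp (Vec d) p P → Set (Lp (Vec d) p P)} {R0 : Ω → Set (Vec d)}

theorem IsConditionallyConvex.convex_zero (hconv : IsConditionallyConvex ℱ P r R) :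
    Convex ℝ (R 0) := by
  intro u hu v hv a b ha hb hab
  refine hconv (fun _ => a) stronglyMeasurable_const (fun _ => ⟨ha, by linarith⟩) 0 0 u v 0 _ hu hv
    ?_ ?_
  · filter_upwards [Lp.coeFn_zero (Vec d) p P] with ω h
    rw [h]
    simp
  · have hb' : 1 - a = b := by linarith
    filter_upwards [Lp.coeFn_add (a • u) (b • v), Lp.coeFn_smul a u, Lp.coeFn_smul b v]
      with ω h1 h2 h3
    rw [h1, Pi.add_apply, h2, h3, hb']
    rfl

/-- Normalization writes `c ∈ R 0` as a sum of two members, so `c / 2` is their midpoint and lies in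
`R 0` by convexity. Repeated halving tends to `0`, and `R 0` is closed. -/
theorem zero_mem_zero (hR : IsConditionalRiskMeasure ℱ P m r R R0) (hnorm : IsNormalized R)
    (hconv : IsConditionallyConvex ℱ P r R) : 0 ∈ R 0 := by
  let _ := lpTop d p P
  have := lpTop_continuousSMul (d := d) (p := p) (P := P)
  obtain ⟨c, hc⟩ := hR.zero_nonempty
  have hhalf : ∀ c ∈ R 0, (1 / 2 : ℝ) • c ∈ R 0 := by
    intro c hc
    rw [hnorm 0] at hc
    obtain ⟨a, ha, b, hb, rfl⟩ := hc
    rw [smul_add]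
    exact hconv.convex_zero ha hb (by norm_num) (by norm_num) (by norm_num)
  have hpow : ∀ n : ℕ, ((1 / 2 : ℝ) ^ n) • c ∈ R 0 := by
    intro n
    induction n with
    | zero => simpa using hc
    | succ n ih =>
      rw [pow_succ', mul_smul]
      exact hhalf _ ih
  have hlim : Filter.Tendsto (fun n : ℕ => ((1 / 2 : ℝ) ^ n) • c) Filter.atTop (𝓝 0) := by
    have h1 : Filter.Tendsto (fun n : ℕ => (1 / 2 : ℝ) ^ n) Filter.atTop (𝓝 0) :=
      tendsto_pow_atTop_nhds_zero_of_lt_one (by norm_num) (by norm_num)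
    simpa using h1.smul_const c
  exact hR.zero_closed.mem_of_tendsto hlim (.of_forall hpow)

theorem add_mem_zero (hnorm : IsNormalized R) {u v : Lp (Vec d) p P} (hu : u ∈ R 0)
    (hv : v ∈ R 0) : u + v ∈ R 0 := by
  rw [hnorm 0]
  exact add_mem_add hu hv

/-- Integer multiples come from additivity, the others by convexity with `0`. -/
theorem smul_mem_zero (hR : IsConditionalRiskMeasure ℱ P m r R R0) (hnorm : IsNormalized R)
    (hconv : IsConditionallyConvex ℱ P r R) {u : Lp (Vec d) p P} (hu : u ∈ R 0) {a : ℝ}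
    (ha : 0 ≤ a) : a • u ∈ R 0 := by
  have h0 := zero_mem_zero hR hnorm hconv
  have hn : ∀ n : ℕ, (n : ℝ) • u ∈ R 0 := by
    intro n
    induction n with
    | zero => simpa using h0
    | succ n ih =>
      rw [Nat.cast_succ, add_smul, one_smul]
      exact add_mem_zero hnorm ih hu
  obtain ⟨n, hn'⟩ := exists_nat_gt a
  have hpos : (0 : ℝ) < n := ha.trans_lt hn'
  have := hconv.convex_zero h0 (hn n) (a := 1 - a / n) (b := a / n)
    (sub_nonneg.2 ((div_le_one hpos).2 hn'.le)) (by positivity) (by ring)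
  rwa [smul_zero, zero_add, smul_smul, div_mul_cancel₀ _ hpos.ne'] at this

theorem MtPos_subset_zero (hR : IsConditionalRiskMeasure ℱ P m r R R0) (hnorm : IsNormalized R)
    (hconv : IsConditionallyConvex ℱ P r R) : MtPos ℱ P m r ⊆ R 0 := by
  intro k hk
  rw [hR.upper 0]
  exact ⟨0, zero_mem_zero hR hnorm hconv, k, hk, zero_add k⟩

/-- Pointwise inclusion of the random set from inclusion of its selections. -/
theorem zeroSet_subset (hR : IsConditionalRiskMeasure ℱ P m r R R0) (hnorm : IsNormalized R)
    (hconv : IsConditionallyConvex ℱ P r R) {K : Set (Vec d)} (hK : IsClosed K)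
    (h : ∀ Z ∈ R 0, ∀ᵐ ω ∂P, Z ω ∈ K) : ∀ᵐ ω ∂P, R0 ω ⊆ K := by
  classical
  refine ae_subset_of_forall_selection (m := ℱ r) hR.zeroSet_closed hR.zeroSet_measurable hK
    fun F f hF hf ⟨x, C, hxC⟩ hfG => ?_
  have h0 := zero_mem_zero hR hnorm hconv
  rw [hR.zero_eq] at h0
  have hFm := ℱ.le r F hF
  have hfs : StronglyMeasurable[ℱ r] (F.indicator f) := (hf.indicator hF).stronglyMeasurable
  have hmem : MemLp (F.indicator f) p P := by
    refine MemLp.of_bound (hfs.mono (ℱ.le r)).aestronglyMeasurable (|C| + ‖x‖)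
      (.of_forall fun ω => ?_)
    by_cases hω : ω ∈ F
    · rw [indicator_of_mem hω]
      have := hxC ω hω
      rw [dist_eq_norm] at this
      calc ‖f ω‖ = ‖(f ω - x) + x‖ := by rw [sub_add_cancel]
        _ ≤ ‖f ω - x‖ + ‖x‖ := norm_add_le _ _
        _ ≤ |C| + ‖x‖ := by linarith [le_abs_self C]
    · rw [indicator_of_notMem hω, norm_zero]
      positivity
  have hco := hmem.coeFn_toLp
  have hZ : hmem.toLp _ ∈ R 0 := by
    rw [hR.zero_eq]
    refine ⟨Lp.memLp _, hfs.aestronglyMeasurable.congr hco.symm, ?_⟩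
    filter_upwards [hco, h0.2.2, Lp.coeFn_zero (Vec d) p P] with ω e1 e2 e3
    rw [e1]
    by_cases hω : ω ∈ F
    · rw [indicator_of_mem hω]
      exact hfG ω hω
    · rw [indicator_of_notMem hω]
      rwa [e3] at e2
  filter_upwards [h _ hZ, hco] with ω e1 e2 hω
  rwa [e2, indicator_of_mem hω] at e1

theorem onesVec_mem : (WithLp.toLp 2 fun i => if i.val < m then 1 else 0 : Vec d) ∈
    eligiblePos d m := by
  refine ⟨fun i hi => ?_, fun i => ?_⟩
  · simp [not_lt.2 hi]
  · by_cases hi : i.val < m <;> simp [hi]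

/-- The random set `R0` is a proper subset of `M`: no constant short position on a set of positive
probability belongs to `R(0)`. -/
theorem neg_indLp_notMem_zero (hR : IsConditionalRiskMeasure ℱ P m r R R0) (hnorm : IsNormalized R)
    (hconv : IsConditionallyConvex ℱ P r R) {E : Set Ω} (hE : MeasurableSet[ℱ r] E)
    (hPE : P E ≠ 0) :
    -indLp P p (ℱ.le r E hE) (WithLp.toLp 2 fun i => if i.val < m then 1 else 0) ∉ R 0 := by
  intro hmem
  set e := indLp P p (ℱ.le r E hE) (WithLp.toLp 2 fun i : Fin d => if i.val < m then (1 : ℝ) else 0)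
  have hsub := zeroSet_subset hR hnorm hconv (K := eligible d m) isClosed_eligible fun Z hZ => by
    filter_upwards [(mem_Mt.1 (hR.subset_Mt 0 hZ)).2] with ω h using h
  -- For `x ∈ M`, the vector `x + ‖x‖(1,…,1,0,…,0)` is in `M_+`; adding `-‖x‖` times the unit
  -- position shows that `1_E x` is in `R 0`. So the random set would be all of `M` on `E`.
  have hsup := ae_subset_of_forall_mem (P := P) hR.zeroSet_closed (K := eligible d m) (E := E)
    fun x hx => by
      have hy : (‖x‖ • (WithLp.toLp 2 fun i : Fin d => if i.val < m then (1 : ℝ) else 0) + x : Vec d)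
          ∈ eligiblePos d m := by
        refine ⟨fun i hi => ?_, fun i => ?_⟩
        · simp [not_lt.2 hi, hx i hi]
        · by_cases hi : i.val < m
          · have := PiLp.norm_apply_le x i
            rw [Real.norm_eq_abs] at this
            simp only [PiLp.add_apply, PiLp.smul_apply, hi, if_true, smul_eq_mul, mul_one]
            linarith [neg_abs_le (x i)]
          · simp [hi, hx i (not_lt.1 hi)]
      have h1 := add_mem_zero hnorm
        (smul_mem_zero hR hnorm hconv hmem (norm_nonneg x))
        (MtPos_subset_zero hR hnorm hconv (indLp_mem_MtPos (P := P) (p := p) hE hy))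
      rw [hR.zero_eq] at h1
      filter_upwards [h1.2.2, Lp.coeFn_add (‖x‖ • -e) (indLp P p (ℱ.le r E hE) _),
        Lp.coeFn_smul ‖x‖ (-e), Lp.coeFn_neg e, coeFn_indLp (P := P) (p := p) (ℱ.le r E hE) _,
        coeFn_indLp (P := P) (p := p) (ℱ.le r E hE) _] with ω e1 e2 e3 e4 e5 e6 hω
      rw [e2, Pi.add_apply, e3, Pi.smul_apply, e4, Pi.neg_apply, e5, e6,
        indicator_of_mem hω, indicator_of_mem hω, smul_neg, neg_add_cancel_left] at e1
      exact e1
  have hnot : ∀ᵐ ω ∂P, ω ∉ E := by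
    filter_upwards [hsub, hsup, hR.zeroSet_ne] with ω e1 e2 e3 hω
    exact e3 (e1.antisymm (e2 hω))
  exact hPE (by simpa using measure_eq_zero_iff_ae_notMem.2 hnot)

end ZeroRisk

/-! ### Convex upper continuity forces `R(0) = M_+`. -/

section ZeroRiskPos

variable {Ω ι : Type*} {mΩ : MeasurableSpace Ω} [LinearOrder ι] [OrderTop ι]
  {P : Measure Ω} [IsProbabilityMeasure P] {ℱ : Filtration ι mΩ} {d m : ℕ} {p q : ℝ≥0∞}
  [Fact (1 ≤ p)] {r : ι} {R : Lp (Vec d) p P → Set (Lp (Vec d) p P)} {R0 : Ω → Set (Vec d)}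

/-- The last point of `C` on the ray from `c` in the direction `-e`. -/
theorem exists_last_on_ray (hR : IsConditionalRiskMeasure ℱ P m r R R0) (hnorm : IsNormalized R)
    (hconv : IsConditionallyConvex ℱ P r R) {c e : Lp (Vec d) p P} (hc : c ∈ R 0)
    (he : -e ∉ R 0) : ∃ l : ℝ, 0 ≤ l ∧ c - l • e ∈ R 0 ∧ ∀ δ : ℝ, 0 < δ → c - l • e - δ • e ∉ R 0 := by
  let _ := lpTop d p P
  have := lpTop_continuousSMul (d := d) (p := p) (P := P)
  have := lpTop_isTopologicalAddGroup (d := d) (p := p) (P := P)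
  set S : Set ℝ := {l | 0 ≤ l ∧ c - l • e ∈ R 0} with hS
  have hSc : IsClosed S := isClosed_Ici.inter (hR.zero_closed.preimage
    (by fun_prop : Continuous fun l : ℝ => c - l • e))
  have h0 : (0 : ℝ) ∈ S := ⟨le_rfl, by simpa using hc⟩
  -- Along an unbounded ray, rescaling by `1 / l n` would produce `-e` as a limit of members of the
  -- cone.
  have hbdd : BddAbove S := by
    by_contra hunb
    rw [not_bddAbove_iff] at hunb
    choose l hl hnl using fun n : ℕ => hunb (n + 1)
    have hpos : ∀ n, 0 < l n := fun n => lt_trans (by positivity) (hnl n)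
    have hmem : ∀ n, (l n)⁻¹ • c - e ∈ R 0 := fun n => by
      have := smul_mem_zero hR hnorm hconv (hl n).2 (inv_nonneg.2 (hpos n).le)
      rwa [smul_sub, smul_smul, inv_mul_cancel₀ (hpos n).ne', one_smul] at this
    have hlim : Filter.Tendsto (fun n => (l n)⁻¹ • c - e) Filter.atTop (𝓝 (-e)) := by
      have h1 : Filter.Tendsto l Filter.atTop Filter.atTop :=
        Filter.tendsto_atTop_mono (fun n => (lt_trans (lt_add_one (n : ℝ)) (hnl n)).le)
          tendsto_natCast_atTop_atTop
      have h2 := ((tendsto_inv_atTop_zero.comp h1).smul_const c).sub_const e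
      simpa using h2
    exact he (hR.zero_closed.mem_of_tendsto hlim (.of_forall hmem))
  have hmem := hSc.csSup_mem ⟨0, h0⟩ hbdd
  refine ⟨sSup S, hmem.1, hmem.2, fun δ hδ hin => ?_⟩
  have : sSup S + δ ∈ S := ⟨by linarith [hmem.1], by rwa [add_smul, ← sub_sub]⟩
  linarith [le_csSup hbdd this]

/-- The curve `ρ b - e / (1 + ρ)`, lowered by nonnegative eligible portfolios, is closed. -/
theorem isClosed_curve_sub [p.HolderConjugate q] {b e : Lp (Vec d) p P} {v : Ω → Vec d}
    (hv : MemLp v q P) (hb : pair P v b < 0) (he : 0 ≤ pair P v e)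
    (hk : ∀ k ∈ (MtPos ℱ P m r : Set (Lp (Vec d) p P)), 0 ≤ pair P v k) :
    IsClosed[lpTop d p P] {u : Lp (Vec d) p P | ∃ ρ : ℝ, 0 ≤ ρ ∧ ρ • b - (1 + ρ)⁻¹ • e - u ∈
      MtPos ℱ P m r} := by
  let _ := lpTop d p P
  have := lpTop_continuousSMul (d := d) (p := p) (P := P)
  have := lpTop_isTopologicalAddGroup (d := d) (p := p) (P := P)
  refine isClosed_of_closure_subset fun u hu => ?_
  -- Pairing with `v` bounds the parameter: near `u` only `ρ ≤ N` can occur. The arc over `[0, N]`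
  -- is compact, and a compact set plus a closed set is closed.
  set N : ℝ := pair P v u / pair P v b + 1
  set U : Set (Lp (Vec d) p P) := {u | pair P v u / pair P v b < N}
  have hU : IsOpen U := isOpen_lt ((continuous_pair hv).div_const _) continuous_const
  have huU : u ∈ U := lt_add_one (pair P v u / pair P v b)
  have hcurve : IsCompact ((fun ρ : ℝ => ρ • b - (1 + ρ)⁻¹ • e) '' Icc 0 N) := by
    have hinv : ContinuousOn (fun ρ : ℝ => (1 + ρ)⁻¹) (Icc 0 N) :=
      ContinuousOn.inv₀ (by fun_prop) fun ρ hρ => (by linarith [hρ.1] : 0 < 1 + ρ).ne'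
    exact isCompact_Icc.image_of_continuousOn
      ((by fun_prop : ContinuousOn (fun ρ : ℝ => ρ • b) (Icc 0 N)).sub
        (hinv.smul continuousOn_const))
  have hcl : IsClosed ((fun ρ : ℝ => ρ • b - (1 + ρ)⁻¹ • e) '' Icc 0 N
      + -(MtPos ℱ P m r : Set (Lp (Vec d) p P))) :=
    IsClosed.add_left_of_isCompact (isClosed_MtPos.preimage continuous_neg) hcurve
  have hmem := hU.inter_closure ⟨huU, hu⟩
  have hsub := closure_minimal (s := U ∩ _) ?_ hcl hmem
  · obtain ⟨_, ⟨ρ, hρ, rfl⟩, k, hk', rfl⟩ := hsub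
    refine ⟨ρ, hρ.1, ?_⟩
    rw [sub_add_cancel_left]
    exact hk'
  · rintro w ⟨hwU, ρ, hρ, hw⟩
    refine ⟨_, ⟨ρ, ⟨hρ, ?_⟩, rfl⟩, w - (ρ • b - (1 + ρ)⁻¹ • e), by rwa [mem_neg, neg_sub],
      add_sub_cancel _ _⟩
    have h1 := hk _ hw
    rw [pair_sub hv, pair_sub hv, pair_smul, pair_smul] at h1
    have h2 : 0 ≤ (1 + ρ)⁻¹ * pair P v e := mul_nonneg (by positivity) he
    have h3 : ρ ≤ pair P v w / pair P v b := by
      rw [le_div_iff_of_neg hb]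
      linarith
    exact h3.trans (le_of_lt hwU)

/-- Convexity of `ρ ↦ 1 / (1 + ρ)` puts a convex combination of two curve points below the curve
point at the averaged parameter; the gap is a nonnegative multiple of `e`. -/
theorem convex_curve_sub {b e : Lp (Vec d) p P} (he : e ∈ MtPos ℱ P m r) :
    Convex ℝ {u : Lp (Vec d) p P | ∃ ρ : ℝ, 0 ≤ ρ ∧ ρ • b - (1 + ρ)⁻¹ • e - u ∈
      MtPos ℱ P m r} := by
  rintro u ⟨ρ, hρ, hu⟩ v ⟨σ, hσ, hv⟩ a c ha hc hac
  refine ⟨a * ρ + c * σ, by positivity, ?_⟩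
  have hconvex : (1 + (a * ρ + c * σ))⁻¹ ≤ a * (1 + ρ)⁻¹ + c * (1 + σ)⁻¹ := by
    have := (convexOn_zpow (𝕜 := ℝ) (-1)).2 (show 1 + ρ ∈ Ioi 0 by simp; linarith)
      (show 1 + σ ∈ Ioi 0 by simp; linarith) ha hc hac
    simp only [smul_eq_mul, zpow_neg_one] at this
    refine le_trans (le_of_eq ?_) this
    congr 1
    linear_combination -hac
  have h1 := MtPos_add (MtPos_add (MtPos_smul hu ha) (MtPos_smul hv hc))
    (MtPos_smul he (sub_nonneg.2 hconvex))
  convert h1 using 1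
  module

/-- Convex upper continuity forces the acceptance of portfolios to be trivial. -/
theorem not_pair_neg [p.HolderConjugate q] (hR : IsConditionalRiskMeasure ℱ P m r R R0)
    (hnorm : IsNormalized R) (hconv : IsConditionallyConvex ℱ P r R) (hcuc : IsCUC ℱ P m r R)
    {c e : Lp (Vec d) p P} {v : Ω → Vec d} (hv : MemLp v q P) (hc : c ∈ R 0)
    (he : e ∈ MtPos ℱ P m r) (he' : -e ∉ R 0)
    (hk : ∀ k ∈ (MtPos ℱ P m r : Set (Lp (Vec d) p P)), 0 ≤ pair P v k) : 0 ≤ pair P v c := by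
  by_contra! hneg
  obtain ⟨l, hl, hb, hlast⟩ := exists_last_on_ray hR hnorm hconv hc he'
  -- Moving `c` to the boundary of the cone along `-e` keeps its `v`-value negative.
  set b := c - l • e
  have hvb : pair P v b < 0 := by
    rw [pair_sub hv, pair_smul]
    linarith [mul_nonneg hl (hk e he)]
  set S := MtSub ℱ P d m p r
  have heM : e ∈ S := (mem_MtPos.1 he).1
  have hbM : b ∈ S := hR.subset_Mt 0 hb
  set D : Set (Lp (Vec d) p P) := {u | ∃ ρ : ℝ, 0 ≤ ρ ∧ ρ • b - (1 + ρ)⁻¹ • e - u ∈ MtPos ℱ P m r}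
  have hD : IsClosed[lpTop d p P] {X | (R X ∩ D).Nonempty} := by
    refine hcuc D (isLowerClosedConvex_of ?_ (isClosed_curve_sub hv hvb (hk e he) hk)
      (convex_curve_sub he) ?_)
    · rintro u ⟨ρ, -, hu⟩
      have := S.sub_mem (S.sub_mem (S.smul_mem ρ hbM) (S.smul_mem (1 + ρ)⁻¹ heM)) (mem_MtPos.1 hu).1
      rwa [sub_sub_cancel] at this
    · rintro u ⟨ρ, hρ, hu⟩ k hk
      refine ⟨ρ, hρ, ?_⟩
      rw [sub_sub_eq_add_sub, add_sub_right_comm]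
      exact MtPos_add hu hk
  -- The curve point `n b - e / (1 + n)` belongs to `R(e / (1 + n))` because `n b ∈ R(0)`; these
  -- positions tend to `0`, and the set of positions meeting `D` is closed.
  have hmem : (0 : Lp (Vec d) p P) ∈ {X | (R X ∩ D).Nonempty} := by
    let _ := lpTop d p P
    have := lpTop_continuousSMul (d := d) (p := p) (P := P)
    have hlim : Filter.Tendsto (fun n : ℕ => (1 + (n : ℝ))⁻¹ • e) Filter.atTop (𝓝 0) := by
      have h1 : Filter.Tendsto (fun n : ℕ => (1 + (n : ℝ))⁻¹) Filter.atTop (𝓝 0) := by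
        simpa [add_comm] using tendsto_one_div_add_atTop_nhds_zero_nat (𝕜 := ℝ)
      simpa using h1.smul_const e
    refine IsClosed.mem_of_tendsto hD hlim (.of_forall fun n => ?_)
    refine ⟨(n : ℝ) • b - (1 + (n : ℝ))⁻¹ • e, ?_, n, n.cast_nonneg, ?_⟩
    · have := hR.translative 0 ((1 + (n : ℝ))⁻¹ • e) (S.smul_mem _ heM)
      rw [zero_add] at this
      rw [this]
      exact ⟨_, smul_mem_zero hR hnorm hconv hb n.cast_nonneg, rfl⟩
    · rw [sub_self]
      exact zero_mem_MtPos
  -- Then some `ρ b - e / (1 + ρ)` lies in `R(0)`. For `ρ = 0` this is `-e`; for `ρ > 0`, dividing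
  -- by `ρ` gives a point of the ray strictly beyond `b`. Both are excluded.
  obtain ⟨u, hu, ρ, hρ, hk'⟩ := hmem
  have h1 := add_mem_zero hnorm hu (MtPos_subset_zero hR hnorm hconv hk')
  rw [add_sub_cancel] at h1
  rcases hρ.eq_or_lt with rfl | hρ
  · simp only [zero_smul, zero_sub, add_zero, inv_one, one_smul] at h1
    exact he' h1
  · have h2 := smul_mem_zero hR hnorm hconv h1 (inv_nonneg.2 hρ.le)
    rw [smul_sub, smul_smul, smul_smul, inv_mul_cancel₀ hρ.ne', one_smul] at h2
    exact hlast _ (by positivity) h2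

/-- If `c_i < 0` on an event `E` of positive probability, then `v = 1_E e_i` is nonnegative on `M_+`
but negative at `c`, which `not_pair_neg` forbids, taking for `e` the unit eligible position on `E`.
-/
theorem zero_eq_MtPos (hR : IsConditionalRiskMeasure ℱ P m r R R0)
    (hnorm : IsNormalized R) (hconv : IsConditionallyConvex ℱ P r R) (hcuc : IsCUC ℱ P m r R) :
    R 0 = MtPos ℱ P m r := by
  have hp : 1 ≤ p := Fact.out
  refine Subset.antisymm (fun c hc => ?_) (MtPos_subset_zero hR hnorm hconv)
  have hcM := mem_Mt.1 (hR.subset_Mt 0 hc)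
  refine mem_MtPos.2 ⟨hR.subset_Mt 0 hc, ae_all_iff.2 fun i => ?_⟩
  by_cases hi : i.val < m
  swap
  · filter_upwards [hcM.2] with ω h
    exact (h i (not_lt.1 hi)).ge
  have hci := aestronglyMeasurable_coord hcM.1 i
  set g := hci.mk _
  set E : Set Ω := {ω | g ω < 0}
  have hE : MeasurableSet[ℱ r] E :=
    @measurableSet_lt _ _ _ _ _ (ℱ r) _ _ _ _ _ hci.stronglyMeasurable_mk.measurable
      measurable_const
  have hE' := ℱ.le r E hE
  have hPE : P E = 0 := by
    by_contra hPE
    have h1 : 0 ≤ pair P (E.indicator fun _ => EuclideanSpace.single i 1) c :=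
      not_pair_neg (q := p.conjExponent) hR hnorm hconv hcuc (memLp_box hE' i _) hc
        (indLp_mem_MtPos hE onesVec_mem) (neg_indLp_notMem_zero hR hnorm hconv hE hPE)
        fun k hk => by
          rw [box_pair hE']
          exact setIntegral_nonneg_of_ae ((mem_MtPos.1 hk).2.mono fun ω h => h i)
    rw [box_pair hE'] at h1
    have h2 : 0 ≤ᵐ[P.restrict E] fun ω => -c ω i := by
      rw [Filter.EventuallyLE, ae_restrict_iff' hE']
      filter_upwards [hci.ae_eq_mk] with ω e hω
      rw [e]
      exact neg_nonneg.2 (le_of_lt hω)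
    have hint : IntegrableOn (fun ω => -c ω i) E P :=
      ((memLp_coord (Lp.memLp c) i).integrable hp).neg.integrableOn
    have h3 : ∫ ω in E, -c ω i ∂P = 0 := by
      refine le_antisymm ?_ (integral_nonneg_of_ae h2)
      rw [integral_neg]
      linarith
    have h4 := (ae_restrict_iff' hE').1 ((integral_eq_zero_iff_of_nonneg_ae h2 hint).1 h3)
    refine hPE (measure_eq_zero_iff_ae_notMem.2 ?_)
    filter_upwards [h4, hci.ae_eq_mk] with ω e1 e2 hω
    have h5 : -c ω i = 0 := e1 hω
    have h6 : g ω < 0 := hω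
    have h7 : c ω i = g ω := e2
    rw [← h7] at h6
    linarith
  filter_upwards [measure_eq_zero_iff_ae_notMem.1 hPE, hci.ae_eq_mk] with ω e1 e2
  rw [e2]
  exact not_lt.1 e1

theorem zeroSet_eq_eligiblePos (hR : IsConditionalRiskMeasure ℱ P m r R R0)
    (hnorm : IsNormalized R) (hconv : IsConditionallyConvex ℱ P r R) (hcuc : IsCUC ℱ P m r R) :
    ∀ᵐ ω ∂P, R0 ω = eligiblePos d m := by
  have hzero := zero_eq_MtPos hR hnorm hconv hcuc
  have h1 := zeroSet_subset hR hnorm hconv (K := eligiblePos d m) isClosed_eligiblePos fun Z hZ => by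
    rw [hzero] at hZ
    exact hZ.2.2
  have h2 := ae_subset_of_forall_mem (P := P) hR.zeroSet_closed (K := eligiblePos d m) (E := univ)
    fun x hx => by
      have hmem := MtPos_subset_zero hR hnorm hconv
        (indLp_mem_MtPos (P := P) (p := p) (ℱ := ℱ) (r := r) MeasurableSet.univ hx)
      rw [hR.zero_eq] at hmem
      filter_upwards [hmem.2.2, coeFn_indLp (P := P) (p := p)
        (ℱ.le r univ MeasurableSet.univ) x] with ω e1 e2 _
      rwa [e2, indicator_univ] at e1
  filter_upwards [h1, h2] with ω e1 e2
  exact e1.antisymm (e2 (mem_univ ω))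

theorem regularRiskMeasure_of (hR : IsConditionalRiskMeasure ℱ P m r R R0)
    (hnorm : IsNormalized R) (hconv : IsConditionallyConvex ℱ P r R) (hcuc : IsCUC ℱ P m r R)
    (hT : ℱ ⊤ = mΩ) (hm : 0 < m) (hmd : m ≤ d)
    (hint : ∀ (w : Ω → Vec d) (X : Lp (Vec d) p P),
      w ∈ LSel ℱ P q r (fun ω => posDual (R0 ω) \ perp (eligible d m)) →
      MemL1 P (scalarization P R w X)) : RegularRiskMeasure ℱ q m r R := by
  have hw := LSel_eq_weights (P := P) (ℱ := ℱ) (q := q) (r := r)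
    (zeroSet_eq_eligiblePos hR hnorm hconv hcuc)
  rw [hw] at hint
  refine ⟨hR.subset_Mt, fun X u hu k hk => ?_, fun X Y h => hR.monotone X Y ⟨Lp.memLp _, ?_, h⟩,
    hR.translative, zero_eq_MtPos hR hnorm hconv hcuc, hconv, hcuc, fun X => ?_,
    fun w hw X => hint w X hw⟩
  · rw [hR.upper X]
    exact add_mem_add hu hk
  · rw [hT]
    exact (Lp.memLp _).1
  -- The essential infimum over an empty set is `⊤`, which is not in `L^1`: integrable
  -- scalarizations force `R X` to be nonempty.
  · by_contra hne
    rw [not_nonempty_iff_eq_empty] at hne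
    obtain ⟨g, -, hg⟩ := hint _ X (one_mem_weights (P := P) (ℱ := ℱ) (q := q) (r := r) hm hmd)
    have htop : (fun _ => (⊤ : EReal)) ≤ᵐ[P] scalarization P R
        (fun _ => WithLp.toLp 2 fun i => if i.val < m then 1 else 0) X := by
      refine le_essInfFam aemeasurable_const ?_
      rintro _ ⟨u, hu, -⟩
      rw [hne] at hu
      exact absurd hu (notMem_empty u)
    have hf : ∀ᵐ _ ∂P, False := by
      filter_upwards [htop, hg] with ω e1 e2
      rw [e2] at e1
      exact EReal.coe_ne_top _ (top_le_iff.1 e1)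
    exact hf.exists.elim fun _ h => h

end ZeroRiskPos

end MSR

theorem lemma4p6 {Ω ι : Type*} [mΩ : MeasurableSpace Ω] (P : Measure Ω) [IsProbabilityMeasure P]
    [LinearOrder ι] [OrderBot ι] [OrderTop ι] (ℱ : Filtration ι mΩ) (hℱ : StandardFiltration ℱ P)
    (p q : ℝ≥0∞) [Fact (1 ≤ p)] [p.HolderConjugate q]
    (d m : ℕ) (hm : 1 ≤ m) (hmd : m ≤ d)
    (R : ι → Lp (Vec d) p P → Set (Lp (Vec d) p P)) (R0 : ι → Ω → Set (Vec d))
    (hR : ∀ r, IsConditionalRiskMeasure ℱ P m r (R r) (R0 r))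
    (hnorm : ∀ r, IsNormalized (R r))
    (hcuc : ∀ r, IsCUC ℱ P m r (R r))
    (hconv : ∀ r, IsConditionallyConvex ℱ P r (R r))
    (hint : ∀ (r : ι) (w : Ω → Vec d) (X : Lp (Vec d) p P),
      w ∈ LSel ℱ P q r (fun ω => posDual (R0 r ω) \ perp (eligible d m)) →
      MemL1 P (scalarization P (R r) w X))
    (t s : ι) (hts : t < s) :
    List.TFAE [
      acceptance (R t) ⊆ steppedAcceptance ℱ P m s (R t) + acceptance (R s),
      ∀ (X : Lp (Vec d) p P) (w : Ω → Vec d),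
        w ∈ LSel ℱ P q t (fun ω => posDual (R0 t ω) \ perp (eligible d m)) →
        recursiveBound ℱ P q m t s (R t) (R s) w X ≤ᵐ[P] scalarization P (R t) w X,
      ∀ (w : Ω → Vec d),
        w ∈ LSel ℱ P q t (fun ω => posDual (R0 t ω) \ perp (eligible d m)) →
        ∀ (Q : Fin d → Measure Ω) (mperp : Ω → Vec d),
        (Q, mperp) ∈ dualSteppedAt ℱ P p q m t s w →
        ∀ (S : Fin d → Measure Ω) (nperp : Ω → Vec d),
        (S, nperp) ∈ dualTerminalAt ℱ P q m s (wStep ℱ P t s Q (w + mperp)) →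
        extendedPenalty ℱ P t s (acceptance (R t)) w Q mperp S nperp ≤ᵐ[P] fun ω =>
          penalty ℱ P t (steppedAcceptance ℱ P m s (R t)) Q (w + mperp) ω
          + genCondExp P (ℱ t) (penalty ℱ P s (acceptance (R s)) S
              (wStep ℱ P t s Q (w + mperp) + nperp)) ω] ∧
    List.TFAE [
      steppedAcceptance ℱ P m s (R t) + acceptance (R s) ⊆ acceptance (R t),
      ∀ (X : Lp (Vec d) p P) (w : Ω → Vec d),
        w ∈ LSel ℱ P q t (fun ω => posDual (R0 t ω) \ perp (eligible d m)) →
        scalarization P (R t) w X ≤ᵐ[P] recursiveBound ℱ P q m t s (R t) (R s) w X,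
      ∀ (w : Ω → Vec d),
        w ∈ LSel ℱ P q t (fun ω => posDual (R0 t ω) \ perp (eligible d m)) →
        ∀ (Q : Fin d → Measure Ω) (mperp : Ω → Vec d),
        (Q, mperp) ∈ dualSteppedAt ℱ P p q m t s w →
        ∀ (S : Fin d → Measure Ω) (nperp : Ω → Vec d),
        (S, nperp) ∈ dualTerminalAt ℱ P q m s (wStep ℱ P t s Q (w + mperp)) →
        (fun ω =>
          penalty ℱ P t (steppedAcceptance ℱ P m s (R t)) Q (w + mperp) ω
          + genCondExp P (ℱ t) (penalty ℱ P s (acceptance (R s)) S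
              (wStep ℱ P t s Q (w + mperp) + nperp)) ω) ≤ᵐ[P]
        extendedPenalty ℱ P t s (acceptance (R t)) w Q mperp S nperp] := by
  have hT := hℱ.terminal
  have hreg := fun r => regularRiskMeasure_of (q := q) (hR r) (hnorm r) (hconv r) (hcuc r) hT hm hmd
    (hint r)
  have hw := LSel_eq_weights (P := P) (ℱ := ℱ) (q := q) (r := t)
    (zeroSet_eq_eligiblePos (hR t) (hnorm t) (hconv t) (hcuc t))
  rw [hw]
  exact ⟨tfae_subset (hreg t) (hreg s) hts.le hT hm hmd,
    tfae_superset (hreg t) (hreg s) hts.le hT hm hmd⟩
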